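/- Write $\mathbb T=\mathbb R/\mathbb Z$. Let $H:\mathbb R\times\mathbb T\times\mathbb R\to\mathbb R$ be a $C^2$ Hamiltonian, $1$-periodic in $t$, convex in $p$ with $\partial_{pp}H>0$, with $H(t,x,p)/|p|\to\infty$ as $|p|\to\infty$ for each $(t,x)$, and such that the flow of $X=(\partial_pH,-\partial_xH)$ on $\mathbb T\times\mathbb R$ is complete; let $\phi_{s,t}$ be this flow from time $s$ to time $t$, $\phi=\phi_{0,1}$, and $L(t,x,v)=\sup_p\,(pv-H(t,x,p))$. Let $\mathcal E$ be the set of functions $f:\mathbb T\to\mathbb R$ that are locally the sum of a continuous and of a decreasing function. Let $G^-(f)$ and $G^+(f)$ be the graphs of the right limits and of the left limits of $f$, and let $G(f)=G^-(f)\cap G^+(f)$. An entropy solution on $[t_0,\infty)$ is a function $y\in C([t_0,\infty),L^1(\mathbb T))$ such that $y$ and $H(t,x,y)$ are locally integrable on $[t_0,\infty)\times\mathbb T$, such that $$\int_{[t_0,\infty)\times\mathbb T}\big(y\,\partial_t\varphi+H(t,x,y)\,\partial_x\varphi\big)\,dt\,dx+\int_{\mathbb T}y(t_0,x)\,\varphi(t_0,x)\,dx=0$$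 for all smooth compactly supported $\varphi:[t_0,\infty)\times\mathbb T\to\mathbb R$, and such that for some positive non-increasing function $K$ on $(t_0,\infty)$ one has $y_t(x+\delta)-y_t(x)\le K(t)\delta$ for all $t>t_0$, $x\in\mathbb T$, $\delta>0$. For functions $f,g$ on $\mathbb T$ we write $g=E(f)$ if some entropy solution $y$ on $[0,\infty)$ satisfies $y_0=f$ and $y_1=g$ almost everywhere. Let $y$ be an entropy solution on $[t_0,\infty)$ and $c=\int_{\mathbb T}y(t_0,x)\,dx$. A $y$-characteristic on an interval $I\subset[t_0,\infty)$ is a trajectory $\gamma:I\to\mathbb T\times\mathbb R$ of $X$ with $\gamma(s)\in\overline{G(y_s)}$ for all $s\in I$. A curve $\gamma=(x,p):[t,t']\to\mathbb T\times\mathbb R$ is calibrated by $u$ if $x$ is absolutely continuous, $u(t',x(t'))=u(t,x(t))+\int_t^{t'}\big(L(s,x,\dot x)-c\,\dot x\big)\,ds$ with a convergent integral, and $p(s)=\partial_vL(s,x(s),\dot x(s))$ for all $s\in[t,t']$. **Theorem (Characteristics).** (i) Let $u:[t_0,\infty)\times\mathbb T\to\mathbb R$ be a viscosity solution (in particular continuous)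 of $\partial_tu+H(t,x,c+\partial_xu)=0$ with $y=c+\partial_xu$, meaning that $u_t$ is a primitive of $y_t-c$ for every $t\ge t_0$. Let $t_0<t<t'$ and let $\gamma:[t,t']\to\mathbb T\times\mathbb R$ be a curve. Then $\gamma$ is calibrated by $u$ if and only if it is a trajectory of $X$ with $\gamma(s)\in\overline{G(y_s)}$ for all $s\in[t,t')$. In particular, $\gamma$ is a $y$-characteristic on $[t,t']$ if and only if it is calibrated by $u$ and $\gamma(t')\in\overline{G(y_{t'})}$. (ii) For every $t>t_0$ and every $(x,p)\in\overline{G(y_t)}$ there is a unique $y$-characteristic $\gamma:(t_0,t]\to\mathbb T\times\mathbb R$ with $\gamma(t)=(x,p)$. (iii) If $t>t_0$ and $\gamma=(x,p):(t_0,t]\to\mathbb T\times\mathbb R$ is a $y$-characteristic, then for each $s\in(t_0,t)$ the function $y_s$ is continuous at $x(s)$ and $y(s,x(s))=p(s)$. (iv) If $y_{t_0}\in\mathcal E$, then for every $t>t_0$ and every $(x,p)\in\overline{G(y_t)}$ there is a unique $y$-characteristic $\gamma=(x,p):[t_0,t]\to\mathbb T\times\mathbb R$ with $\gamma(t)=(x,p)$;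 moreover $y_{t_0}$ is continuous at $x(t_0)$ and $y(t_0,x(t_0))=p(t_0)$. Consequently $\overline{G(y_{t'})}\subset\phi_{t,t'}(G(y_t))$ whenever $t_0<t<t'$, and $\overline{G(g)}\subset\phi(G(f))$ whenever $f,g\in\mathcal E$ and $g=E(f)$. -/

import Mathlib

open Set Filter Topology MeasureTheory

namespace Burgers

/-- The circle `ℝ / ℤ`, with its translation invariant probability measure `volume`. -/
abbrev Circ : Type := UnitAddCircle

/-- The derivative of a function on the circle. -/
noncomputable def circDeriv (f : Circ → ℝ) (x : Circ) : ℝ :=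
  deriv (fun h : ℝ => f (x + (h : Circ))) 0

/-- `γ = (x, p)` solves `x' = ∂_p H(s, x, p)`, `p' = - ∂_x H(s, x, p)` on the interval `I`
(with one-sided derivatives at end points of `I` that belong to `I`).  The curve on the circle
is differentiated through a lift `ξ` to the real line. -/
def IsTrajectory (H : ℝ → Circ → ℝ → ℝ) (I : Set ℝ) (γ : ℝ → Circ × ℝ) : Prop :=
  ∃ ξ : ℝ → ℝ, (∀ s ∈ I, (γ s).1 = (ξ s : Circ)) ∧
    ∀ s ∈ I,
      HasDerivWithinAt ξ (deriv (fun q => H s (γ s).1 q) (γ s).2) I s ∧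
      HasDerivWithinAt (fun r => (γ r).2) (-(circDeriv (fun z => H s z (γ s).2) (γ s).1)) I s

/-- The standing hypotheses on the Hamiltonian: `C²`, `1`-periodic in time, convex in `p` with
`∂_pp H > 0`, superlinear in `p`, and with a complete Hamiltonian flow. -/
structure IsTonelliHamiltonian (H : ℝ → Circ → ℝ → ℝ) : Prop where
  contDiff : ContDiff ℝ 2 (fun z : ℝ × ℝ × ℝ => H z.1 (z.2.1 : Circ) z.2.2)
  periodic : ∀ t x p, H (t + 1) x p = H t x p
  convex : ∀ t x, ConvexOn ℝ univ (H t x)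
  deriv2_pos : ∀ t x p, 0 < iteratedDeriv 2 (H t x) p
  superlinear : ∀ t x, Tendsto (fun p : ℝ => H t x p / |p|) (cocompact ℝ) atTop
  complete : ∀ (t₀ : ℝ) (z₀ : Circ × ℝ),
    ∃ γ : ℝ → Circ × ℝ, IsTrajectory H univ γ ∧ γ t₀ = z₀

/-- The flow `φ_{s,t}` of the Hamiltonian vector field: follow the trajectory which is at `z` at
time `s` until time `t`. -/
noncomputable def flow {H : ℝ → Circ → ℝ → ℝ} (hH : IsTonelliHamiltonian H) (s t : ℝ)
    (z : Circ × ℝ) : Circ × ℝ :=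
  (hH.complete s z).choose t

/-- The Lagrangian `L(t, x, v) = sup_p (p v - H(t, x, p))`. -/
noncomputable def lagrangian (H : ℝ → Circ → ℝ → ℝ) (t : ℝ) (x : Circ) (v : ℝ) : ℝ :=
  ⨆ p : ℝ, (p * v - H t x p)

/-- The set `𝓔` of functions on the circle which are locally the sum of a continuous and of a
decreasing function. -/
def classE : Set (Circ → ℝ) :=
  {f | ∀ x : Circ, ∃ ε > (0 : ℝ), ∃ g d : ℝ → ℝ,
    ContinuousOn g (Ioo (-ε) ε) ∧ AntitoneOn d (Ioo (-ε) ε) ∧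
    ∀ h ∈ Ioo (-ε) ε, f (x + (h : Circ)) = g h + d h}

/-- The graph `G⁻(f)` of the right limits of `f`. -/
def graphMinus (f : Circ → ℝ) : Set (Circ × ℝ) :=
  {z | Tendsto (fun h : ℝ => f (z.1 + (h : Circ))) (𝓝[>] 0) (𝓝 z.2)}

/-- The graph `G⁺(f)` of the left limits of `f`. -/
def graphPlus (f : Circ → ℝ) : Set (Circ × ℝ) :=
  {z | Tendsto (fun h : ℝ => f (z.1 + (h : Circ))) (𝓝[<] 0) (𝓝 z.2)}

/-- The graph `G(f) = G⁻(f) ∩ G⁺(f)`. -/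
def graph (f : Circ → ℝ) : Set (Circ × ℝ) := graphMinus f ∩ graphPlus f

/-- Smooth test functions on `[t₀, ∞) × 𝕋` with compact support (restrictions of smooth functions
on `ℝ × 𝕋`, vanishing for large times). -/
def IsTestFunction (φ : ℝ → Circ → ℝ) : Prop :=
  ContDiff ℝ ((⊤ : ℕ∞) : WithTop ℕ∞) (fun z : ℝ × ℝ => φ z.1 (z.2 : Circ)) ∧
    ∃ T : ℝ, ∀ t ≥ T, ∀ x, φ t x = 0

/-- Entropy solutions `y : [t₀, ∞) × 𝕋 → ℝ` of `∂_t y + ∂_x (H(t, x, y)) = 0`: elements of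
`C([t₀, ∞), L¹(𝕋))` solving the equation, with initial value `y t₀`, in the sense of distributions,
and satisfying the Oleinik inequalities. Values at times `t < t₀` are irrelevant. -/
structure IsEntropySolution (H : ℝ → Circ → ℝ → ℝ) (t₀ : ℝ) (y : ℝ → Circ → ℝ) : Prop where
  integrable : ∀ t ≥ t₀, Integrable (y t)
  continuous_L1 : ∀ t ≥ t₀,
    Tendsto (fun s => ∫ x, |y s x - y t x|) (𝓝[Ici t₀] t) (𝓝 0)
  locInt : ∀ T : ℝ, IntegrableOn (fun z : ℝ × Circ => y z.1 z.2) (Icc t₀ T ×ˢ univ)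
  locInt_H : ∀ T : ℝ,
    IntegrableOn (fun z : ℝ × Circ => H z.1 z.2 (y z.1 z.2)) (Icc t₀ T ×ˢ univ)
  weak : ∀ φ : ℝ → Circ → ℝ, IsTestFunction φ →
    (∫ z in Ici t₀ ×ˢ (univ : Set Circ),
        (y z.1 z.2 * deriv (fun s => φ s z.2) z.1
          + H z.1 z.2 (y z.1 z.2) * circDeriv (φ z.1) z.2))
      + ∫ x, y t₀ x * φ t₀ x = 0
  oleinik : ∃ K : ℝ → ℝ, (∀ t > t₀, 0 < K t) ∧ AntitoneOn K (Ioi t₀) ∧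
    ∀ t > t₀, ∀ x : Circ, ∀ δ : ℝ, 0 < δ → y t (x + (δ : Circ)) - y t x ≤ K t * δ

/-- `g = E(f)` in `L¹(𝕋)`: `g` is the value at time `1` of an entropy solution with value `f` at
time `0`. -/
def IsEntropyImage (H : ℝ → Circ → ℝ → ℝ) (f g : Circ → ℝ) : Prop :=
  ∃ y : ℝ → Circ → ℝ, IsEntropySolution H 0 y ∧ y 0 =ᵐ[volume] f ∧ y 1 =ᵐ[volume] g

/-- Viscosity solutions `u : [t₀, ∞) × 𝕋 → ℝ`, in the sense of Crandall and Lions, of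
`∂_t u + H(t, x, c + ∂_x u) = 0`. -/
structure IsViscositySolution (H : ℝ → Circ → ℝ → ℝ) (c t₀ : ℝ) (u : ℝ → Circ → ℝ) : Prop where
  continuousOn : ContinuousOn (fun z : ℝ × Circ => u z.1 z.2) (Ici t₀ ×ˢ univ)
  sub : ∀ φ : ℝ → Circ → ℝ, ContDiff ℝ 1 (fun z : ℝ × ℝ => φ z.1 (z.2 : Circ)) →
    ∀ t > t₀, ∀ x : Circ, IsLocalMax (fun z : ℝ × Circ => u z.1 z.2 - φ z.1 z.2) (t, x) →
      deriv (fun s => φ s x) t + H t x (c + circDeriv (φ t) x) ≤ 0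
  super : ∀ φ : ℝ → Circ → ℝ, ContDiff ℝ 1 (fun z : ℝ × ℝ => φ z.1 (z.2 : Circ)) →
    ∀ t > t₀, ∀ x : Circ, IsLocalMin (fun z : ℝ × Circ => u z.1 z.2 - φ z.1 z.2) (t, x) →
      0 ≤ deriv (fun s => φ s x) t + H t x (c + circDeriv (φ t) x)

/-- `y = c + ∂_x u` at every time `t ≥ t₀`, in the weak sense: `u t` is a primitive of
`y t - c`. -/
def IsPotential (c t₀ : ℝ) (y u : ℝ → Circ → ℝ) : Prop :=
  ∀ t ≥ t₀, ∀ (x : Circ) (h : ℝ),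
    u t (x + (h : Circ)) - u t x = ∫ r in (0 : ℝ)..h, (y t (x + (r : Circ)) - c)

/-- `γ = (x, p)` is calibrated by `u` on `[a, b]`, `a < b`: the curve `x` is absolutely continuous,
`u(b, x(b)) = u(a, x(a)) + ∫_a^b (L(s, x, x') - c x') ds` (a convergent integral), and
`p = ∂_v L(s, x, x')`.  Here `x'` is computed through a lift `ξ`. -/
def IsCalibrated (H : ℝ → Circ → ℝ → ℝ) (c : ℝ) (u : ℝ → Circ → ℝ) (a b : ℝ)
    (γ : ℝ → Circ × ℝ) : Prop :=
  ∃ ξ : ℝ → ℝ, AbsolutelyContinuousOnInterval ξ a b ∧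
    (∀ s ∈ Icc a b, (γ s).1 = (ξ s : Circ)) ∧
    IntervalIntegrable (fun s => lagrangian H s (γ s).1 (derivWithin ξ (Icc a b) s)
      - c * derivWithin ξ (Icc a b) s) volume a b ∧
    u b (γ b).1 = u a (γ a).1 +
      ∫ s in a..b, (lagrangian H s (γ s).1 (derivWithin ξ (Icc a b) s)
        - c * derivWithin ξ (Icc a b) s) ∧
    ∀ s ∈ Icc a b, (γ s).2 = deriv (lagrangian H s (γ s).1) (derivWithin ξ (Icc a b) s)

/-- A `y`-characteristic on `I`: a trajectory of the Hamiltonian vector field with `γ(s)` in the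
closure of the graph of `y_s` for all `s ∈ I`. -/
def IsCharacteristic (H : ℝ → Circ → ℝ → ℝ) (y : ℝ → Circ → ℝ) (I : Set ℝ)
    (γ : ℝ → Circ × ℝ) : Prop :=
  IsTrajectory H I γ ∧ ∀ s ∈ I, γ s ∈ closure (graph (y s))

end Burgers

open Burgers

namespace Burgers

/-! ### Second order calculus for the Hamiltonian on the universal cover -/

/-! Everything is read off a potential on the universal cover: a function `u` with `y = c + ∂ₓu`.
The structure `SemiconcavePotential` records what is used: `u` is continuous, `y` obeys the Oleinik
bound at positive times (so `u` is semiconcave in space there), and the Hamilton-Jacobi equation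
holds after integration over space-time rectangles. Neither a representation formula for `u` nor the
existence of minimizers is needed.

The first pillar is `chain_rule`. Averages of `u` over short segments are `C¹`. Differentiating them
along an absolutely continuous curve `ξ` and shrinking the segment from one side shows that `u`
varies along `ξ` by the integral of `(q - c) ξ' - h(ξ, q)`, where `q` is the right (or equally the
left) limit of `y` at `ξ`. The Fenchel inequality then bounds increments of `u` by the Lagrangian
action, and the same bound along affine variations of a trajectory costs only a quadratic error
(`exists_variation_le`).

The second pillar is `calibrated_of_differentiableAt`. Follow backward a trajectory `(ξ, p)` issued
from a differentiability point of `y b`, and let `ω(s) ≥ 0` be the excess of its action on `[s, b]`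
over the increment of `u`. Comparison with translated curves, using a lower parabola for `u` at time
`b` and the semiconcavity upper parabola at time `s`, gives `(q - p)² ≤ const · ω`. By the chain
rule `ω(s)` is the integral over `[s, b]` of the convexity gap of `h` between `p` and `q`, which is
at most a multiple of `(q - p)²`. Gronwall then gives `ω = 0`: the trajectory is calibrated.
Differentiability points are dense, and trajectories depend continuously on their end point, so this
extends to the closure of the graph (`calibrated_of_mem_closure`).

Conversely a calibrated trajectory gives `u` a lower parabola of slope `p - c` at its starting time.
Since `y` can only jump down, this forces continuity of `y` there, with value `p`
(`continuousAt_of_calibrated`). The argument works at `t₀` as soon as one-sided limits exist in the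
right order, which is what `classE` provides. Characteristics are therefore the backward
trajectories, and existence, uniqueness, continuity and the inclusions follow from the flow.

For the calibration criterion, equality in Fenchel along a calibrated curve identifies both side
limits of `y` with the momentum almost everywhere, and translation of the curve gives the integrated
Euler-Lagrange equation (`exists_trajectory_of_calibrated`).

It remains to build the potential. The weak equation is tested against products, and Parseval's
identity turns this into the integrated Hamilton-Jacobi equation. A given viscosity solution with
the same space derivative differs from this potential by a function of time, which is constant by a
perturbed test function argument (`mul_deriv_nonpos_of_isLocalMax`). -/

lemma exists_taylor_two {f f' f'' : ℝ → ℝ} (hf : ∀ x, HasDerivAt f (f' x) x)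
    (hf' : ∀ x, HasDerivAt f' (f'' x) x) (p q : ℝ) :
    ∃ z ∈ uIcc p q, f q = f p + f' p * (q - p) + f'' z / 2 * (q - p) ^ 2 := by
  rcases eq_or_ne p q with rfl | hpq
  · exact ⟨p, by simp, by simp⟩
  have hne : (q - p) ^ 2 ≠ 0 := pow_ne_zero _ (sub_ne_zero.2 hpq.symm)
  -- With this `A` the remainder vanishes at `p` and at `q`, and its derivative vanishes at `p`.
  -- Rolle applied twice gives the point, without continuity of the second derivative.
  set A := (f q - f p - f' p * (q - p)) / (q - p) ^ 2 with hA
  have hAq : A * (q - p) ^ 2 = f q - f p - f' p * (q - p) := div_mul_cancel₀ _ hne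
  have hg : ∀ x, HasDerivAt (fun x => f x - f p - f' p * (x - p) - A * (x - p) ^ 2)
      (f' x - f' p - 2 * A * (x - p)) x := fun x => by
    have h1 := (hasDerivAt_id x).sub_const p
    refine ((((hf x).sub_const (f p)).sub (h1.const_mul (f' p))).sub
      ((h1.pow 2).const_mul A)).congr_deriv ?_
    simp; ring
  have hg' : ∀ x, HasDerivAt (fun x => f' x - f' p - 2 * A * (x - p)) (f'' x - 2 * A) x :=
    fun x => by
    have h1 := (hasDerivAt_id x).sub_const p
    exact (((hf' x).sub_const (f' p)).sub (h1.const_mul (2 * A))).congr_deriv (by simp)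
  have key : ∃ z ∈ uIcc p q, f'' z = 2 * A := by
    rcases hpq.lt_or_gt with h | h
    · obtain ⟨r, hr, hr0⟩ := exists_hasDerivAt_eq_zero h
        (fun x _ => (hg x).continuousAt.continuousWithinAt) (by simp [hAq]) fun x _ => hg x
      obtain ⟨z, hz, hz0⟩ := exists_hasDerivAt_eq_zero hr.1
        (fun x _ => (hg' x).continuousAt.continuousWithinAt) (by simp [hr0]) fun x _ => hg' x
      exact ⟨z, by rw [uIcc_of_le h.le]; exact ⟨hz.1.le, hz.2.le.trans hr.2.le⟩, by linarith⟩
    · obtain ⟨r, hr, hr0⟩ := exists_hasDerivAt_eq_zero h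
        (fun x _ => (hg x).continuousAt.continuousWithinAt) (by simp [hAq]) fun x _ => hg x
      obtain ⟨z, hz, hz0⟩ := exists_hasDerivAt_eq_zero hr.2
        (fun x _ => (hg' x).continuousAt.continuousWithinAt) (by simp [hr0]) fun x _ => hg' x
      exact ⟨z, by rw [uIcc_of_ge h.le]; exact ⟨hr.1.le.trans hz.1.le, hz.2.le⟩, by linarith⟩
  obtain ⟨z, hz, hzA⟩ := key
  refine ⟨z, hz, ?_⟩
  rw [hzA]; linarith

/-- The partial derivative with respect to the position. -/
noncomputable def dX (h : ℝ → ℝ → ℝ → ℝ) (s x p : ℝ) : ℝ := deriv (fun z => h s z p) x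

/-- The partial derivative with respect to the momentum. -/
noncomputable def dP (h : ℝ → ℝ → ℝ → ℝ) (s x p : ℝ) : ℝ := deriv (h s x) p

/-- Joint regularity of a function of time, position and momentum. -/
def Smooth (n : WithTop ℕ∞) (h : ℝ → ℝ → ℝ → ℝ) : Prop :=
  ContDiff ℝ n (fun z : ℝ × ℝ × ℝ => h z.1 z.2.1 z.2.2)

section Calculus

variable {h : ℝ → ℝ → ℝ → ℝ}

lemma Smooth.hasDerivAt_fderiv_snd_snd (hh : Smooth 1 h) (s x p : ℝ) :
    HasDerivAt (h s x)
      (fderiv ℝ (fun z : ℝ × ℝ × ℝ => h z.1 z.2.1 z.2.2) (s, x, p) (0, 0, 1)) p := by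
  have h1 : HasDerivAt (fun q : ℝ => ((s, x, q) : ℝ × ℝ × ℝ)) (0, 0, 1) p :=
    (hasDerivAt_const p s).prodMk ((hasDerivAt_const p x).prodMk (hasDerivAt_id p))
  exact ((ContDiff.differentiable hh (by simp)) (s, x, p)).hasFDerivAt.comp_hasDerivAt p h1

lemma Smooth.hasDerivAt_fderiv_snd_fst (hh : Smooth 1 h) (s x p : ℝ) :
    HasDerivAt (fun z => h s z p)
      (fderiv ℝ (fun z : ℝ × ℝ × ℝ => h z.1 z.2.1 z.2.2) (s, x, p) (0, 1, 0)) x := by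
  have h1 : HasDerivAt (fun q : ℝ => ((s, q, p) : ℝ × ℝ × ℝ)) (0, 1, 0) x :=
    (hasDerivAt_const x s).prodMk ((hasDerivAt_id x).prodMk (hasDerivAt_const x p))
  exact ((ContDiff.differentiable hh (by simp)) (s, x, p)).hasFDerivAt.comp_hasDerivAt x h1

lemma Smooth.hasDerivAt_dP (hh : Smooth 1 h) (s x p : ℝ) : HasDerivAt (h s x) (dP h s x p) p :=
  (hh.hasDerivAt_fderiv_snd_snd s x p).differentiableAt.hasDerivAt

lemma Smooth.hasDerivAt_dX (hh : Smooth 1 h) (s x p : ℝ) :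
    HasDerivAt (fun z => h s z p) (dX h s x p) x :=
  (hh.hasDerivAt_fderiv_snd_fst s x p).differentiableAt.hasDerivAt

lemma Smooth.dP (hh : Smooth 2 h) : Smooth 1 (dP h) := by
  have h1 : Smooth 1 h := ContDiff.of_le hh (by norm_num)
  have : (fun z : ℝ × ℝ × ℝ => Burgers.dP h z.1 z.2.1 z.2.2) = fun z =>
      fderiv ℝ (fun z : ℝ × ℝ × ℝ => h z.1 z.2.1 z.2.2) z (0, 0, 1) := by
    ext z; exact (h1.hasDerivAt_fderiv_snd_snd z.1 z.2.1 z.2.2).deriv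
  unfold Smooth
  rw [this]
  exact (ContDiff.fderiv_right hh (by norm_num)).clm_apply contDiff_const

lemma Smooth.dX (hh : Smooth 2 h) : Smooth 1 (dX h) := by
  have h1 : Smooth 1 h := ContDiff.of_le hh (by norm_num)
  have : (fun z : ℝ × ℝ × ℝ => Burgers.dX h z.1 z.2.1 z.2.2) = fun z =>
      fderiv ℝ (fun z : ℝ × ℝ × ℝ => h z.1 z.2.1 z.2.2) z (0, 1, 0) := by
    ext z; exact (h1.hasDerivAt_fderiv_snd_fst z.1 z.2.1 z.2.2).deriv
  unfold Smooth
  rw [this]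
  exact (ContDiff.fderiv_right hh (by norm_num)).clm_apply contDiff_const

lemma Smooth.continuous_dP (hh : Smooth 1 h) :
    Continuous (fun z : ℝ × ℝ × ℝ => Burgers.dP h z.1 z.2.1 z.2.2) := by
  have : (fun z : ℝ × ℝ × ℝ => Burgers.dP h z.1 z.2.1 z.2.2) = fun z =>
      fderiv ℝ (fun z : ℝ × ℝ × ℝ => h z.1 z.2.1 z.2.2) z (0, 0, 1) := by
    ext z; exact (hh.hasDerivAt_fderiv_snd_snd z.1 z.2.1 z.2.2).deriv
  rw [this]
  exact ((ContDiff.fderiv_right (m := 0) hh (by norm_num)).clm_apply contDiff_const).continuous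

lemma Smooth.continuous_dX (hh : Smooth 1 h) :
    Continuous (fun z : ℝ × ℝ × ℝ => Burgers.dX h z.1 z.2.1 z.2.2) := by
  have : (fun z : ℝ × ℝ × ℝ => Burgers.dX h z.1 z.2.1 z.2.2) = fun z =>
      fderiv ℝ (fun z : ℝ × ℝ × ℝ => h z.1 z.2.1 z.2.2) z (0, 1, 0) := by
    ext z; exact (hh.hasDerivAt_fderiv_snd_fst z.1 z.2.1 z.2.2).deriv
  rw [this]
  exact ((ContDiff.fderiv_right (m := 0) hh (by norm_num)).clm_apply contDiff_const).continuous

lemma Smooth.continuous (hh : Smooth 1 h) :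
    Continuous (fun z : ℝ × ℝ × ℝ => h z.1 z.2.1 z.2.2) := ContDiff.continuous hh

lemma exists_bound_on_box {g : ℝ → ℝ → ℝ → ℝ}
    (hg : Continuous (fun z : ℝ × ℝ × ℝ => g z.1 z.2.1 z.2.2)) (a b X R : ℝ) :
    ∃ C ≥ 0, ∀ s ∈ Icc a b, ∀ x, |x| ≤ X → ∀ p, |p| ≤ R → |g s x p| ≤ C := by
  obtain ⟨C, hC⟩ := (isCompact_Icc.prod (isCompact_Icc.prod isCompact_Icc) :
    IsCompact (Icc a b ×ˢ Icc (-X) X ×ˢ Icc (-R) R)).exists_bound_of_continuousOn hg.continuousOn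
  refine ⟨max C 0, le_max_right _ _, fun s hs x hx p hp => ?_⟩
  exact (hC (s, x, p) ⟨hs, abs_le.1 hx, abs_le.1 hp⟩).trans (le_max_left _ _)

lemma exists_pos_lower_bound_on_box {g : ℝ → ℝ → ℝ → ℝ}
    (hg : Continuous (fun z : ℝ × ℝ × ℝ => g z.1 z.2.1 z.2.2)) (hpos : ∀ s x p, 0 < g s x p)
    (a b X R : ℝ) :
    ∃ κ > 0, ∀ s ∈ Icc a b, ∀ x, |x| ≤ X → ∀ p, |p| ≤ R → κ ≤ g s x p := by
  rcases (Icc a b ×ˢ Icc (-X) X ×ˢ Icc (-R) R).eq_empty_or_nonempty with he | hne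
  · refine ⟨1, one_pos, fun s hs x hx p hp => ?_⟩
    have : (s, x, p) ∈ Icc a b ×ˢ Icc (-X) X ×ˢ Icc (-R) R := ⟨hs, abs_le.1 hx, abs_le.1 hp⟩
    rw [he] at this
    exact this.elim
  · obtain ⟨z, -, hz⟩ := (isCompact_Icc.prod (isCompact_Icc.prod isCompact_Icc) :
      IsCompact (Icc a b ×ˢ Icc (-X) X ×ˢ Icc (-R) R)).exists_isMinOn hne hg.continuousOn
    exact ⟨_, hpos z.1 z.2.1 z.2.2, fun s hs x hx p hp =>
      hz (show (s, x, p) ∈ _ from ⟨hs, abs_le.1 hx, abs_le.1 hp⟩)⟩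

lemma abs_le_of_mem_uIcc {p q z R : ℝ} (hp : |p| ≤ R) (hq : |q| ≤ R) (hz : z ∈ uIcc p q) :
    |z| ≤ R := by
  rw [abs_le] at *
  rcases le_total p q with h | h
  · rw [uIcc_of_le h] at hz; exact ⟨hp.1.trans hz.1, hz.2.trans hq.2⟩
  · rw [uIcc_of_ge h] at hz; exact ⟨hq.1.trans hz.1, hz.2.trans hp.2⟩

/-- The gap in the tangent inequality is at most quadratic on compact sets. -/
lemma Smooth.exists_deficit_le (hh : Smooth 2 h) (a b X R : ℝ) :
    ∃ C ≥ 0, ∀ s ∈ Icc a b, ∀ x, |x| ≤ X → ∀ p, |p| ≤ R → ∀ q, |q| ≤ R →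
      h s x q - h s x p - (q - p) * Burgers.dP h s x p ≤ C * (q - p) ^ 2 := by
  have h1 : Smooth 1 h := ContDiff.of_le hh (by norm_num)
  obtain ⟨C, hC0, hC⟩ := exists_bound_on_box hh.dP.continuous_dP a b X R
  refine ⟨C, hC0, fun s hs x hx p hp q hq => ?_⟩
  obtain ⟨z, hz, he⟩ := exists_taylor_two (fun p => h1.hasDerivAt_dP s x p)
    (fun p => hh.dP.hasDerivAt_dP s x p) p q
  have := (abs_le.1 (hC s hs x hx z (abs_le_of_mem_uIcc hp hq hz))).2
  rw [he]
  nlinarith [sq_nonneg (q - p)]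

/-- Strict convexity along momenta gives a quantitative Fenchel inequality for perturbed
positions and velocities. -/
lemma Smooth.exists_fenchel_variation (hh : Smooth 2 h)
    (hpos : ∀ s x p, 0 < Burgers.dP (Burgers.dP h) s x p)
    (hconv : ∀ s x, ConvexOn ℝ univ (h s x)) (a b X R : ℝ) :
    ∃ δ₀ > 0, ∃ C ≥ 0, ∀ s ∈ Icc a b, ∀ x, |x| ≤ X → ∀ p, |p| ≤ R →
      ∀ δ, |δ| ≤ δ₀ → ∀ w, |w| ≤ δ₀ → ∀ q,
      q * (Burgers.dP h s x p + w) - h s (x + δ) q ≤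
        p * Burgers.dP h s x p - h s x p + p * w - δ * Burgers.dX h s x p
          + C * (δ ^ 2 + w ^ 2) := by
  have h1 : Smooth 1 h := ContDiff.of_le hh (by norm_num)
  obtain ⟨A, hA0, hA⟩ := exists_bound_on_box hh.dX.continuous_dX a b (X + 1) (R + 1)
  obtain ⟨B, hB0, hB⟩ := exists_bound_on_box hh.dX.continuous_dP a b (X + 1) (R + 1)
  obtain ⟨κ, hκ, hκ'⟩ := exists_pos_lower_bound_on_box hh.dP.continuous_dP hpos a b (X + 1) (R + 1)
  -- The three terms come from Young's inequality for `(q - p) w`, Young's inequality for the cross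
  -- term in `δ`, and the Taylor error of `h` in the position. They are summed so that one constant
  -- serves both squares.
  set C := 2 / κ + 2 * B ^ 2 / κ + A with hC
  have hC0 : 0 ≤ C := by positivity
  have hCA : A ≤ C := by
    have : 0 ≤ 2 / κ + 2 * B ^ 2 / κ := by positivity
    linarith
  -- At distance one from `p` the convexity gain `κ / 4` must beat three error terms, each at most
  -- `C` times a square. This explains the factor `12`.
  set δ₀ := min 1 (Real.sqrt (κ / (12 * (C + 1)))) with hδ₀
  have hδpos : 0 < δ₀ := lt_min one_pos (Real.sqrt_pos.2 (by positivity))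
  have hδsq : ∀ δ, |δ| ≤ δ₀ → δ ^ 2 * (12 * (C + 1)) ≤ κ := fun δ hδ => by
    have h2 : |δ| ≤ Real.sqrt (κ / (12 * (C + 1))) := hδ.trans (min_le_right _ _)
    have h3 := (Real.le_sqrt (abs_nonneg δ) (by positivity)).1 h2
    rw [sq_abs, le_div_iff₀ (by positivity)] at h3
    exact h3
  refine ⟨δ₀, hδpos, C, hC0, fun s hs x hx p hp δ hδ w hw q => ?_⟩
  set v := Burgers.dP h s x p with hv
  set G := p * v - h s x p + p * w - δ * Burgers.dX h s x p with hG
  have hδ1 : |δ| ≤ 1 := hδ.trans (min_le_left _ _)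
  have hxX : |x| ≤ X + 1 := by linarith
  have hxδ : |x + δ| ≤ X + 1 := (abs_add_le _ _).trans (by linarith)
  have hpR : |p| ≤ R + 1 := by linarith
  have shift : ∀ q, |q| ≤ R + 1 →
      |h s (x + δ) q - h s x q - δ * Burgers.dX h s x q| ≤ A * δ ^ 2 := fun q hq => by
    obtain ⟨z, hz, he⟩ := exists_taylor_two (fun z => h1.hasDerivAt_dX s z q)
      (fun z => hh.dX.hasDerivAt_dX s z q) x (x + δ)
    have := hA s hs z (abs_le_of_mem_uIcc hxX hxδ hz) q hq
    rw [he, show h s x q + Burgers.dX h s x q * (x + δ - x) +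
      Burgers.dX (Burgers.dX h) s z q / 2 * (x + δ - x) ^ 2 - h s x q - δ * Burgers.dX h s x q
      = Burgers.dX (Burgers.dX h) s z q / 2 * δ ^ 2 by ring, abs_mul, abs_of_nonneg (sq_nonneg δ)]
    gcongr
    rw [abs_div, abs_two]
    linarith [abs_nonneg (Burgers.dX (Burgers.dX h) s z q)]
  have near : ∀ q, |q| ≤ R + 1 → q * (v + w) - h s (x + δ) q
      ≤ G - κ / 4 * (q - p) ^ 2 + C * (δ ^ 2 + w ^ 2) := fun q hq => by
    have e1 := (abs_le.1 (shift q hq)).1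
    have e2 : |Burgers.dX h s x q - Burgers.dX h s x p| ≤ B * |q - p| := by
      have := (convex_uIcc p q).norm_image_sub_le_of_norm_hasDerivWithin_le
        (f := Burgers.dX h s x) (C := B)
        (fun z _ => (hh.dX.hasDerivAt_dP s x z).hasDerivWithinAt)
        (fun z hz => hB s hs x hxX z (abs_le_of_mem_uIcc hpR hq hz)) left_mem_uIcc right_mem_uIcc
      simpa [Real.norm_eq_abs] using this
    have e3 : h s x p + v * (q - p) + κ / 2 * (q - p) ^ 2 ≤ h s x q := by
      obtain ⟨z, hz, he⟩ := exists_taylor_two (fun p => h1.hasDerivAt_dP s x p)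
        (fun p => hh.dP.hasDerivAt_dP s x p) p q
      have := hκ' s hs x hxX z (abs_le_of_mem_uIcc hpR hq hz)
      rw [he]
      have := mul_le_mul_of_nonneg_right this (sq_nonneg (q - p))
      linarith
    have e4 : δ * Burgers.dX h s x p - |δ| * (B * |q - p|) ≤ δ * Burgers.dX h s x q := by
      have : |δ * (Burgers.dX h s x q - Burgers.dX h s x p)| ≤ |δ| * (B * |q - p|) := by
        rw [abs_mul]; gcongr
      linarith [(abs_le.1 this).1]
    -- Strong convexity provides `κ / 2`. The two applications of Young's inequality consume `κ / 8`
    -- each and leave the `κ / 4` of `near`.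
    have e5 : |δ| * (B * |q - p|) ≤ κ / 8 * (q - p) ^ 2 + 2 * B ^ 2 / κ * δ ^ 2 := by
      have : 0 ≤ (κ * |q - p| - 4 * B * |δ|) ^ 2 / (8 * κ) := by positivity
      have h2 : (κ * |q - p| - 4 * B * |δ|) ^ 2 / (8 * κ) =
          κ / 8 * (q - p) ^ 2 + 2 * B ^ 2 / κ * δ ^ 2 - |δ| * (B * |q - p|) := by
        rw [← sq_abs (q - p), ← sq_abs δ]; field_simp; ring
      linarith
    have e6 : (q - p) * w ≤ κ / 8 * (q - p) ^ 2 + 2 / κ * w ^ 2 := by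
      have : 0 ≤ (κ * (q - p) - 4 * w) ^ 2 / (8 * κ) := by positivity
      have h2 : (κ * (q - p) - 4 * w) ^ 2 / (8 * κ) =
          κ / 8 * (q - p) ^ 2 + 2 / κ * w ^ 2 - (q - p) * w := by
        field_simp; ring
      linarith
    have e7 : 0 ≤ 2 / κ * δ ^ 2 := by positivity
    have e8 : 0 ≤ 2 * B ^ 2 / κ * w ^ 2 := by positivity
    have e9 : 0 ≤ A * w ^ 2 := by positivity
    rw [hG, hC]
    linarith
  have atp : G - A * δ ^ 2 ≤ p * (v + w) - h s (x + δ) p := by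
    have e1 := (abs_le.1 (shift p hpR)).2
    rw [hG]; linarith
  have unit : ∀ q, |q - p| = 1 → q * (v + w) - h s (x + δ) q ≤ p * (v + w) - h s (x + δ) p := by
    intro q hq
    have hqR : |q| ≤ R + 1 := by
      have : |q| ≤ |q - p| + |p| := by simpa using abs_add_le (q - p) p
      linarith
    have e1 := near q hqR
    rw [← sq_abs (q - p), hq] at e1
    have e2 := hδsq δ hδ
    have e3 := hδsq w hw
    have e4 : A * δ ^ 2 ≤ C * δ ^ 2 := by gcongr
    nlinarith [sq_nonneg δ, sq_nonneg w]
  by_cases hq : |q - p| ≤ 1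
  · have hqR : |q| ≤ R + 1 := by
      have : |q| ≤ |q - p| + |p| := by simpa using abs_add_le (q - p) p
      linarith
    have e1 := near q hqR
    have : 0 ≤ κ / 4 * (q - p) ^ 2 := by positivity
    linarith
  · push Not at hq
    have hl0 : 0 < |q - p| := by linarith
    -- Large momenta are outside the box where the second order bounds hold. The point of the
    -- segment from `p` to `q` at distance one from `p` has no larger value than `p`, so by
    -- concavity neither has `q`.
    set l := 1 / |q - p| with hl
    have hlpos : 0 < l := by positivity
    have hl1 : l ≤ 1 := by rw [hl, div_le_one hl0]; exact hq.le
    have e1 := unit (p + l * (q - p)) (by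
      rw [add_sub_cancel_left, abs_mul, abs_of_pos hlpos, hl]; field_simp)
    have e2 := (hconv s (x + δ)).2 (mem_univ p) (mem_univ q) (by linarith : 0 ≤ 1 - l) hlpos.le
      (by ring)
    simp only [smul_eq_mul] at e2
    rw [show (1 - l) * p + l * q = p + l * (q - p) by ring] at e2
    have e3 : l * (q * (v + w) - h s (x + δ) q) ≤ l * (p * (v + w) - h s (x + δ) p) := by
      linarith
    have e4 := le_of_mul_le_mul_left e3 hlpos
    have e5 := near p hpR
    simp only [sub_self] at e5
    linarith

end Calculus
end Burgers

namespace Burgers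

/-! ### One-sided Lipschitz functions -/

/-- Functions whose increments satisfy the upper Lipschitz bound `f (x + δ) - f x ≤ K δ`. -/
def UpperLip (K : ℝ) (f : ℝ → ℝ) : Prop := ∀ x δ : ℝ, 0 < δ → f (x + δ) - f x ≤ K * δ

namespace UpperLip

variable {K : ℝ} {f : ℝ → ℝ}

lemma antitone (hf : UpperLip K f) : Antitone (fun x => f x - K * x) := by
  intro x x' hx
  rcases hx.eq_or_lt with rfl | hx
  · rfl
  · have := hf x (x' - x) (by linarith)
    simp only [add_sub_cancel] at this
    show f x' - K * x' ≤ f x - K * x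
    linarith

lemma measurable (hf : UpperLip K f) : Measurable f := by
  have := hf.antitone.measurable.add (measurable_id.const_mul K)
  convert! this using 1
  ext x; simp

lemma countable_not_continuousAt (hf : UpperLip K f) : {x | ¬ ContinuousAt f x}.Countable := by
  refine hf.antitone.countable_not_continuousAt.mono fun x hx => ?_
  contrapose! hx
  have hc : ContinuousAt (fun x => f x - K * x) x := by simpa using hx
  simp only [mem_ofPred_eq, not_not]
  have : ContinuousAt (fun x => (f x - K * x) + K * x) x := hc.add (by fun_prop)
  simpa using this

lemma ae_differentiableAt (hf : UpperLip K f) : ∀ᵐ x, DifferentiableAt ℝ f x := by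
  filter_upwards [hf.antitone.neg.ae_differentiableAt] with x hx
  have : DifferentiableAt ℝ (fun x => K * x - -(f x - K * x) - K * x + K * x) x :=
    ((((differentiableAt_id.const_mul K).sub hx)).sub
      (differentiableAt_id.const_mul K)).add (differentiableAt_id.const_mul K)
  simpa using this

/-- Up to a linear term the function is decreasing, so it can only jump down: right limit ≤ value ≤
left limit. This ordering is what later upgrades a lower parabola to continuity. -/
lemma exists_tendsto_right (hf : UpperLip K f) (x : ℝ) :
    ∃ q, Tendsto f (𝓝[>] x) (𝓝 q) ∧ q ≤ f x := by
  have h1 := hf.antitone.tendsto_rightLim x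
  have h2 : Tendsto (fun z => K * z) (𝓝[>] x) (𝓝 (K * x)) :=
    ((continuous_const_mul K).tendsto x).mono_left nhdsWithin_le_nhds
  refine ⟨_, by simpa using h1.add h2, ?_⟩
  have := hf.antitone.rightLim_le (le_refl x)
  linarith

lemma exists_tendsto_left (hf : UpperLip K f) (x : ℝ) :
    ∃ q, Tendsto f (𝓝[<] x) (𝓝 q) ∧ f x ≤ q := by
  have h1 := hf.antitone.tendsto_leftLim x
  have h2 : Tendsto (fun z => K * z) (𝓝[<] x) (𝓝 (K * x)) :=
    ((continuous_const_mul K).tendsto x).mono_left nhdsWithin_le_nhds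
  refine ⟨_, by simpa using h1.add h2, ?_⟩
  have := hf.antitone.le_leftLim (le_refl x)
  linarith

end UpperLip

/-- `q` is a value of the maximal monotone completion at `x` of an upper Lipschitz function. -/
def IsSuperValue (K : ℝ) (f : ℝ → ℝ) (x q : ℝ) : Prop :=
  ∀ r : ℝ, (0 < r → f (x + r) ≤ q + K * r) ∧ (r < 0 → q + K * r ≤ f (x + r))

lemma UpperLip.isSuperValue_of_tendsto_right {K : ℝ} {f : ℝ → ℝ} (hf : UpperLip K f) {x q : ℝ}
    (hq : Tendsto f (𝓝[>] x) (𝓝 q)) : IsSuperValue K f x q := fun r => by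
  have hid : Tendsto (fun z : ℝ => z) (𝓝[>] x) (𝓝 x) := nhdsWithin_le_nhds
  constructor
  · intro hr
    have : Tendsto (fun z => f z + K * (x + r - z)) (𝓝[>] x) (𝓝 (q + K * (x + r - x))) :=
      hq.add ((hid.const_sub (x + r)).const_mul K)
    rw [add_sub_cancel_left] at this
    refine ge_of_tendsto this ?_
    filter_upwards [Ioo_mem_nhdsGT (show x < x + r by linarith)] with z hz
    have := hf z (x + r - z) (by linarith [hz.2])
    simp only [add_sub_cancel] at this
    linarith
  · intro hr
    have : Tendsto (fun z => f z + K * (x + r - z)) (𝓝[>] x) (𝓝 (q + K * (x + r - x))) :=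
      hq.add ((hid.const_sub (x + r)).const_mul K)
    rw [add_sub_cancel_left] at this
    refine le_of_tendsto this ?_
    filter_upwards [self_mem_nhdsWithin] with z hz
    have := hf (x + r) (z - (x + r)) (by linarith [mem_Ioi.1 hz])
    simp only [add_sub_cancel] at this
    linarith

/-- Integrals from `x` are controlled by any super value, up to a quadratic term. -/
lemma IsSuperValue.integral_le {K : ℝ} {f : ℝ → ℝ} {x q : ℝ} (hq : IsSuperValue K f x q) (h : ℝ)
    (hi : IntervalIntegrable f volume x (x + h)) :
    ∫ r in x..(x + h), f r ≤ q * h + K / 2 * h ^ 2 := by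
  have hc : ∫ r in x..(x + h), (q + K * (r - x)) = q * h + K / 2 * h ^ 2 := by
    have hd : ∀ r ∈ uIcc x (x + h),
        HasDerivAt (fun r => q * r + K / 2 * (r - x) ^ 2) (q + K * (r - x)) r := fun r _ => by
      refine (((hasDerivAt_id r).const_mul q).add
        ((((hasDerivAt_id r).sub_const x).pow 2).const_mul (K / 2))).congr_deriv ?_
      simp; ring
    rw [intervalIntegral.integral_eq_sub_of_hasDerivAt hd (by
      apply Continuous.intervalIntegrable; fun_prop)]
    ring
  have hl : IntervalIntegrable (fun r => q + K * (r - x)) volume x (x + h) := by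
    apply Continuous.intervalIntegrable; fun_prop
  rw [← hc]
  rcases le_total 0 h with hh | hh
  · refine intervalIntegral.integral_mono_on_of_le_Ioo (by linarith) hi hl fun r hr => ?_
    have := (hq (r - x)).1 (by linarith [hr.1])
    simpa using this
  · rw [intervalIntegral.integral_symm (x + h) x, intervalIntegral.integral_symm (x + h) x]
    apply neg_le_neg
    refine intervalIntegral.integral_mono_on_of_le_Ioo (by linarith) hl.symm hi.symm
      fun r hr => ?_
    have := (hq (r - x)).2 (by linarith [hr.2])
    simpa using this

/-! ### Semiconcave potentials -/

/-- Semiconcave (in space, at positive times) potentials of an integrated Hamilton-Jacobi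
equation, on the universal cover: `y` is the shifted space derivative `c + ∂_x u`. -/
structure SemiconcavePotential (h : ℝ → ℝ → ℝ → ℝ) (c t₀ : ℝ) (K : ℝ → ℝ)
    (y u : ℝ → ℝ → ℝ) : Prop where
  contH : Continuous (fun z : ℝ × ℝ × ℝ => h z.1 z.2.1 z.2.2)
  upperLip : ∀ t > t₀, UpperLip (K t) (y t)
  anti : AntitoneOn K (Ioi t₀)
  pos : ∀ t > t₀, 0 < K t
  bdd : ∀ t > t₀, ∀ x, |y t x - c| ≤ K t
  cont : ContinuousOn (fun z : ℝ × ℝ => u z.1 z.2) (Ici t₀ ×ˢ univ)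
  pot : ∀ t ≥ t₀, ∀ x x', u t x' - u t x = ∫ r in x..x', (y t r - c)
  eqn : ∀ t t', t₀ < t → t₀ < t' → ∀ x, ∀ ε ≠ (0 : ℝ),
    ∫ θ in (0 : ℝ)..1, (u t' (x + ε * θ) - u t (x + ε * θ)) =
      -∫ s in t..t', ∫ θ in (0 : ℝ)..1, h s (x + ε * θ) (y s (x + ε * θ))

namespace SemiconcavePotential

variable {h : ℝ → ℝ → ℝ → ℝ} {c t₀ : ℝ} {K : ℝ → ℝ} {y u : ℝ → ℝ → ℝ}

lemma abs_le (P : SemiconcavePotential h c t₀ K y u) {a t : ℝ} (ha : t₀ < a) (hat : a ≤ t)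
    (x : ℝ) : |y t x| ≤ K a + |c| := by
  have h1 := P.bdd t (ha.trans_le hat) x
  have h2 : K t ≤ K a := P.anti ha (ha.trans_le hat) hat
  have := abs_add_le (y t x - c) c
  rw [sub_add_cancel] at this
  linarith

lemma intervalIntegrable (P : SemiconcavePotential h c t₀ K y u) {t : ℝ} (ht : t₀ < t) (a b : ℝ) :
    IntervalIntegrable (y t) volume a b := by
  refine (intervalIntegrable_const (c := K t + |c|)).mono_fun
    (P.upperLip t ht).measurable.aestronglyMeasurable ?_
  filter_upwards with x
  rw [Real.norm_eq_abs, Real.norm_eq_abs]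
  exact (P.abs_le ht le_rfl x).trans (le_abs_self _)

lemma pot' (P : SemiconcavePotential h c t₀ K y u) {t : ℝ} (ht : t₀ < t) (x x' : ℝ) :
    u t x' - u t x = (∫ r in x..x', y t r) - c * (x' - x) := by
  rw [P.pot t ht.le, intervalIntegral.integral_sub (P.intervalIntegrable ht _ _) (by simp)]
  simp [mul_comm]

lemma cont_slice (P : SemiconcavePotential h c t₀ K y u) {t : ℝ} (ht : t₀ ≤ t) :
    Continuous (u t) :=
  continuousOn_univ.1 (P.cont.comp (f := fun x : ℝ => (t, x)) (by fun_prop)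
    fun x _ => ⟨ht, mem_univ _⟩)

lemma continuousAt_u (P : SemiconcavePotential h c t₀ K y u) {t : ℝ} (ht : t₀ < t) (x : ℝ) :
    ContinuousAt (fun z : ℝ × ℝ => u z.1 z.2) (t, x) :=
  P.cont.continuousAt (prod_mem_nhds (Ici_mem_nhds ht) univ_mem)

/-- Semiconcavity: every super value is a super-differential, with a quadratic error. -/
lemma le_of_isSuperValue (P : SemiconcavePotential h c t₀ K y u) {t : ℝ} (ht : t₀ < t)
    {x q : ℝ} (hq : IsSuperValue (K t) (y t) x q) (r : ℝ) :
    u t (x + r) ≤ u t x + (q - c) * r + K t / 2 * r ^ 2 := by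
  have := P.pot' ht x (x + r)
  have := hq.integral_le r (P.intervalIntegrable ht _ _)
  linarith

/-- Joint continuity of `y` at the continuity points of its time slices. -/
lemma continuousAt_y (P : SemiconcavePotential h c t₀ K y u) {t x : ℝ} (ht : t₀ < t)
    (hx : ContinuousAt (y t) x) : ContinuousAt (fun z : ℝ × ℝ => y z.1 z.2) (t, x) := by
  rw [ContinuousAt, Metric.tendsto_nhds]
  intro η hη
  -- `K` may blow up at `t₀`. Staying above the midpoint makes `K a` a uniform bound for nearby
  -- times.
  set a := (t₀ + t) / 2 with ha
  have ha0 : t₀ < a := by rw [ha]; linarith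
  have hat : a < t := by rw [ha]; linarith
  have hKa := P.pos a ha0
  obtain ⟨d, hd, hdy⟩ := Metric.continuousAt_iff.1 hx (η / 4) (by positivity)
  -- The value of `y` is compared with difference quotients of `u` at the fixed scale `δ`. These are
  -- continuous in time, and the one-sided Lipschitz bound makes an error of at most `K a * δ ≤ η /
  -- 4`.
  set δ := min (d / 2) (η / (4 * K a)) with hδ
  have hδ0 : 0 < δ := lt_min (by positivity) (by positivity)
  have hδd : δ < d := (min_le_left _ _).trans_lt (by linarith)
  have hδK : K a * δ ≤ η / 4 := by
    have : δ ≤ η / (4 * K a) := min_le_right _ _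
    rw [le_div_iff₀ (by positivity)] at this
    linarith
  have near : ∀ r, |r - x| ≤ δ → y t x - η / 4 ≤ y t r ∧ y t r ≤ y t x + η / 4 := fun r hr => by
    have := hdy (show dist r x < d by rw [Real.dist_eq]; linarith)
    rw [Real.dist_eq, abs_lt] at this
    constructor <;> linarith
  have upper : (∫ r in (x - δ)..x, y t r) ≤ (y t x + η / 4) * δ := by
    have := intervalIntegral.integral_mono_on (show x - δ ≤ x by linarith)
      (P.intervalIntegrable ht _ _) (intervalIntegrable_const (c := y t x + η / 4)) fun r hr =>
        (near r (by rw [_root_.abs_le]; constructor <;> linarith [hr.1, hr.2])).2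
    simp at this; linarith
  have lower : (y t x - η / 4) * δ ≤ ∫ r in x..(x + δ), y t r := by
    have := intervalIntegral.integral_mono_on (show x ≤ x + δ by linarith)
      (intervalIntegrable_const (c := y t x - η / 4)) (P.intervalIntegrable ht _ _) fun r hr =>
        (near r (by rw [_root_.abs_le]; constructor <;> linarith [hr.1, hr.2])).1
    simp at this; linarith
  have shift : ∀ e : ℝ, Tendsto (fun z : ℝ × ℝ => u z.1 (z.2 + e)) (𝓝 (t, x))
      (𝓝 (u t (x + e))) := fun e =>
    (P.continuousAt_u ht (x + e)).comp (f := fun z : ℝ × ℝ => (z.1, z.2 + e)) (x := (t, x))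
      (by fun_prop)
  have t1 : Tendsto (fun z : ℝ × ℝ => u z.1 (z.2 + 0) - u z.1 (z.2 + -δ)) (𝓝 (t, x))
      (𝓝 (u t (x + 0) - u t (x + -δ))) := (shift 0).sub (shift (-δ))
  have t2 : Tendsto (fun z : ℝ × ℝ => u z.1 (z.2 + δ) - u z.1 (z.2 + 0)) (𝓝 (t, x))
      (𝓝 (u t (x + δ) - u t (x + 0))) := (shift δ).sub (shift 0)
  have hη' : 0 < η / 4 * δ := by positivity
  filter_upwards [t1.eventually (gt_mem_nhds (show _ < u t (x + 0) - u t (x + -δ) + η / 4 * δ by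
      linarith)), t2.eventually (lt_mem_nhds (show u t (x + δ) - u t (x + 0) - η / 4 * δ < _ by
      linarith)), prod_mem_nhds (Ioi_mem_nhds hat) (univ_mem (f := 𝓝 x))] with z hz1 hz2 hz3
  have hz : t₀ < z.1 := ha0.trans hz3.1
  have hKz : K z.1 ≤ K a := P.anti ha0 hz (le_of_lt hz3.1)
  simp only [add_zero, ← sub_eq_add_neg] at hz1 hz2
  have e1 := P.pot' hz (z.2 - δ) z.2
  have e2 := P.pot' ht (x - δ) x
  have e3 := P.pot' hz z.2 (z.2 + δ)
  have e4 := P.pot' ht x (x + δ)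
  -- The bound limits growth to the right only, so the left quotient bounds `y` from above and the
  -- right quotient from below.
  have f1 : (y z.1 z.2 - K a * δ) * δ ≤ ∫ r in (z.2 - δ)..z.2, y z.1 r := by
    have := intervalIntegral.integral_mono_on_of_le_Ioo (show z.2 - δ ≤ z.2 by linarith)
      (intervalIntegrable_const (c := y z.1 z.2 - K a * δ)) (P.intervalIntegrable hz _ _)
      fun r hr => by
        have := P.upperLip z.1 hz r (z.2 - r) (by linarith [hr.2])
        rw [add_sub_cancel] at this
        have h2 : K z.1 * (z.2 - r) ≤ K a * δ :=
          mul_le_mul hKz (by linarith [hr.1]) (by linarith [hr.2]) hKa.le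
        linarith
    simp at this; linarith
  have f2 : (∫ r in z.2..(z.2 + δ), y z.1 r) ≤ (y z.1 z.2 + K a * δ) * δ := by
    have := intervalIntegral.integral_mono_on_of_le_Ioo (show z.2 ≤ z.2 + δ by linarith)
      (P.intervalIntegrable hz _ _) (intervalIntegrable_const (c := y z.1 z.2 + K a * δ))
      fun r hr => by
        have := P.upperLip z.1 hz z.2 (r - z.2) (by linarith [hr.1])
        rw [add_sub_cancel] at this
        have h2 : K z.1 * (r - z.2) ≤ K a * δ :=
          mul_le_mul hKz (by linarith [hr.2]) (by linarith [hr.1]) hKa.le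
        linarith
    simp at this; linarith
  have g1 : y z.1 z.2 < y t x + η := by
    have : (y z.1 z.2 - K a * δ) * δ < (y t x + η / 4 + η / 4) * δ := by linarith
    have := lt_of_mul_lt_mul_right this hδ0.le
    linarith
  have g2 : y t x - η < y z.1 z.2 := by
    have : (y t x - η / 4 - η / 4) * δ < (y z.1 z.2 + K a * δ) * δ := by linarith
    have := lt_of_mul_lt_mul_right this hδ0.le
    linarith
  rw [Real.dist_eq, abs_lt]
  constructor <;> linarith

lemma ae_continuousAt_affine (P : SemiconcavePotential h c t₀ K y u) {t : ℝ} (ht : t₀ < t)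
    (x : ℝ) {ε : ℝ} (hε : ε ≠ 0) : ∀ᵐ θ : ℝ, ContinuousAt (y t) (x + ε * θ) := by
  have : {θ : ℝ | ¬ ContinuousAt (y t) (x + ε * θ)}.Countable :=
    (P.upperLip t ht).countable_not_continuousAt.preimage (f := fun θ : ℝ => x + ε * θ)
      (fun a b hab => by simpa [hε] using hab)
  exact this.measure_zero volume

/-- Averages along short segments are continuous. -/
lemma continuousAt_average (P : SemiconcavePotential h c t₀ K y u) {Ψ : ℝ → ℝ → ℝ → ℝ}
    (hΨ : Continuous (fun z : ℝ × ℝ × ℝ => Ψ z.1 z.2.1 z.2.2)) {ε : ℝ} (hε : ε ≠ 0)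
    {t : ℝ} (ht : t₀ < t) (x : ℝ) :
    ContinuousAt (fun z : ℝ × ℝ => ∫ θ in (0 : ℝ)..1, Ψ z.1 (z.2 + ε * θ) (y z.1 (z.2 + ε * θ)))
      (t, x) := by
  set a := (t₀ + t) / 2 with ha
  have ha0 : t₀ < a := by rw [ha]; linarith
  have hat : a < t := by rw [ha]; linarith
  obtain ⟨C, -, hC⟩ := exists_bound_on_box hΨ a (t + 1) (|x| + 1 + |ε|) (K a + |c|)
  have hnear : ∀ᶠ z : ℝ × ℝ in 𝓝 (t, x), z ∈ Ioo a (t + 1) ×ˢ Metric.ball x 1 :=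
    prod_mem_nhds (Ioo_mem_nhds hat (by linarith)) (Metric.ball_mem_nhds x one_pos)
  refine intervalIntegral.continuousAt_of_dominated_interval (bound := fun _ => C) ?_ ?_ (by simp) ?_
  · filter_upwards [hnear] with z hz
    have hm := (P.upperLip z.1 (ha0.trans hz.1.1)).measurable
    refine Measurable.aestronglyMeasurable ?_
    exact hΨ.measurable.comp (measurable_const.prodMk ((by fun_prop : Measurable fun θ : ℝ =>
      z.2 + ε * θ).prodMk (hm.comp (by fun_prop))))
  · filter_upwards [hnear] with z hz
    refine ae_of_all _ fun θ hθ => ?_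
    rw [uIoc_of_le zero_le_one] at hθ
    refine hC z.1 ⟨hz.1.1.le, hz.1.2.le⟩ _ ?_ _ (P.abs_le ha0 hz.1.1.le _)
    have h1 : |z.2 - x| < 1 := hz.2
    have h2 : |ε * θ| ≤ |ε| := by
      rw [abs_mul, abs_of_pos hθ.1]; exact mul_le_of_le_one_right (abs_nonneg _) hθ.2
    have h3 : |z.2 + ε * θ| ≤ |z.2 - x| + |x| + |ε * θ| := by
      have e1 := abs_add_le z.2 (ε * θ)
      have e2 := abs_add_le (z.2 - x) x
      rw [sub_add_cancel] at e2
      linarith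
    linarith
  -- A slice `y t` has countably many discontinuities, and a nondegenerate segment meets them in a
  -- null set. Elsewhere `y` is jointly continuous.
  · filter_upwards [P.ae_continuousAt_affine ht x hε] with θ hθ _
    have h1 := (P.continuousAt_y ht hθ).comp_of_eq
      (f := fun z : ℝ × ℝ => (z.1, z.2 + ε * θ)) (x := (t, x)) (by fun_prop) rfl
    exact hΨ.continuousAt.comp (f := fun z : ℝ × ℝ =>
      ((z.1, z.2 + ε * θ, y z.1 (z.2 + ε * θ)) : ℝ × ℝ × ℝ))
      (continuousAt_fst.prodMk ((by fun_prop : ContinuousAt (fun z : ℝ × ℝ => z.2 + ε * θ)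
        (t, x)).prodMk h1))

end SemiconcavePotential

/-- The average of `u t` over the segment from `x` to `x + ε`. -/
noncomputable def segAvg (u : ℝ → ℝ → ℝ) (ε t x : ℝ) : ℝ := ∫ θ in (0 : ℝ)..1, u t (x + ε * θ)

/-- The average of `h t · (y t ·)` over the segment from `x` to `x + ε`. -/
noncomputable def segFlux (h : ℝ → ℝ → ℝ → ℝ) (y : ℝ → ℝ → ℝ) (ε t x : ℝ) : ℝ :=
  ∫ θ in (0 : ℝ)..1, h t (x + ε * θ) (y t (x + ε * θ))

/-! ### Segment averages of the potential are continuously differentiable -/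

namespace SemiconcavePotential

variable {h : ℝ → ℝ → ℝ → ℝ} {c t₀ : ℝ} {K : ℝ → ℝ} {y u : ℝ → ℝ → ℝ}

lemma continuousAt_segFlux (P : SemiconcavePotential h c t₀ K y u) {ε : ℝ} (hε : ε ≠ 0)
    {t : ℝ} (ht : t₀ < t) (x : ℝ) :
    ContinuousAt (fun z : ℝ × ℝ => segFlux h y ε z.1 z.2) (t, x) :=
  P.continuousAt_average P.contH hε ht x

lemma continuousAt_segAvg_y (P : SemiconcavePotential h c t₀ K y u) {ε : ℝ} (hε : ε ≠ 0)
    {t : ℝ} (ht : t₀ < t) (x : ℝ) :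
    ContinuousAt (fun z : ℝ × ℝ => segAvg y ε z.1 z.2) (t, x) :=
  P.continuousAt_average (Ψ := fun _ _ p => p) (by fun_prop) hε ht x

/-- Averaging replaces the space derivative of `u` by its difference quotient over the segment,
which is the average of `y` minus `c`. No regularity of `y` is involved. -/
lemma hasDerivAt_segAvg_right (P : SemiconcavePotential h c t₀ K y u) {ε : ℝ} (hε : ε ≠ 0)
    {t : ℝ} (ht : t₀ < t) (x : ℝ) :
    HasDerivAt (segAvg u ε t) (segAvg y ε t x - c) x := by
  have hc := P.cont_slice ht.le
  have e : segAvg u ε t = fun x => ε⁻¹ * ((∫ r in (0 : ℝ)..(x + ε), u t r) -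
      ∫ r in (0 : ℝ)..x, u t r) := by
    ext x
    rw [intervalIntegral.integral_interval_sub_left (hc.intervalIntegrable _ _)
      (hc.intervalIntegrable _ _)]
    simp [segAvg, intervalIntegral.integral_comp_add_mul (fun r => u t r) hε x]
  have e2 : segAvg y ε t x - c = ε⁻¹ * (u t (x + ε) - u t x) := by
    rw [P.pot' ht]
    simp only [segAvg]
    rw [intervalIntegral.integral_comp_add_mul (fun r => y t r) hε x]
    simp only [mul_zero, add_zero, mul_one, smul_eq_mul]
    field_simp
    ring
  rw [e, e2]
  have h1 : ∀ z, HasDerivAt (fun z => ∫ r in (0 : ℝ)..z, u t r) (u t z) z := fun z =>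
    intervalIntegral.integral_hasDerivAt_right (hc.intervalIntegrable _ _)
      (hc.stronglyMeasurableAtFilter _ _) hc.continuousAt
  exact (((h1 (x + ε)).comp_add_const x ε).sub (h1 x)).const_mul _

/-- The integrated equation exhibits the average as a primitive in time of the averaged flux, which
is continuous at positive times. -/
lemma hasDerivAt_segAvg_left (P : SemiconcavePotential h c t₀ K y u) {ε : ℝ} (hε : ε ≠ 0)
    {t : ℝ} (ht : t₀ < t) (x : ℝ) :
    HasDerivAt (fun s => segAvg u ε s x) (-segFlux h y ε t x) t := by
  have hg : ContinuousOn (fun s => segFlux h y ε s x) (Ioi t₀) := fun s hs =>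
    ((P.continuousAt_segFlux hε hs x).comp (f := fun s : ℝ => (s, x)) (x := s)
      (by fun_prop)).continuousWithinAt
  have h1 : HasDerivAt (fun s => ∫ r in t..s, segFlux h y ε r x) (segFlux h y ε t x) t := by
    refine intervalIntegral.integral_hasDerivAt_right (by simp) ?_ (hg.continuousAt (Ioi_mem_nhds ht))
    exact hg.stronglyMeasurableAtFilter isOpen_Ioi t ht
  refine ((h1.neg).const_add (segAvg u ε t x)).congr_of_eventuallyEq ?_
  filter_upwards [Ioi_mem_nhds ht] with s hs
  have := P.eqn t s ht hs x ε hε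
  have hci : ∀ t, t₀ < t → IntervalIntegrable (fun θ => u t (x + ε * θ)) volume 0 1 :=
    fun t ht => ((P.cont_slice ht.le).comp (by fun_prop)).intervalIntegrable _ _
  rw [intervalIntegral.integral_sub (hci s hs) (hci t ht)] at this
  simp only [segAvg, segFlux, Pi.neg_apply]
  linarith

lemma hasStrictFDerivAt_segAvg (P : SemiconcavePotential h c t₀ K y u) {ε : ℝ} (hε : ε ≠ 0)
    {t : ℝ} (ht : t₀ < t) (x : ℝ) :
    HasStrictFDerivAt (fun z : ℝ × ℝ => segAvg u ε z.1 z.2)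
      ((ContinuousLinearMap.toSpanSingleton ℝ (-segFlux h y ε t x)).coprod
        (ContinuousLinearMap.toSpanSingleton ℝ (segAvg y ε t x - c))) (t, x) := by
  have hn : ∀ᶠ z : ℝ × ℝ in 𝓝 (t, x), t₀ < z.1 :=
    continuousAt_fst.eventually (lt_mem_nhds ht)
  have hl : Continuous (fun a : ℝ => ContinuousLinearMap.toSpanSingleton ℝ a) :=
    (ContinuousLinearMap.toSpanSingletonCLE (𝕜 := ℝ) (E := ℝ)).continuous
  refine hasStrictFDerivAt_uncurry_coprod (𝕜 := ℝ) (u := (t, x)) (f := fun t x => segAvg u ε t x)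
    (f₁ := fun t x => ContinuousLinearMap.toSpanSingleton ℝ (-segFlux h y ε t x))
    (f₂ := fun t x => ContinuousLinearMap.toSpanSingleton ℝ (segAvg y ε t x - c)) ?_ ?_ ?_ ?_
  · filter_upwards [hn] with z hz
    exact (P.hasDerivAt_segAvg_left hε hz z.2).hasFDerivAt
  · filter_upwards [hn] with z hz
    exact (P.hasDerivAt_segAvg_right hε hz z.2).hasFDerivAt
  · exact hl.continuousAt.comp (P.continuousAt_segFlux hε ht x).neg
  · exact hl.continuousAt.comp ((P.continuousAt_segAvg_y hε ht x).sub continuousAt_const)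

end SemiconcavePotential

end Burgers

namespace Burgers

/-! ### The chain rule along absolutely continuous curves -/

open AbsolutelyContinuousOnInterval in
lemma _root_.LipschitzOnWith.absolutelyContinuousOnInterval_comp_prodMk {F : ℝ × ℝ → ℝ}
    {L : NNReal} {S : Set (ℝ × ℝ)} (hF : LipschitzOnWith L F S) {ξ : ℝ → ℝ} {a b : ℝ}
    (hξ : AbsolutelyContinuousOnInterval ξ a b) (hS : ∀ s ∈ uIcc a b, (s, ξ s) ∈ S) :
    AbsolutelyContinuousOnInterval (fun s => F (s, ξ s)) a b := by
  have hid : AbsolutelyContinuousOnInterval (fun s : ℝ => s) a b :=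
    (LipschitzWith.id.lipschitzOnWith (s := uIcc a b)).absolutelyContinuousOnInterval
  unfold AbsolutelyContinuousOnInterval at hξ hid ⊢
  refine squeeze_zero' ?_ ?_ (by simpa using (hid.const_mul (L : ℝ)).add (hξ.const_mul (L : ℝ)))
  · exact Eventually.of_forall fun _ => Finset.sum_nonneg fun i hi => dist_nonneg
  rw [eventually_inf_principal]
  filter_upwards with ⟨n, I⟩ hnI
  simp only [Finset.mul_sum, ← Finset.sum_add_distrib]
  refine Finset.sum_le_sum fun i hi => ?_
  have h1 := hnI.1 i hi
  refine (hF.dist_le_mul _ (hS _ h1.1) _ (hS _ h1.2)).trans ?_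
  rw [← mul_add]
  refine mul_le_mul_of_nonneg_left ?_ L.coe_nonneg
  rw [Prod.dist_eq]
  exact max_le_add_of_nonneg dist_nonneg dist_nonneg

/-- Filters of nonzero increments converging to `0` from one side. -/
structure IsSideFilter (l : Filter ℝ) : Prop where
  ne_zero : ∀ᶠ ε in l, ε ≠ (0 : ℝ)
  le_nhds : l ≤ 𝓝 0
  scale : ∀ θ ∈ Ioc (0 : ℝ) 1, Tendsto (fun ε => ε * θ) l l

lemma isSideFilter_right : IsSideFilter (𝓝[>] (0 : ℝ)) where
  ne_zero := by filter_upwards [self_mem_nhdsWithin] with ε hε using (ne_of_gt hε)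
  le_nhds := nhdsWithin_le_nhds
  scale θ hθ := by
    refine tendsto_nhdsWithin_iff.2 ⟨?_, ?_⟩
    · have : Tendsto (fun ε : ℝ => ε * θ) (𝓝 0) (𝓝 (0 * θ)) := (continuous_mul_const θ).tendsto 0
      rw [zero_mul] at this
      exact this.mono_left nhdsWithin_le_nhds
    · filter_upwards [self_mem_nhdsWithin] with ε hε using mul_pos hε hθ.1

lemma isSideFilter_left : IsSideFilter (𝓝[<] (0 : ℝ)) where
  ne_zero := by filter_upwards [self_mem_nhdsWithin] with ε hε using (ne_of_lt hε)
  le_nhds := nhdsWithin_le_nhds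
  scale θ hθ := by
    refine tendsto_nhdsWithin_iff.2 ⟨?_, ?_⟩
    · have : Tendsto (fun ε : ℝ => ε * θ) (𝓝 0) (𝓝 (0 * θ)) := (continuous_mul_const θ).tendsto 0
      rw [zero_mul] at this
      exact this.mono_left nhdsWithin_le_nhds
    · filter_upwards [self_mem_nhdsWithin] with ε hε using mul_neg_of_neg_of_pos hε hθ.1

lemma tendsto_add_left_nhdsGT (x : ℝ) : Tendsto (fun r : ℝ => x + r) (𝓝[>] 0) (𝓝[>] x) := by
  refine tendsto_nhdsWithin_iff.2 ⟨?_, ?_⟩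
  · have : Tendsto (fun r : ℝ => x + r) (𝓝 0) (𝓝 (x + 0)) := (continuous_const_add x).tendsto 0
    rw [add_zero] at this
    exact this.mono_left nhdsWithin_le_nhds
  · filter_upwards [self_mem_nhdsWithin] with r hr
    have : 0 < r := hr
    exact mem_Ioi.2 (by linarith)

lemma tendsto_add_left_nhdsLT (x : ℝ) : Tendsto (fun r : ℝ => x + r) (𝓝[<] 0) (𝓝[<] x) := by
  refine tendsto_nhdsWithin_iff.2 ⟨?_, ?_⟩
  · have : Tendsto (fun r : ℝ => x + r) (𝓝 0) (𝓝 (x + 0)) := (continuous_const_add x).tendsto 0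
    rw [add_zero] at this
    exact this.mono_left nhdsWithin_le_nhds
  · filter_upwards [self_mem_nhdsWithin] with r hr
    have : r < 0 := hr
    exact mem_Iio.2 (by linarith)

namespace SemiconcavePotential

variable {h : ℝ → ℝ → ℝ → ℝ} {c t₀ : ℝ} {K : ℝ → ℝ} {y u : ℝ → ℝ → ℝ}

/-- Only values of `y` on one side of `x` enter when `ε` keeps a sign, so a one-sided limit
suffices. `IsSideFilter.scale` passes it to each fixed `θ`, and dominated convergence concludes. -/
lemma tendsto_average (P : SemiconcavePotential h c t₀ K y u) {Ψ : ℝ → ℝ → ℝ → ℝ}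
    (hΨ : Continuous (fun z : ℝ × ℝ × ℝ => Ψ z.1 z.2.1 z.2.2)) {l : Filter ℝ}
    [l.IsCountablyGenerated] (hl : IsSideFilter l) {t : ℝ} (ht : t₀ < t) {x q : ℝ}
    (hq : Tendsto (fun r => y t (x + r)) l (𝓝 q)) :
    Tendsto (fun ε => ∫ θ in (0 : ℝ)..1, Ψ t (x + ε * θ) (y t (x + ε * θ))) l
      (𝓝 (Ψ t x q)) := by
  obtain ⟨C, -, hC⟩ := exists_bound_on_box hΨ t t (|x| + 1) (K t + |c|)
  have hm := (P.upperLip t ht).measurable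
  have hlim : Tendsto (fun ε => ∫ θ in (0 : ℝ)..1, Ψ t (x + ε * θ) (y t (x + ε * θ))) l
      (𝓝 (∫ θ in (0 : ℝ)..1, Ψ t x q)) := by
    refine intervalIntegral.tendsto_integral_filter_of_dominated_convergence (fun _ => C) ?_ ?_
      (by simp) ?_
    · refine Eventually.of_forall fun ε => Measurable.aestronglyMeasurable ?_
      exact hΨ.measurable.comp (measurable_const.prodMk ((by fun_prop : Measurable fun θ : ℝ =>
        x + ε * θ).prodMk (hm.comp (by fun_prop))))
    · filter_upwards [hl.le_nhds (Metric.ball_mem_nhds 0 one_pos)] with ε hε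
      refine ae_of_all _ fun θ hθ => ?_
      rw [uIoc_of_le zero_le_one] at hθ
      refine hC t ⟨le_rfl, le_rfl⟩ _ ?_ _ (P.abs_le ht le_rfl _)
      have h1 : |ε| < 1 := by simpa using hε
      have h2 : |ε * θ| ≤ |ε| := by
        rw [abs_mul, abs_of_pos hθ.1]; exact mul_le_of_le_one_right (abs_nonneg _) hθ.2
      linarith [abs_add_le x (ε * θ)]
    · refine ae_of_all _ fun θ hθ => ?_
      rw [uIoc_of_le zero_le_one] at hθ
      have h1 : Tendsto (fun ε => y t (x + ε * θ)) l (𝓝 q) := hq.comp (hl.scale θ hθ)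
      have h2 : Tendsto (fun ε => x + ε * θ) l (𝓝 (x + 0)) :=
        (((hl.scale θ hθ).mono_right hl.le_nhds)).const_add x
      rw [add_zero] at h2
      exact (hΨ.tendsto (t, x, q)).comp (tendsto_const_nhds.prodMk_nhds (h2.prodMk_nhds h1))
  simpa using hlim

lemma tendsto_segAvg (P : SemiconcavePotential h c t₀ K y u) {l : Filter ℝ}
    [l.IsCountablyGenerated] (hl : IsSideFilter l) {t : ℝ} (ht : t₀ < t) (x : ℝ) :
    Tendsto (fun ε => segAvg u ε t x) l (𝓝 (u t x)) := by
  have hc := P.cont_slice ht.le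
  have : Continuous (fun ε => segAvg u ε t x) :=
    intervalIntegral.continuous_parametric_intervalIntegral_of_continuous' (by fun_prop) 0 1
  have h2 : segAvg u 0 t x = u t x := by simp [segAvg]
  rw [← h2]
  exact (this.tendsto 0).mono_left hl.le_nhds

/-- The continuous partial derivatives are bounded on a convex compact box containing the curve,
hence the average is Lipschitz there. -/
lemma absolutelyContinuous_segAvg (P : SemiconcavePotential h c t₀ K y u) {ε : ℝ} (hε : ε ≠ 0)
    {a b : ℝ} (ha : t₀ < a) (hab : a ≤ b) {ξ : ℝ → ℝ}
    (hξ : AbsolutelyContinuousOnInterval ξ a b) :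
    AbsolutelyContinuousOnInterval (fun s => segAvg u ε s (ξ s)) a b := by
  obtain ⟨X, hX⟩ := hξ.exists_bound
  set S : Set (ℝ × ℝ) := Icc a b ×ˢ Icc (-X) X with hSdef
  have hS0 : ∀ z ∈ S, t₀ < z.1 := fun z hz => ha.trans_le hz.1.1
  have hScomp : IsCompact S := isCompact_Icc.prod isCompact_Icc
  have hSconv : Convex ℝ S := (convex_Icc a b).prod (convex_Icc _ _)
  have hl : Continuous (fun a : ℝ => ContinuousLinearMap.toSpanSingleton ℝ a) :=
    (ContinuousLinearMap.toSpanSingletonCLE (𝕜 := ℝ) (E := ℝ)).continuous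
  have c1 : ContinuousOn (fun z : ℝ × ℝ => segFlux h y ε z.1 z.2) S := fun z hz =>
    (P.continuousAt_segFlux hε (hS0 z hz) z.2).continuousWithinAt
  have c2 : ContinuousOn (fun z : ℝ × ℝ => segAvg y ε z.1 z.2 - c) S := fun z hz =>
    ((P.continuousAt_segAvg_y hε (hS0 z hz) z.2).sub continuousAt_const).continuousWithinAt
  obtain ⟨C1, hC1⟩ := hScomp.exists_bound_of_continuousOn c1
  obtain ⟨C2, hC2⟩ := hScomp.exists_bound_of_continuousOn c2
  have hlip : LipschitzOnWith (Real.toNNReal (C1 + C2)) (fun z : ℝ × ℝ => segAvg u ε z.1 z.2) S := by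
    refine hSconv.lipschitzOnWith_of_nnnorm_hasFDerivWithin_le (𝕜 := ℝ)
      (fun z hz => (P.hasStrictFDerivAt_segAvg hε (hS0 z hz) z.2).hasFDerivAt.hasFDerivWithinAt)
      fun z hz => ?_
    rw [← NNReal.coe_le_coe, coe_nnnorm]
    refine le_trans ?_ (Real.le_coe_toNNReal _)
    refine ContinuousLinearMap.opNorm_le_bound _ ?_ fun w => ?_
    · exact add_nonneg ((norm_nonneg _).trans (hC1 z hz)) ((norm_nonneg _).trans (hC2 z hz))
    · simp only [ContinuousLinearMap.coprod_apply, ContinuousLinearMap.toSpanSingleton_apply]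
      refine (norm_add_le _ _).trans ?_
      rw [norm_smul, norm_smul, norm_neg, add_mul, mul_comm, mul_comm ‖w.2‖]
      exact add_le_add
        (mul_le_mul (hC1 z hz) (norm_fst_le w) (norm_nonneg _) ((norm_nonneg _).trans (hC1 z hz)))
        (mul_le_mul (hC2 z hz) (norm_snd_le w) (norm_nonneg _) ((norm_nonneg _).trans (hC2 z hz)))
  refine hlip.absolutelyContinuousOnInterval_comp_prodMk hξ fun s hs => ?_
  have := hX s hs
  rw [uIcc_of_le hab] at hs
  exact ⟨hs, _root_.abs_le.1 this⟩

lemma segAvg_sub_eq_integral (P : SemiconcavePotential h c t₀ K y u) {ε : ℝ} (hε : ε ≠ 0)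
    {a b : ℝ} (ha : t₀ < a) (hab : a ≤ b) {ξ : ℝ → ℝ}
    (hξ : AbsolutelyContinuousOnInterval ξ a b) :
    segAvg u ε b (ξ b) - segAvg u ε a (ξ a) =
      ∫ s in a..b, ((segAvg y ε s (ξ s) - c) * deriv ξ s - segFlux h y ε s (ξ s)) := by
  rw [← (P.absolutelyContinuous_segAvg hε ha hab hξ).integral_deriv_eq_sub]
  refine intervalIntegral.integral_congr_ae ?_
  filter_upwards [hξ.ae_differentiableAt] with s hs hsab
  have hs' := hs (uIoc_subset_uIcc hsab)
  rw [uIoc_of_le hab] at hsab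
  have h1 := (P.hasStrictFDerivAt_segAvg hε (ha.trans hsab.1) (ξ s)).hasFDerivAt
  have h2 := h1.comp_hasDerivAt s ((hasDerivAt_id s).prodMk hs'.hasDerivAt)
  have h3 := h2.deriv
  simp only [Function.comp_def, id] at h3
  rw [h3]
  simp only [ContinuousLinearMap.coprod_apply, ContinuousLinearMap.toSpanSingleton_apply,
    smul_eq_mul]
  ring

/-- The chain rule along an absolutely continuous curve, with one-sided values of `y`. -/
theorem chain_rule (P : SemiconcavePotential h c t₀ K y u) {l : Filter ℝ} [l.NeBot]
    [l.IsCountablyGenerated] (hl : IsSideFilter l) {a b : ℝ} (ha : t₀ < a) (hab : a ≤ b)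
    {ξ q : ℝ → ℝ} (hξ : AbsolutelyContinuousOnInterval ξ a b)
    (hq : ∀ s ∈ Icc a b, Tendsto (fun r => y s (ξ s + r)) l (𝓝 (q s))) :
    IntervalIntegrable (fun s => (q s - c) * deriv ξ s - h s (ξ s) (q s)) volume a b ∧
      u b (ξ b) - u a (ξ a) = ∫ s in a..b, ((q s - c) * deriv ξ s - h s (ξ s) (q s)) := by
  obtain ⟨X, hX⟩ := hξ.exists_bound
  obtain ⟨C, hC0, hC⟩ := exists_bound_on_box P.contH a b (X + 1) (K a + |c|)
  have hK0 := P.pos a ha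
  have hξd := hξ.intervalIntegrable_deriv
  -- An integrable majorant independent of `ε`: `y` and the flux are bounded on the box, and `ξ'` is
  -- integrable.
  set B : ℝ → ℝ := fun s => (K a + |c| + |c|) * |deriv ξ s| + C with hB
  have hBint : IntervalIntegrable B volume a b :=
    (hξd.abs.const_mul _).add intervalIntegrable_const
  have hξc := hξ.continuousOn
  rw [uIcc_of_le hab] at hξc hX
  have hmeas : ∀ᶠ ε in l, AEStronglyMeasurable
      (fun s => (segAvg y ε s (ξ s) - c) * deriv ξ s - segFlux h y ε s (ξ s))
      (volume.restrict (uIoc a b)) := by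
    filter_upwards [hl.ne_zero] with ε hε
    have c1 : ContinuousOn (fun s => segFlux h y ε s (ξ s)) (Icc a b) := fun s hs =>
      (P.continuousAt_segFlux hε (ha.trans_le hs.1) (ξ s)).comp_continuousWithinAt
        (f := fun s => (s, ξ s)) (continuousWithinAt_id.prodMk (hξc s hs))
    have c2 : ContinuousOn (fun s => segAvg y ε s (ξ s) - c) (Icc a b) := fun s hs =>
      ((P.continuousAt_segAvg_y hε (ha.trans_le hs.1) (ξ s)).comp_continuousWithinAt
        (f := fun s => (s, ξ s)) (continuousWithinAt_id.prodMk (hξc s hs))).sub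
        continuousWithinAt_const
    rw [uIoc_of_le hab]
    have m1 := (c1.mono Ioc_subset_Icc_self).aestronglyMeasurable (μ := volume) measurableSet_Ioc
    have m2 := (c2.mono Ioc_subset_Icc_self).aestronglyMeasurable (μ := volume) measurableSet_Ioc
    exact (m2.mul (hξd.1.aestronglyMeasurable)).sub m1
  have hbound : ∀ᶠ ε in l, ∀ s ∈ Ioc a b,
      ‖(segAvg y ε s (ξ s) - c) * deriv ξ s - segFlux h y ε s (ξ s)‖ ≤ B s := by
    filter_upwards [hl.le_nhds (Metric.ball_mem_nhds 0 one_pos)] with ε hε s hs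
    have hε1 : |ε| < 1 := by simpa using hε
    have b1 : ‖segAvg y ε s (ξ s)‖ ≤ (K a + |c|) * |1 - 0| :=
      intervalIntegral.norm_integral_le_of_norm_le_const fun θ _ => P.abs_le ha hs.1.le _
    have b2 : ‖segFlux h y ε s (ξ s)‖ ≤ C * |1 - 0| := by
      refine intervalIntegral.norm_integral_le_of_norm_le_const fun θ hθ => ?_
      rw [uIoc_of_le zero_le_one] at hθ
      refine hC s (Ioc_subset_Icc_self hs) _ ?_ _ (P.abs_le ha hs.1.le _)
      have h2 : |ε * θ| ≤ |ε| := by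
        rw [abs_mul, abs_of_pos hθ.1]; exact mul_le_of_le_one_right (abs_nonneg _) hθ.2
      have h3 : |ξ s| ≤ X := hX s (Ioc_subset_Icc_self hs)
      linarith [abs_add_le (ξ s) (ε * θ)]
    simp only [sub_zero, abs_one, mul_one, Real.norm_eq_abs] at b1 b2
    refine (norm_sub_le _ _).trans (add_le_add ?_ b2)
    rw [norm_mul]
    refine mul_le_mul_of_nonneg_right ?_ (norm_nonneg _)
    refine (norm_sub_le _ _).trans (add_le_add b1 le_rfl)
  have hlim : ∀ s ∈ Ioc a b, Tendsto (fun ε => (segAvg y ε s (ξ s) - c) * deriv ξ s -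
      segFlux h y ε s (ξ s)) l (𝓝 ((q s - c) * deriv ξ s - h s (ξ s) (q s))) := fun s hs => by
    have hs0 := ha.trans hs.1
    have hqs := hq s (Ioc_subset_Icc_self hs)
    have l1 := P.tendsto_average (Ψ := fun _ _ p => p) (by fun_prop) hl hs0 hqs
    have l2 := P.tendsto_average P.contH hl hs0 hqs
    exact ((l1.sub_const c).mul_const _).sub l2
  constructor
  · refine hBint.mono_fun ?_ ?_
    · obtain ⟨e, he⟩ := l.exists_seq_tendsto
      obtain ⟨N, hN⟩ := eventually_atTop.1 (he.eventually hmeas)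
      refine aestronglyMeasurable_of_tendsto_ae atTop (fun n => hN (n + N) (by omega)) ?_
      rw [ae_restrict_iff' measurableSet_uIoc]
      refine ae_of_all _ fun s hs => ?_
      rw [uIoc_of_le hab] at hs
      exact (hlim s hs).comp (he.comp (tendsto_add_atTop_nat N))
    · rw [Filter.EventuallyLE, ae_restrict_iff' measurableSet_uIoc]
      refine ae_of_all _ fun s hs => ?_
      rw [uIoc_of_le hab] at hs
      refine le_of_tendsto (hlim s hs).norm ?_
      filter_upwards [hbound] with ε hε
      exact (hε s hs).trans (le_abs_self _)
  · have hint := intervalIntegral.tendsto_integral_filter_of_dominated_convergence B hmeas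
      (by
        filter_upwards [hbound] with ε hε
        refine ae_of_all _ fun s hs => ?_
        rw [uIoc_of_le hab] at hs
        exact hε s hs) hBint (ae_of_all _ fun s hs => by
        rw [uIoc_of_le hab] at hs
        exact hlim s hs)
    refine tendsto_nhds_unique ?_ hint
    refine Tendsto.congr' ?_ ((P.tendsto_segAvg hl (ha.trans_le hab) (ξ b)).sub
      (P.tendsto_segAvg hl ha (ξ a)))
    filter_upwards [hl.ne_zero] with ε hε
    exact P.segAvg_sub_eq_integral hε ha hab hξ

end SemiconcavePotential
end Burgers

namespace Burgers

/-! ### Trajectories on the universal cover and variations -/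

/-- Trajectories of the Hamiltonian vector field on the universal cover. -/
def IsLiftTraj (h : ℝ → ℝ → ℝ → ℝ) (I : Set ℝ) (ξ p : ℝ → ℝ) : Prop :=
  ∀ s ∈ I, HasDerivWithinAt ξ (dP h s (ξ s) (p s)) I s ∧
    HasDerivWithinAt p (-(dX h s (ξ s) (p s))) I s

/-- The action, reduced by `c`, of a curve in phase space with velocity `∂_p h`. -/
noncomputable def action (h : ℝ → ℝ → ℝ → ℝ) (c : ℝ) (ξ p : ℝ → ℝ) (a b : ℝ) : ℝ :=
  ∫ s in a..b, ((p s - c) * dP h s (ξ s) (p s) - h s (ξ s) (p s))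

lemma absolutelyContinuousOnInterval_of_hasDerivWithinAt {ξ v : ℝ → ℝ} {a b : ℝ} (hab : a ≤ b)
    (hξ : ∀ s ∈ Icc a b, HasDerivWithinAt ξ (v s) (Icc a b) s) (hv : ContinuousOn v (Icc a b)) :
    AbsolutelyContinuousOnInterval ξ a b := by
  obtain ⟨C, hC⟩ := isCompact_Icc.exists_bound_of_continuousOn hv
  have : LipschitzOnWith (Real.toNNReal C) ξ (Icc a b) := by
    refine (convex_Icc a b).lipschitzOnWith_of_nnnorm_hasDerivWithin_le hξ fun s hs => ?_
    rw [← NNReal.coe_le_coe, coe_nnnorm]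
    exact (hC s hs).trans (Real.le_coe_toNNReal _)
  rw [← uIcc_of_le hab] at this
  exact this.absolutelyContinuousOnInterval

lemma ae_deriv_eq_of_hasDerivWithinAt {ξ v : ℝ → ℝ} {a b : ℝ}
    (hξ : ∀ s ∈ Icc a b, HasDerivWithinAt ξ (v s) (Icc a b) s) :
    ∀ᵐ s, s ∈ Ioc a b → deriv ξ s = v s := by
  filter_upwards [compl_mem_ae_iff.2 (measure_singleton (μ := volume) b)] with s hsb hs
  have hsb' : s < b := lt_of_le_of_ne hs.2 hsb
  exact ((hξ s (Ioc_subset_Icc_self hs)).hasDerivAt (Icc_mem_nhds hs.1 hsb')).deriv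

namespace IsLiftTraj

variable {h : ℝ → ℝ → ℝ → ℝ} {I : Set ℝ} {ξ p : ℝ → ℝ}

lemma mono (T : IsLiftTraj h I ξ p) {J : Set ℝ} (hJ : J ⊆ I) : IsLiftTraj h J ξ p :=
  fun s hs => ⟨(T s (hJ hs)).1.mono hJ, (T s (hJ hs)).2.mono hJ⟩

lemma continuousOn_fst (T : IsLiftTraj h I ξ p) : ContinuousOn ξ I :=
  fun s hs => (T s hs).1.continuousWithinAt

lemma continuousOn_snd (T : IsLiftTraj h I ξ p) : ContinuousOn p I :=
  fun s hs => (T s hs).2.continuousWithinAt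

lemma continuousOn_comp (T : IsLiftTraj h I ξ p) {g : ℝ → ℝ → ℝ → ℝ}
    (hg : Continuous (fun z : ℝ × ℝ × ℝ => g z.1 z.2.1 z.2.2)) :
    ContinuousOn (fun s => g s (ξ s) (p s)) I :=
  hg.comp_continuousOn (continuousOn_id.prodMk (T.continuousOn_fst.prodMk T.continuousOn_snd))

lemma continuousOn_action_integrand (T : IsLiftTraj h I ξ p) (hh : Smooth 1 h) (c : ℝ) :
    ContinuousOn (fun s => (p s - c) * dP h s (ξ s) (p s) - h s (ξ s) (p s)) I :=
  ((T.continuousOn_snd.sub continuousOn_const).mul (T.continuousOn_comp hh.continuous_dP)).sub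
    (T.continuousOn_comp hh.continuous)

end IsLiftTraj

lemma continuousOn_action_left {h : ℝ → ℝ → ℝ → ℝ} {ξ p : ℝ → ℝ} {a b : ℝ}
    (T : IsLiftTraj h (Icc a b) ξ p) (hh : Smooth 1 h) (c : ℝ) (hab : a ≤ b) :
    ContinuousOn (fun s => action h c ξ p s b) (Icc a b) := by
  have hi := (T.continuousOn_action_integrand hh c).integrableOn_Icc (μ := volume)
  have h1 := intervalIntegral.continuousOn_primitive_interval_left (a := a) (b := b)
    (by rw [uIcc_of_le hab]; exact hi)
  rw [uIcc_of_le hab] at h1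
  exact h1

lemma continuousOn_action_right {h : ℝ → ℝ → ℝ → ℝ} {ξ p : ℝ → ℝ} {a b : ℝ}
    (T : IsLiftTraj h (Icc a b) ξ p) (hh : Smooth 1 h) (c : ℝ) (hab : a ≤ b) :
    ContinuousOn (fun s => action h c ξ p a s) (Icc a b) := by
  have hi := (T.continuousOn_action_integrand hh c).integrableOn_Icc (μ := volume)
  have h1 := intervalIntegral.continuousOn_primitive_interval (a := a) (b := b)
    (by rw [uIcc_of_le hab]; exact hi)
  rw [uIcc_of_le hab] at h1
  exact h1

/-- A backward Gronwall inequality: with `W(s) = ∫_s^b ω`, the hypothesis makes `W(s) exp(C s)`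
nondecreasing, and it vanishes at `b`. -/
lemma nonpos_of_le_mul_integral {ω : ℝ → ℝ} {a b C : ℝ} (hC : 0 ≤ C)
    (hω : ContinuousOn ω (Icc a b)) (hle : ∀ s ∈ Icc a b, ω s ≤ C * ∫ r in s..b, ω r) :
    ∀ s ∈ Icc a b, ω s ≤ 0 := by
  intro s hs
  have hab : a ≤ b := hs.1.trans hs.2
  have hi := hω.integrableOn_Icc (μ := volume)
  have hW : ContinuousOn (fun s => ∫ r in s..b, ω r) (Icc a b) := by
    have h1 := intervalIntegral.continuousOn_primitive_interval_left (a := a) (b := b)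
      (by rw [uIcc_of_le hab]; exact hi)
    rwa [uIcc_of_le hab] at h1
  have hmono : MonotoneOn (fun s => (∫ r in s..b, ω r) * Real.exp (C * s)) (Icc a b) := by
    have hd : ∀ r ∈ interior (Icc a b), HasDerivAt
        (fun s => (∫ r in s..b, ω r) * Real.exp (C * s))
        (-ω r * Real.exp (C * r) + (∫ z in r..b, ω z) * (Real.exp (C * r) * (C * 1))) r := by
      intro r hr
      rw [interior_Icc] at hr
      refine HasDerivAt.mul ?_ (((hasDerivAt_id r).const_mul C).exp)
      refine intervalIntegral.integral_hasDerivAt_left ?_ ?_ ?_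
      · exact (hω.mono (Icc_subset_Icc_left hr.1.le)).intervalIntegrable_of_Icc hr.2.le
      · exact (hω.mono Ioo_subset_Icc_self).stronglyMeasurableAtFilter isOpen_Ioo r hr
      · exact hω.continuousAt (Icc_mem_nhds hr.1 hr.2)
    refine monotoneOn_of_deriv_nonneg (convex_Icc a b) (hW.mul (by fun_prop))
      (fun r hr => (hd r hr).differentiableAt.differentiableWithinAt) fun r hr => ?_
    rw [(hd r hr).deriv]
    have := hle r (interior_subset hr)
    have e := Real.exp_pos (C * r)
    nlinarith
  have h1 := hmono hs ⟨hab, le_rfl⟩ hs.2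
  simp only [intervalIntegral.integral_same, zero_mul] at h1
  have h2 : ∫ r in s..b, ω r ≤ 0 := by
    by_contra hn
    push Not at hn
    exact absurd h1 (not_le.2 (mul_pos hn (Real.exp_pos _)))
  exact (hle s hs).trans (mul_nonpos_of_nonneg_of_nonpos hC h2)

namespace SemiconcavePotential

variable {h : ℝ → ℝ → ℝ → ℝ} {c t₀ : ℝ} {K : ℝ → ℝ} {y u : ℝ → ℝ → ℝ}

lemma exists_right_value (P : SemiconcavePotential h c t₀ K y u) (ξ : ℝ → ℝ) :
    ∃ q : ℝ → ℝ, ∀ s, t₀ < s → Tendsto (y s) (𝓝[>] (ξ s)) (𝓝 (q s)) := by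
  have : ∀ s, ∃ q, t₀ < s → Tendsto (y s) (𝓝[>] (ξ s)) (𝓝 q) := fun s => by
    by_cases hs : t₀ < s
    · obtain ⟨q, hq, -⟩ := (P.upperLip s hs).exists_tendsto_right (ξ s)
      exact ⟨q, fun _ => hq⟩
    · exact ⟨0, fun hs' => absurd hs' hs⟩
  choose q hq using this
  exact ⟨q, hq⟩

lemma exists_left_value (P : SemiconcavePotential h c t₀ K y u) (ξ : ℝ → ℝ) :
    ∃ q : ℝ → ℝ, ∀ s, t₀ < s → Tendsto (y s) (𝓝[<] (ξ s)) (𝓝 (q s)) := by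
  have : ∀ s, ∃ q, t₀ < s → Tendsto (y s) (𝓝[<] (ξ s)) (𝓝 q) := fun s => by
    by_cases hs : t₀ < s
    · obtain ⟨q, hq, -⟩ := (P.upperLip s hs).exists_tendsto_left (ξ s)
      exact ⟨q, fun _ => hq⟩
    · exact ⟨0, fun hs' => absurd hs' hs⟩
  choose q hq using this
  exact ⟨q, hq⟩

/-- The potential is dominated by any upper bound of the Lagrangian action. -/
lemma sub_le_integral (P : SemiconcavePotential h c t₀ K y u) {a b : ℝ} (ha : t₀ < a)
    (hab : a ≤ b) {ζ v g : ℝ → ℝ} (hζ : AbsolutelyContinuousOnInterval ζ a b)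
    (hv : ∀ᵐ s, s ∈ Ioc a b → deriv ζ s = v s) (hg : IntervalIntegrable g volume a b)
    (hle : ∀ᵐ s, s ∈ Ioc a b → ∀ q, (q - c) * v s - h s (ζ s) q ≤ g s) :
    u b (ζ b) - u a (ζ a) ≤ ∫ s in a..b, g s := by
  -- Either side would do, since the pointwise bound is assumed for every momentum.
  obtain ⟨q, hq⟩ := P.exists_right_value ζ
  obtain ⟨h1, h2⟩ := P.chain_rule isSideFilter_right ha hab hζ
    (q := q) fun s hs => (hq s (ha.trans_le hs.1)).comp (tendsto_add_left_nhdsGT _)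
  rw [h2]
  refine intervalIntegral.integral_mono_ae_restrict hab h1 hg ?_
  rw [Filter.EventuallyLE, ae_restrict_iff' measurableSet_Icc]
  have hane : ∀ᵐ s : ℝ, s ≠ a := compl_mem_ae_iff.2 (measure_singleton (μ := volume) a)
  filter_upwards [hv, hle, hane] with s hs1 hs2 hsa hs
  have hs' : s ∈ Ioc a b := ⟨lt_of_le_of_ne hs.1 (Ne.symm hsa), hs.2⟩
  rw [hs1 hs']
  exact hs2 hs' _

/-- Upper bound for the potential along affine variations of a trajectory. -/
lemma exists_variation_le (P : SemiconcavePotential h c t₀ K y u) (hh : Smooth 2 h)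
    (hpos : ∀ s x p, 0 < dP (dP h) s x p) (hconv : ∀ s x, ConvexOn ℝ univ (h s x))
    {a₀ b : ℝ} {ξ p : ℝ → ℝ} (T : IsLiftTraj h (Icc a₀ b) ξ p) (α β : ℝ) :
    ∃ δ > 0, ∃ C ≥ 0, ∀ a ∈ Icc a₀ b, t₀ < a → ∀ η, |η| ≤ δ →
      u b (ξ b + η * (α + β * b)) - u a (ξ a + η * (α + β * a)) ≤
        action h c ξ p a b + η * ((p b - c) * (α + β * b) - (p a - c) * (α + β * a))
          + C * η ^ 2 := by
  have h1 : Smooth 1 h := ContDiff.of_le hh (by norm_num)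
  obtain ⟨X, hX⟩ := isCompact_Icc.exists_bound_of_continuousOn T.continuousOn_fst
  obtain ⟨R, hR⟩ := isCompact_Icc.exists_bound_of_continuousOn T.continuousOn_snd
  obtain ⟨δ₀, hδ₀, C, hC0, hC⟩ := hh.exists_fenchel_variation hpos hconv a₀ b X R
  obtain ⟨B, hB⟩ := isCompact_Icc.exists_bound_of_continuousOn
    (s := Icc a₀ b) (f := fun s => α + β * s) (by fun_prop)
  set M := |B| + |β| + 1 with hM
  have hM0 : 0 < M := by positivity
  -- The constants are computed on all of `[a₀, b]` and do not depend on `a`, so `a` may later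
  -- decrease to `t₀`.
  refine ⟨δ₀ / M, by positivity, 2 * C * M ^ 2 * |b - a₀|, by positivity, ?_⟩
  intro a ha hta η hη
  have hab := ha.2
  have hηM : |η| * M ≤ δ₀ := by rwa [le_div_iff₀ hM0] at hη
  have Ta := T.mono (Icc_subset_Icc_left ha.1 : Icc a b ⊆ Icc a₀ b)
  have hd : ∀ s ∈ Icc a b, HasDerivWithinAt (fun s => ξ s + η * (α + β * s))
      (dP h s (ξ s) (p s) + η * β) (Icc a b) s := fun s hs => by
    have := ((((hasDerivAt_id s).const_mul β).const_add α).const_mul η).hasDerivWithinAt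
      (s := Icc a b)
    refine ((Ta s hs).1.add this).congr_deriv ?_
    ring
  have hcv := (Ta.continuousOn_comp h1.continuous_dP)
  have hcx := (Ta.continuousOn_comp h1.continuous_dX)
  have hac := absolutelyContinuousOnInterval_of_hasDerivWithinAt hab hd
    (hcv.add continuousOn_const)
  set g1 : ℝ → ℝ := fun s => (p s - c) * dP h s (ξ s) (p s) - h s (ξ s) (p s) with hg1
  set g2 : ℝ → ℝ := fun s => (p s - c) * β - (α + β * s) * dX h s (ξ s) (p s) with hg2
  have hg1c : ContinuousOn g1 (Icc a b) := Ta.continuousOn_action_integrand h1 c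
  have hg2c : ContinuousOn g2 (Icc a b) :=
    ((Ta.continuousOn_snd.sub continuousOn_const).mul continuousOn_const).sub
      (ContinuousOn.mul (by fun_prop) hcx)
  have hi1 := hg1c.intervalIntegrable_of_Icc (μ := volume) hab
  have hi2 := hg2c.intervalIntegrable_of_Icc (μ := volume) hab
  have hbase := P.sub_le_integral hta hab hac (ae_deriv_eq_of_hasDerivWithinAt hd)
    (g := fun s => g1 s + η * g2 s + 2 * C * M ^ 2 * η ^ 2)
    ((hi1.add (hi2.const_mul η)).add intervalIntegrable_const) (ae_of_all _ fun s hs q => by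
      have hs' : s ∈ Icc a₀ b := ⟨ha.1.trans hs.1.le, hs.2⟩
      have hBs : |α + β * s| ≤ M := by
        have := (hB s hs').trans (le_abs_self B)
        rw [Real.norm_eq_abs] at this
        have := abs_nonneg β
        linarith
      have hβM : |β| ≤ M := by linarith [abs_nonneg B]
      have hd1 : |η * (α + β * s)| ≤ δ₀ := by
        rw [abs_mul]; exact (mul_le_mul_of_nonneg_left hBs (abs_nonneg η)).trans hηM
      have hd2 : |η * β| ≤ δ₀ := by
        rw [abs_mul]; exact (mul_le_mul_of_nonneg_left hβM (abs_nonneg η)).trans hηM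
      have := hC s hs' (ξ s) (hX s hs') (p s) (hR s hs') _ hd1 _ hd2 q
      have s1 : (η * (α + β * s)) ^ 2 ≤ η ^ 2 * M ^ 2 := by
        rw [mul_pow]
        exact mul_le_mul_of_nonneg_left (sq_le_sq' (by linarith [neg_abs_le (α + β * s)])
          ((le_abs_self _).trans hBs)) (sq_nonneg η)
      have s2 : (η * β) ^ 2 ≤ η ^ 2 * M ^ 2 := by
        rw [mul_pow]
        exact mul_le_mul_of_nonneg_left (sq_le_sq' (by linarith [neg_abs_le β])
          ((le_abs_self _).trans hβM)) (sq_nonneg η)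
      have s3 : C * ((η * (α + β * s)) ^ 2 + (η * β) ^ 2) ≤ 2 * C * M ^ 2 * η ^ 2 := by
        have := mul_le_mul_of_nonneg_left (add_le_add s1 s2) hC0
        linarith
      simp only [hg1, hg2]
      linarith)
  -- The first variation is a boundary term because `p' = -∂ₓh` along the trajectory.
  have hint : ∫ s in a..b, g2 s = (p b - c) * (α + β * b) - (p a - c) * (α + β * a) := by
    refine intervalIntegral.integral_eq_sub_of_hasDeriv_right_of_le hab
      (f := fun s => (p s - c) * (α + β * s))
      ((Ta.continuousOn_snd.sub continuousOn_const).mul (by fun_prop)) (fun s hs => ?_) hi2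
    have h3 := ((Ta s (Ioo_subset_Icc_self hs)).2.hasDerivAt (Icc_mem_nhds hs.1 hs.2)).sub_const c
    have h4 := ((hasDerivAt_id s).const_mul β).const_add α
    refine ((h3.mul h4).congr_deriv ?_).hasDerivWithinAt
    simp only [hg2, id]; ring
  rw [intervalIntegral.integral_add (hi1.add (hi2.const_mul η)) intervalIntegrable_const,
    intervalIntegral.integral_add hi1 (hi2.const_mul η), intervalIntegral.integral_const_mul,
    hint, intervalIntegral.integral_const, smul_eq_mul] at hbase
  have hact : ∫ s in a..b, g1 s = action h c ξ p a b := rfl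
  rw [hact] at hbase
  have e1 : (b - a) * (2 * C * M ^ 2 * η ^ 2) ≤ 2 * C * M ^ 2 * |b - a₀| * η ^ 2 := by
    have h5 := mul_le_mul_of_nonneg_right
      (show b - a ≤ |b - a₀| from (by linarith [ha.1] : b - a ≤ b - a₀).trans (le_abs_self _))
      (by positivity : 0 ≤ 2 * C * M ^ 2 * η ^ 2)
    linarith
  linarith

end SemiconcavePotential
end Burgers

namespace Burgers

/-! ### Uniqueness and stability of trajectories -/

section ODE

variable {h : ℝ → ℝ → ℝ → ℝ}

/-- The Hamiltonian vector field. -/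
noncomputable def hamField (h : ℝ → ℝ → ℝ → ℝ) (s : ℝ) (z : ℝ × ℝ) : ℝ × ℝ :=
  (dP h s z.1 z.2, -(dX h s z.1 z.2))

lemma Smooth.exists_lipschitzOnWith_hamField (hh : Smooth 2 h) (a b X R : ℝ) :
    ∃ L : NNReal, ∀ s ∈ Icc a b, LipschitzOnWith L (hamField h s) (Icc (-X) X ×ˢ Icc (-R) R) := by
  have hc : ContDiff ℝ 1 (fun z : ℝ × ℝ × ℝ => hamField h z.1 z.2) :=
    ContDiff.prodMk hh.dP (ContDiff.neg hh.dX)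
  obtain ⟨L, hL⟩ := hc.contDiffOn.exists_lipschitzOnWith (by decide)
    ((convex_Icc a b).prod ((convex_Icc (-X) X).prod (convex_Icc (-R) R)))
    (isCompact_Icc.prod (isCompact_Icc.prod isCompact_Icc))
  refine ⟨L, fun s hs => LipschitzOnWith.of_dist_le_mul fun z hz w hw => ?_⟩
  have := hL.dist_le_mul (s, z) ⟨hs, hz⟩ (s, w) ⟨hs, hw⟩
  rwa [Prod.dist_eq (x := (s, z)), dist_self, max_eq_right dist_nonneg] at this

lemma IsLiftTraj.hasDerivWithinAt_prod {I : Set ℝ} {ξ p : ℝ → ℝ} (T : IsLiftTraj h I ξ p) {s : ℝ}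
    (hs : s ∈ I) : HasDerivWithinAt (fun s => (ξ s, p s)) (hamField h s (ξ s, p s)) I s :=
  (T s hs).1.prodMk (T s hs).2

lemma IsLiftTraj.continuousOn_prod {I : Set ℝ} {ξ p : ℝ → ℝ} (T : IsLiftTraj h I ξ p) :
    ContinuousOn (fun s => (ξ s, p s)) I := T.continuousOn_fst.prodMk T.continuousOn_snd

lemma IsLiftTraj.exists_bound {a b : ℝ} {ξ p : ℝ → ℝ} (T : IsLiftTraj h (Icc a b) ξ p) :
    ∃ R, ∀ s ∈ Icc a b, (ξ s, p s) ∈ Icc (-R) R ×ˢ Icc (-R) R := by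
  obtain ⟨X, hX⟩ := isCompact_Icc.exists_bound_of_continuousOn T.continuousOn_fst
  obtain ⟨R, hR⟩ := isCompact_Icc.exists_bound_of_continuousOn T.continuousOn_snd
  exact ⟨max X R, fun s hs => ⟨abs_le.1 ((hX s hs).trans (le_max_left _ _)),
    abs_le.1 ((hR s hs).trans (le_max_right _ _))⟩⟩

/-- Backward Gronwall estimate for two trajectories that stay in a common box. -/
lemma IsLiftTraj.dist_le {a b L R : ℝ} (hL0 : 0 ≤ L)
    (hL : ∀ s ∈ Icc a b, LipschitzOnWith (Real.toNNReal L) (hamField h s)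
      (Icc (-R) R ×ˢ Icc (-R) R)) {ξ p ξ' p' : ℝ → ℝ}
    (T : IsLiftTraj h (Icc a b) ξ p) (T' : IsLiftTraj h (Icc a b) ξ' p')
    (hb : ∀ s ∈ Ioc a b, (ξ s, p s) ∈ Icc (-R) R ×ˢ Icc (-R) R)
    (hb' : ∀ s ∈ Ioc a b, (ξ' s, p' s) ∈ Icc (-R) R ×ˢ Icc (-R) R) (hab : a ≤ b) :
    dist (ξ a, p a) (ξ' a, p' a) ≤ dist (ξ b, p b) (ξ' b, p' b) * Real.exp (L * (b - a)) := by
  -- The library estimate runs forward in time, so the trajectories are reversed by `t ↦ a + b - t`.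
  -- The box condition is needed only on `(a, b]`, which is what the continuation argument below can
  -- supply.
  have hrev : ∀ t ∈ Icc a b, a + b - t ∈ Icc a b := fun t ht =>
    ⟨by linarith [ht.2], by linarith [ht.1]⟩
  have hrev' : ∀ t ∈ Ico a b, a + b - t ∈ Ioc a b := fun t ht =>
    ⟨by linarith [ht.2], by linarith [ht.1]⟩
  have key : ∀ {ξ p : ℝ → ℝ}, IsLiftTraj h (Icc a b) ξ p → ∀ t ∈ Ico a b,
      HasDerivWithinAt (fun t => (ξ (a + b - t), p (a + b - t)))
        (-hamField h (a + b - t) (ξ (a + b - t), p (a + b - t))) (Ici t) t := by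
    intro ξ p T t ht
    have h1 := T.hasDerivWithinAt_prod (hrev t (Ico_subset_Icc_self ht))
    have h2 : HasDerivWithinAt (fun t => a + b - t) (-1) (Icc a b) t :=
      ((hasDerivAt_id t).const_sub (a + b)).hasDerivWithinAt
    have h3 := h1.scomp t h2 (fun t ht => hrev t ht)
    rw [neg_one_smul] at h3
    exact h3.mono_of_mem_nhdsWithin (Icc_mem_nhdsGE_of_mem ht)
  have hcont : ∀ {ξ p : ℝ → ℝ}, IsLiftTraj h (Icc a b) ξ p →
      ContinuousOn (fun t => (ξ (a + b - t), p (a + b - t))) (Icc a b) := fun T =>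
    T.continuousOn_prod.comp (by fun_prop) fun t ht => hrev t ht
  have := dist_le_of_trajectories_ODE_of_mem (v := fun t z => -hamField h (a + b - t) z)
    (s := fun _ => Icc (-R) R ×ˢ Icc (-R) R) (a := a) (b := b) (K := Real.toNNReal L)
    (δ := dist (ξ b, p b) (ξ' b, p' b))
    (fun t ht => (hL _ (hrev t (Ico_subset_Icc_self ht))).neg)
    (hcont T) (key T) (fun t ht => hb _ (hrev' t ht))
    (hcont T') (key T') (fun t ht => hb' _ (hrev' t ht)) (by simp) b ⟨hab, le_rfl⟩
  simpa [Real.coe_toNNReal L hL0] using this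

/-- Trajectories depend continuously on their terminal value. -/
lemma Smooth.exists_stability (hh : Smooth 2 h) {a b : ℝ} {ξ p : ℝ → ℝ}
    (T : IsLiftTraj h (Icc a b) ξ p) :
    ∃ δ > 0, ∃ C ≥ 0, ∀ ξ' p' : ℝ → ℝ, IsLiftTraj h (Icc a b) ξ' p' →
      dist (ξ b, p b) (ξ' b, p' b) ≤ δ → ∀ s ∈ Icc a b,
        dist (ξ s, p s) (ξ' s, p' s) ≤ C * dist (ξ b, p b) (ξ' b, p' b) := by
  obtain ⟨R, hR⟩ := T.exists_bound
  obtain ⟨L, hL⟩ := hh.exists_lipschitzOnWith_hamField a b (R + 1) (R + 1)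
  set E := Real.exp (L * |b - a|) with hE
  have hE0 : 0 < E := Real.exp_pos _
  have hbox : ∀ {z w : ℝ × ℝ}, z ∈ Icc (-R) R ×ˢ Icc (-R) R → dist z w < 1 →
      w ∈ Icc (-(R + 1)) (R + 1) ×ˢ Icc (-(R + 1)) (R + 1) := by
    intro z w hz hd
    rw [Prod.dist_eq, max_lt_iff, Real.dist_eq, Real.dist_eq, abs_lt, abs_lt] at hd
    obtain ⟨⟨a1, a2⟩, a3, a4⟩ := hz
    refine ⟨⟨?_, ?_⟩, ?_, ?_⟩ <;> linarith
  have hE1 : ∀ s ∈ Icc a b, Real.exp ((L : ℝ) * (b - s)) ≤ E := fun s hs => by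
    rw [hE]
    refine Real.exp_le_exp.2 (mul_le_mul_of_nonneg_left ?_ L.2)
    rw [abs_of_nonneg (by linarith [hs.1, hs.2])]
    linarith [hs.1]
  -- With this radius the Gronwall bound stays below one, so the second trajectory cannot leave the
  -- enlarged box on which the field is Lipschitz.
  refine ⟨1 / (2 * E), by positivity, E, hE0.le, fun ξ' p' T' hd => ?_⟩
  have hL' : ∀ s ∈ Icc a b, LipschitzOnWith (Real.toNNReal L) (hamField h s)
      (Icc (-(R + 1)) (R + 1) ×ˢ Icc (-(R + 1)) (R + 1)) := by simpa using hL
  have step : ∀ s ∈ Icc a b,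
      (∀ r ∈ Ioc s b, dist (ξ r, p r) (ξ' r, p' r) < 1) →
      dist (ξ s, p s) (ξ' s, p' s) ≤ E * dist (ξ b, p b) (ξ' b, p' b) := by
    intro s hs hr
    have hsub : Icc s b ⊆ Icc a b := Icc_subset_Icc_left hs.1
    have := IsLiftTraj.dist_le L.2 (fun r hr => hL' r (hsub hr)) (T.mono hsub) (T'.mono hsub)
      (fun r hr' => hbox (hR r (hsub (Ioc_subset_Icc_self hr'))) (by simp))
      (fun r hr' => hbox (hR r (hsub (Ioc_subset_Icc_self hr'))) (hr r hr')) hs.2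
    refine this.trans ?_
    rw [mul_comm]
    exact mul_le_mul_of_nonneg_right (hE1 s hs) dist_nonneg
  have hsmall : E * dist (ξ b, p b) (ξ' b, p' b) < 1 := by
    rw [le_div_iff₀ (by positivity)] at hd
    linarith
  have hlt : ∀ s ∈ Icc a b, dist (ξ s, p s) (ξ' s, p' s) < 1 := by
    by_contra hcon
    push Not at hcon
    -- If the distance reached one, look at the last such time: after it both trajectories are in
    -- the box, so the estimate applies up to that time and contradicts it.
    set S := {s ∈ Icc a b | 1 ≤ dist (ξ s, p s) (ξ' s, p' s)} with hS
    have hSne : S.Nonempty := hcon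
    have hcd : ContinuousOn (fun s => dist (ξ s, p s) (ξ' s, p' s)) (Icc a b) :=
      continuous_dist.comp_continuousOn (T.continuousOn_prod.prodMk T'.continuousOn_prod)
    have hScl : IsClosed S := hcd.preimage_isClosed_of_isClosed isClosed_Icc isClosed_Ici
    have hScomp : IsCompact S := isCompact_Icc.of_isClosed_subset hScl fun s hs => hs.1
    have hmem := hScomp.sSup_mem hSne
    have := step _ hmem.1 fun r hr => by
      by_contra hn
      push Not at hn
      have : r ∈ S := ⟨⟨hmem.1.1.trans hr.1.le, hr.2⟩, hn⟩
      exact absurd (le_csSup hScomp.bddAbove this) (not_le.2 hr.1)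
    linarith [hmem.2]
  exact fun s hs => step s hs fun r hr => hlt r ⟨hs.1.trans hr.1.le, hr.2⟩

lemma Smooth.eq_of_eq_right (hh : Smooth 2 h) {a b : ℝ} {ξ p ξ' p' : ℝ → ℝ}
    (T : IsLiftTraj h (Icc a b) ξ p) (T' : IsLiftTraj h (Icc a b) ξ' p') (h1 : ξ b = ξ' b)
    (h2 : p b = p' b) : ∀ s ∈ Icc a b, ξ s = ξ' s ∧ p s = p' s := by
  obtain ⟨δ, hδ, C, hC, hst⟩ := hh.exists_stability T
  intro s hs
  have := hst ξ' p' T' (by simp [h1, h2, hδ.le]) s hs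
  rw [h1, h2, dist_self, mul_zero] at this
  simpa using dist_le_zero.1 this

lemma Smooth.eq_of_eq_left (hh : Smooth 2 h) {a b : ℝ} {ξ p ξ' p' : ℝ → ℝ}
    (T : IsLiftTraj h (Icc a b) ξ p) (T' : IsLiftTraj h (Icc a b) ξ' p') (h1 : ξ a = ξ' a)
    (h2 : p a = p' a) : ∀ s ∈ Icc a b, ξ s = ξ' s ∧ p s = p' s := by
  obtain ⟨R, hR⟩ := T.exists_bound
  obtain ⟨R', hR'⟩ := T'.exists_bound
  obtain ⟨L, hL⟩ := hh.exists_lipschitzOnWith_hamField a b (max R R') (max R R')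
  have m1 : Icc (-R) R ×ˢ Icc (-R) R ⊆
      Icc (-max R R') (max R R') ×ˢ Icc (-max R R') (max R R') :=
    prod_mono (Icc_subset_Icc (neg_le_neg (le_max_left _ _)) (le_max_left _ _))
      (Icc_subset_Icc (neg_le_neg (le_max_left _ _)) (le_max_left _ _))
  have m2 : Icc (-R') R' ×ˢ Icc (-R') R' ⊆
      Icc (-max R R') (max R R') ×ˢ Icc (-max R R') (max R R') :=
    prod_mono (Icc_subset_Icc (neg_le_neg (le_max_right _ _)) (le_max_right _ _))
      (Icc_subset_Icc (neg_le_neg (le_max_right _ _)) (le_max_right _ _))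
  have := ODE_solution_unique_of_mem_Icc_right (v := hamField h)
    (s := fun _ => Icc (-max R R') (max R R') ×ˢ Icc (-max R R') (max R R'))
    (fun t ht => hL t (Ico_subset_Icc_self ht)) T.continuousOn_prod
    (fun t ht => (T.hasDerivWithinAt_prod (Ico_subset_Icc_self ht)).mono_of_mem_nhdsWithin
      (Icc_mem_nhdsGE_of_mem ht)) (fun t ht => m1 (hR t (Ico_subset_Icc_self ht)))
    T'.continuousOn_prod
    (fun t ht => (T'.hasDerivWithinAt_prod (Ico_subset_Icc_self ht)).mono_of_mem_nhdsWithin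
      (Icc_mem_nhdsGE_of_mem ht)) (fun t ht => m2 (hR' t (Ico_subset_Icc_self ht)))
    (by simp [h1, h2])
  intro s hs
  simpa using this hs

end ODE
end Burgers

namespace Burgers

/-! ### Backward trajectories are calibrated -/

namespace SemiconcavePotential

variable {h : ℝ → ℝ → ℝ → ℝ} {c t₀ : ℝ} {K : ℝ → ℝ} {y u : ℝ → ℝ → ℝ}

/-- At a point where `y t` is differentiable, `u t` is bounded below by a parabola. -/
lemma exists_lower_parabola (P : SemiconcavePotential h c t₀ K y u) {t x : ℝ} (ht : t₀ < t)
    (hd : DifferentiableAt ℝ (y t) x) :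
    ∃ δ > 0, ∃ C ≥ 0, ∀ η, |η| ≤ δ → u t x + (y t x - c) * η - C * η ^ 2 ≤ u t (x + η) := by
  obtain ⟨C, hC⟩ := hd.hasDerivAt.isBigO_sub.bound
  rw [Metric.eventually_nhds_iff] at hC
  obtain ⟨δ, hδ, hδC⟩ := hC
  refine ⟨δ / 2, by positivity, max C 0, le_max_right _ _, fun η hη => ?_⟩
  have h1 := P.pot' ht x (x + η)
  have h2 : ‖∫ r in x..(x + η), (y t r - y t x)‖ ≤ max C 0 * |η| * |x + η - x| := by
    refine intervalIntegral.norm_integral_le_of_norm_le_const fun r hr => ?_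
    have hrx : |r - x| ≤ |η| := by
      have := abs_sub_left_of_mem_uIcc (uIoc_subset_uIcc hr)
      rwa [add_sub_cancel_left] at this
    have := hδC (show dist r x < δ by rw [Real.dist_eq]; linarith)
    refine this.trans ?_
    rw [Real.norm_eq_abs]
    exact mul_le_mul (le_max_left _ _) hrx (abs_nonneg _) (le_max_right _ _)
  rw [intervalIntegral.integral_sub (P.intervalIntegrable ht _ _) intervalIntegrable_const,
    intervalIntegral.integral_const, add_sub_cancel_left, smul_eq_mul, Real.norm_eq_abs,
    mul_assoc, ← abs_mul, ← pow_two, abs_sq] at h2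
  have h3 := (_root_.abs_le.1 h2).1
  linarith

lemma abs_le_of_tendsto (P : SemiconcavePotential h c t₀ K y u) {a t : ℝ} (ha : t₀ < a)
    (hat : a ≤ t) {l : Filter ℝ} [l.NeBot] {q : ℝ} (hq : Tendsto (y t) l (𝓝 q)) :
    |q| ≤ K a + |c| :=
  le_of_tendsto hq.abs (Eventually.of_forall fun x => P.abs_le ha hat x)

/-- The variation inequality at `η = 0`: the potential is dominated by the action of any trajectory.
-/
lemma sub_le_action (P : SemiconcavePotential h c t₀ K y u) (hh : Smooth 2 h)
    (hpos : ∀ s x p, 0 < dP (dP h) s x p) (hconv : ∀ s x, ConvexOn ℝ univ (h s x))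
    {a b : ℝ} (ha : t₀ < a) {ξ p : ℝ → ℝ} (T : IsLiftTraj h (Icc a b) ξ p) :
    ∀ s ∈ Icc a b, u b (ξ b) - u s (ξ s) ≤ action h c ξ p s b := by
  obtain ⟨δ, hδ, C, -, hC⟩ := P.exists_variation_le hh hpos hconv T 0 0
  intro s hs
  simpa using hC s hs (ha.trans_le hs.1) 0 (by simp [hδ.le])

lemma continuousOn_along (P : SemiconcavePotential h c t₀ K y u) {a b : ℝ} (ha : t₀ ≤ a)
    {ξ : ℝ → ℝ} (hξ : ContinuousOn ξ (Icc a b)) : ContinuousOn (fun s => u s (ξ s)) (Icc a b) :=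
  P.cont.comp (f := fun s => (s, ξ s)) (continuousOn_id.prodMk hξ)
    fun _ hs => ⟨ha.trans hs.1, mem_univ _⟩

/-- Backward trajectories from differentiability points of `y b` are calibrated. -/
theorem calibrated_of_differentiableAt (P : SemiconcavePotential h c t₀ K y u) (hh : Smooth 2 h)
    (hpos : ∀ s x p, 0 < dP (dP h) s x p) (hconv : ∀ s x, ConvexOn ℝ univ (h s x))
    {a b : ℝ} (ha : t₀ < a) (hab : a ≤ b) {ξ p : ℝ → ℝ} (T : IsLiftTraj h (Icc a b) ξ p)
    (hd : DifferentiableAt ℝ (y b) (ξ b)) (hpb : p b = y b (ξ b)) :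
    ∀ s ∈ Icc a b, u b (ξ b) - u s (ξ s) = action h c ξ p s b := by
  have h1 : Smooth 1 h := ContDiff.of_le hh (by norm_num)
  obtain ⟨X, hX⟩ := T.exists_bound
  set R := max X (K a + |c|) with hR
  have hKa := P.pos a ha
  have hR0 : 0 < R := lt_of_lt_of_le (by positivity) (le_max_right _ _)
  have hξX : ∀ s ∈ Icc a b, |ξ s| ≤ X := fun s hs => _root_.abs_le.2 (hX s hs).1
  have hpR : ∀ s ∈ Icc a b, |p s| ≤ R := fun s hs =>
    (_root_.abs_le.2 (hX s hs).2).trans (le_max_left _ _)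
  obtain ⟨q, hq⟩ := P.exists_right_value ξ
  have hqR : ∀ s ∈ Icc a b, |q s| ≤ R := fun s hs =>
    (P.abs_le_of_tendsto ha hs.1 (hq s (ha.trans_le hs.1))).trans (le_max_right _ _)
  obtain ⟨δ₁, hδ₁, C₁, hC₁0, hC₁⟩ := P.exists_variation_le hh hpos hconv T 1 0
  obtain ⟨δ₂, hδ₂, C₂, hC₂0, hC₂⟩ := P.exists_lower_parabola (ha.trans_le hab) hd
  obtain ⟨C₃, hC₃0, hC₃⟩ := hh.exists_deficit_le a b X R
  -- The calibration defect, to be shown nonpositive. The reverse inequality is `sub_le_action`.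
  set ω : ℝ → ℝ := fun s => action h c ξ p s b - (u b (ξ b) - u s (ξ s)) with hω
  have hωc : ContinuousOn ω (Icc a b) := (continuousOn_action_left T h1 c hab).sub
    (continuousOn_const.sub (P.continuousOn_along ha.le T.continuousOn_fst))
  set δ := min δ₁ δ₂ with hδ
  have hδ0 : 0 < δ := lt_min hδ₁ hδ₂
  -- The first three terms are the curvatures of the variation, of the lower parabola at `b` and of
  -- the semiconcavity bound. The term `R / δ` only makes `M` large enough for the optimal `η` to be
  -- admissible.
  set M := C₁ + C₂ + K a / 2 + R / δ with hM
  have hM0 : 0 < M := by positivity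
  have hquad : ∀ s ∈ Icc a b, (q s - p s) ^ 2 ≤ 4 * M * ω s := by
    intro s hs
    have hs0 := ha.trans_le hs.1
    have hKs : K s ≤ K a := P.anti ha hs0 hs.1
    set e := q s - p s with he
    have heE : |e| ≤ 2 * R := by
      have := abs_sub (q s) (p s)
      linarith [hqR s hs, hpR s hs]
    -- The minimizer of `e η + M η²`. It turns nonnegativity of `ω s + e η + M η²` into `e² ≤ 4 M ω
    -- s`.
    set η := -e / (2 * M) with hη
    have hηδ : |η| ≤ δ := by
      rw [hη, abs_div, abs_neg, abs_of_pos (by positivity : 0 < 2 * M), div_le_iff₀ (by positivity)]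
      have : δ * (R / δ) = R := by field_simp
      have h2 : 0 ≤ δ * (C₁ + C₂ + K a / 2) := by positivity
      rw [hM]
      nlinarith
    have v1 := hC₁ s hs hs0 η (hηδ.trans (min_le_left _ _))
    have v2 := hC₂ η (hηδ.trans (min_le_right _ _))
    have v3 := P.le_of_isSuperValue hs0
      ((P.upperLip s hs0).isSuperValue_of_tendsto_right (hq s hs0)) η
    simp only [zero_mul, add_zero, mul_one] at v1
    rw [← hpb] at v2
    have v4 : K s / 2 * η ^ 2 ≤ K a / 2 * η ^ 2 := by gcongr
    have v5 : 0 ≤ R / δ * η ^ 2 := by positivity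
    have v6 : 0 ≤ ω s + e * η + M * η ^ 2 := by
      rw [hM]
      simp only [hω, he]
      linarith
    have v7 : e * η + M * η ^ 2 = - (e ^ 2 / (4 * M)) := by
      rw [hη]; field_simp; ring
    have v8 : e ^ 2 / (4 * M) ≤ ω s := by linarith
    rwa [div_le_iff₀ (by positivity), mul_comm] at v8
  have hωint : ∀ s ∈ Icc a b, ω s ≤ (C₃ * (4 * M)) * ∫ r in s..b, ω r := by
    intro s hs
    have hs0 := ha.trans_le hs.1
    have hsub : Icc s b ⊆ Icc a b := Icc_subset_Icc_left hs.1
    have Ts := T.mono hsub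
    have hac := absolutelyContinuousOnInterval_of_hasDerivWithinAt hs.2 (fun r hr => (Ts r hr).1)
      (Ts.continuousOn_comp h1.continuous_dP)
    obtain ⟨i1, i2⟩ := P.chain_rule isSideFilter_right hs0 hs.2 hac (q := q) fun r hr =>
      (hq r (hs0.trans_le hr.1)).comp (tendsto_add_left_nhdsGT _)
    have i3 : IntervalIntegrable (fun r => (p r - c) * dP h r (ξ r) (p r) - h r (ξ r) (p r))
        volume s b := (Ts.continuousOn_action_integrand h1 c).intervalIntegrable_of_Icc hs.2
    have i4 : IntervalIntegrable ω volume s b := (hωc.mono hsub).intervalIntegrable_of_Icc hs.2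
    -- Along the trajectory `ξ' = ∂_p h`, so the difference of the two integrands is the gap of `h`
    -- at `q` above its tangent at `p`, which is quadratic in `q - p`.
    have e1 : ω s = ∫ r in s..b, (((p r - c) * dP h r (ξ r) (p r) - h r (ξ r) (p r)) -
        ((q r - c) * deriv ξ r - h r (ξ r) (q r))) := by
      rw [intervalIntegral.integral_sub i3 i1, ← i2]
      rfl
    rw [e1, ← intervalIntegral.integral_const_mul]
    refine intervalIntegral.integral_mono_ae_restrict hs.2 (i3.sub i1) (i4.const_mul _) ?_
    rw [Filter.EventuallyLE, ae_restrict_iff' measurableSet_Icc]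
    have hane : ∀ᵐ r : ℝ, r ≠ s := compl_mem_ae_iff.2 (measure_singleton (μ := volume) s)
    filter_upwards [ae_deriv_eq_of_hasDerivWithinAt (fun r hr => (Ts r hr).1), hane]
      with r hr hrs hrI
    rw [hr ⟨lt_of_le_of_ne hrI.1 (Ne.symm hrs), hrI.2⟩]
    have hr' := hsub hrI
    have d1 := hC₃ r hr' (ξ r) (hξX r hr') (p r) (hpR r hr') (q r) (hqR r hr')
    have d2 := mul_le_mul_of_nonneg_left (hquad r hr') hC₃0
    linarith
  intro s hs
  have k1 := nonpos_of_le_mul_integral (by positivity) hωc hωint s hs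
  have k2 := P.sub_le_action hh hpos hconv ha T s hs
  simp only [hω] at k1
  linarith

/-- Points of the graph of `y t` over continuity points, on the universal cover. -/
def contGraph (f : ℝ → ℝ) : Set (ℝ × ℝ) := {z | ContinuousAt f z.1 ∧ f z.1 = z.2}

/-- Differentiability holds almost everywhere, hence on a dense set, and continuity at the point
makes the nearby values converge. -/
lemma contGraph_subset_closure {K : ℝ} {f : ℝ → ℝ} (hf : UpperLip K f) :
    contGraph f ⊆ closure {z | DifferentiableAt ℝ f z.1 ∧ f z.1 = z.2} := by
  rintro ⟨x, p⟩ ⟨hc, hp⟩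
  simp only at hc hp
  subst hp
  have hdense : Dense {x | DifferentiableAt ℝ f x} := Measure.dense_of_ae hf.ae_differentiableAt
  obtain ⟨xs, hxs, hlim⟩ := mem_closure_iff_seq_limit.1 (hdense x)
  exact mem_closure_of_tendsto (hlim.prodMk_nhds (hc.tendsto.comp hlim))
    (Eventually.of_forall fun n => ⟨hxs n, rfl⟩)

lemma tendsto_action {hh : Smooth 1 h} {a b s : ℝ} (hs : s ∈ Icc a b) {ξ p : ℝ → ℝ}
    {ξs ps : ℕ → ℝ → ℝ} (T : IsLiftTraj h (Icc a b) ξ p)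
    (Ts : ∀ n, IsLiftTraj h (Icc a b) (ξs n) (ps n))
    (hb : ∀ᶠ n in atTop, ∀ r ∈ Icc a b, dist (ξ r, p r) (ξs n r, ps n r) ≤ 1)
    (hlim : ∀ r ∈ Icc a b, Tendsto (fun n => (ξs n r, ps n r)) atTop (𝓝 (ξ r, p r))) (c : ℝ) :
    Tendsto (fun n => action h c (ξs n) (ps n) s b) atTop (𝓝 (action h c ξ p s b)) := by
  obtain ⟨R, hR⟩ := T.exists_bound
  have hcont : Continuous (fun z : ℝ × ℝ × ℝ => (z.2.2 - c) * dP h z.1 z.2.1 z.2.2 -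
      h z.1 z.2.1 z.2.2) :=
    ((continuous_snd.comp continuous_snd).sub continuous_const).mul hh.continuous_dP |>.sub
      hh.continuous
  obtain ⟨C, -, hC⟩ := exists_bound_on_box (g := fun s x p => (p - c) * dP h s x p - h s x p)
    hcont a b (R + 1) (R + 1)
  have hsub : Icc s b ⊆ Icc a b := Icc_subset_Icc_left hs.1
  refine intervalIntegral.tendsto_integral_filter_of_dominated_convergence (fun _ => C) ?_ ?_
    (by simp) ?_
  · refine Eventually.of_forall fun n => ?_
    rw [uIoc_of_le hs.2]
    exact (((Ts n).continuousOn_action_integrand hh c).mono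
      (Ioc_subset_Icc_self.trans hsub)).aestronglyMeasurable measurableSet_Ioc
  · filter_upwards [hb] with n hn
    refine ae_of_all _ fun r hr => ?_
    rw [uIoc_of_le hs.2] at hr
    have hr' := hsub (Ioc_subset_Icc_self hr)
    have hd := hn r hr'
    rw [Prod.dist_eq, max_le_iff, Real.dist_eq, Real.dist_eq, _root_.abs_le, _root_.abs_le] at hd
    obtain ⟨⟨a1, a2⟩, a3, a4⟩ := hR r hr'
    obtain ⟨⟨b1, b2⟩, b3, b4⟩ := hd
    simp only at a1 a2 a3 a4 b1 b2 b3 b4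
    exact hC r hr' _ (_root_.abs_le.2 ⟨by linarith, by linarith⟩) _
      (_root_.abs_le.2 ⟨by linarith, by linarith⟩)
  · refine ae_of_all _ fun r hr => ?_
    rw [uIoc_of_le hs.2] at hr
    exact (hcont.tendsto (r, ξ r, p r)).comp
      (tendsto_const_nhds.prodMk_nhds (hlim r (hsub (Ioc_subset_Icc_self hr))))

/-- Backward trajectories from the closure of the graph are calibrated. -/
theorem calibrated_of_mem_closure (P : SemiconcavePotential h c t₀ K y u) (hh : Smooth 2 h)
    (hpos : ∀ s x p, 0 < dP (dP h) s x p) (hconv : ∀ s x, ConvexOn ℝ univ (h s x))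
    {a b : ℝ} (ha : t₀ < a) (hab : a ≤ b)
    (hex : ∀ z : ℝ × ℝ, ∃ ξ p : ℝ → ℝ, IsLiftTraj h (Icc a b) ξ p ∧ ξ b = z.1 ∧ p b = z.2)
    {ξ p : ℝ → ℝ} (T : IsLiftTraj h (Icc a b) ξ p)
    (hz : (ξ b, p b) ∈ closure (contGraph (y b))) :
    ∀ s ∈ Icc a b, u b (ξ b) - u s (ξ s) = action h c ξ p s b := by
  have h1 : Smooth 1 h := ContDiff.of_le hh (by norm_num)
  have hb0 := ha.trans_le hab
  have hz' := closure_minimal (contGraph_subset_closure (P.upperLip b hb0)) isClosed_closure hz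
  obtain ⟨zs, hzs, hlim⟩ := mem_closure_iff_seq_limit.1 hz'
  choose ξs ps Ts hξs hps using fun n => hex (zs n)
  have hzb : ∀ n, (ξs n b, ps n b) = zs n := fun n => by rw [hξs, hps]
  obtain ⟨δ, hδ, C, hC0, hC⟩ := hh.exists_stability T
  have hdist : Tendsto (fun n => dist (ξ b, p b) (ξs n b, ps n b)) atTop (𝓝 0) := by
    simp only [hzb]
    have := (tendsto_const_nhds (x := ((ξ b, p b) : ℝ × ℝ))).dist hlim
    rwa [dist_self] at this
  have hsmall : ∀ᶠ n in atTop, dist (ξ b, p b) (ξs n b, ps n b) ≤ δ :=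
    (hdist.eventually (gt_mem_nhds hδ)).mono fun n hn => hn.le
  have hCd : Tendsto (fun n => C * dist (ξ b, p b) (ξs n b, ps n b)) atTop (𝓝 0) := by
    simpa using hdist.const_mul C
  have hptw : ∀ r ∈ Icc a b, Tendsto (fun n => (ξs n r, ps n r)) atTop (𝓝 (ξ r, p r)) := by
    intro r hr
    rw [tendsto_iff_dist_tendsto_zero]
    refine squeeze_zero' (Eventually.of_forall fun n => dist_nonneg) ?_ hCd
    filter_upwards [hsmall] with n hn
    rw [dist_comm]
    exact hC _ _ (Ts n) hn r hr
  have hb1 : ∀ᶠ n in atTop, ∀ r ∈ Icc a b, dist (ξ r, p r) (ξs n r, ps n r) ≤ 1 := by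
    filter_upwards [hsmall, hCd.eventually (gt_mem_nhds one_pos)] with n hn hn1 r hr
    exact (hC _ _ (Ts n) hn r hr).trans hn1.le
  intro s hs
  have l1 := tendsto_action (hh := h1) hs T Ts hb1 hptw c
  have hu : ∀ r ∈ Icc a b, Tendsto (fun n => u r (ξs n r)) atTop (𝓝 (u r (ξ r))) := fun r hr =>
    ((P.cont_slice (ha.le.trans hr.1)).tendsto _).comp
      ((continuous_fst.tendsto _).comp (hptw r hr))
  have l2 := (hu b ⟨hab, le_rfl⟩).sub (hu s hs)
  refine tendsto_nhds_unique l2 (l1.congr fun n => ?_)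
  have hn := hzs n
  refine (P.calibrated_of_differentiableAt hh hpos hconv ha hab (Ts n) ?_ ?_ s hs).symm
  · rw [hξs]; exact hn.1
  · rw [hps, hξs]; exact hn.2.symm

/-- A calibrated trajectory touches the potential from below at its initial point. -/
lemma exists_lower_parabola_of_calibrated (P : SemiconcavePotential h c t₀ K y u) (hh : Smooth 2 h)
    (hpos : ∀ s x p, 0 < dP (dP h) s x p) (hconv : ∀ s x, ConvexOn ℝ univ (h s x))
    {a b : ℝ} (ha : t₀ ≤ a) (hab : a < b) {ξ p : ℝ → ℝ} (T : IsLiftTraj h (Icc a b) ξ p)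
    (hcal : u b (ξ b) - u a (ξ a) = action h c ξ p a b) :
    ∃ δ > 0, ∃ C ≥ 0, ∀ η, |η| ≤ δ →
      u a (ξ a) + (p a - c) * η - C * η ^ 2 ≤ u a (ξ a + η) := by
  have h1 : Smooth 1 h := ContDiff.of_le hh (by norm_num)
  have hba : b - a ≠ 0 := by linarith
  -- The affine weight is `(b - s) / (b - a)`: the end point stays fixed while the initial point
  -- moves by `η`.
  obtain ⟨δ, hδ, C, hC0, hC⟩ :=
    P.exists_variation_le hh hpos hconv T (b / (b - a)) (-1 / (b - a))
  have e1 : b / (b - a) + -1 / (b - a) * b = 0 := by field_simp; ring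
  have e2 : b / (b - a) + -1 / (b - a) * a = 1 := by field_simp; ring
  refine ⟨δ, hδ, C, hC0, fun η hη => ?_⟩
  rw [e1] at hC
  simp only [mul_zero, add_zero, zero_sub] at hC
  have hmem : a ∈ Icc a b := ⟨le_rfl, hab.le⟩
  set ψ : ℝ → ℝ := fun s => b / (b - a) + -1 / (b - a) * s with hψ
  have hψa : ψ a = 1 := e2
  have hψc : Continuous ψ := by fun_prop
  have c1 : ContinuousOn (fun s => u s (ξ s + η * ψ s)) (Icc a b) :=
    P.continuousOn_along ha (T.continuousOn_fst.add (by fun_prop))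
  have c2 : ContinuousOn (fun s => action h c ξ p s b + η * -((p s - c) * ψ s) + C * η ^ 2)
      (Icc a b) :=
    ((continuousOn_action_left T h1 c hab.le).add (continuousOn_const.mul
      ((T.continuousOn_snd.sub continuousOn_const).mul hψc.continuousOn).neg)).add
      continuousOn_const
  -- The variation inequality is available only at times after `t₀`, whereas `a = t₀` is allowed
  -- here. Continuity gives the case `s ↓ a`.
  have hle : u b (ξ b) - u a (ξ a + η * ψ a) ≤
      action h c ξ p a b + η * -((p a - c) * ψ a) + C * η ^ 2 := by
    have hne : (𝓝[Ioc a b] a).NeBot := left_nhdsWithin_Ioc_neBot hab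
    refine le_of_tendsto_of_tendsto (b := 𝓝[Ioc a b] a)
      ((continuousOn_const.sub c1 a hmem).mono_left (nhdsWithin_mono a Ioc_subset_Icc_self))
      ((c2 a hmem).mono_left (nhdsWithin_mono a Ioc_subset_Icc_self)) ?_
    filter_upwards [self_mem_nhdsWithin] with s hs
    exact hC s (Ioc_subset_Icc_self hs) (ha.trans_lt hs.1) η hη
  rw [hψa, mul_one, mul_one] at hle
  linarith

end SemiconcavePotential

/-- A function with a downward jump at most, whose integrals are bounded below by a parabola, is
continuous. -/
lemma continuousAt_of_lower_parabola {f : ℝ → ℝ} {x p δ C q₁ q₂ : ℝ} (hδ : 0 < δ)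
    (h₁ : Tendsto f (𝓝[>] x) (𝓝 q₁)) (h₂ : Tendsto f (𝓝[<] x) (𝓝 q₂)) (h₁' : q₁ ≤ f x)
    (h₂' : f x ≤ q₂) (hint : ∀ a b, IntervalIntegrable f volume a b)
    (hle : ∀ η, |η| ≤ δ → p * η - C * η ^ 2 ≤ ∫ r in x..(x + η), f r) :
    ContinuousAt f x ∧ f x = p := by
  -- A right limit below `p` would make the integral over a short interval to the right smaller than
  -- the parabola. The left side is symmetric, and together they squeeze `p ≤ q₁ ≤ f x ≤ q₂ ≤ p`.
  have hp1 : p ≤ q₁ := by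
    by_contra hcon
    push Not at hcon
    set ε := (p - q₁) / 2 with hε
    have hε0 : 0 < ε := by rw [hε]; linarith
    have h3 := h₁.eventually (gt_mem_nhds (show q₁ < q₁ + ε by linarith))
    obtain ⟨z, hz, hzs⟩ := mem_nhdsGT_iff_exists_Ioo_subset.1 h3
    have hz' : x < z := hz
    set η := min δ (min (z - x) (ε / (2 * (|C| + 1)))) with hη
    have hη0 : 0 < η := lt_min hδ (lt_min (by linarith) (by positivity))
    have hηz : η ≤ z - x := (min_le_right _ _).trans (min_le_left _ _)
    have hηC : η * (2 * (|C| + 1)) ≤ ε := by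
      have : η ≤ ε / (2 * (|C| + 1)) := (min_le_right _ _).trans (min_le_right _ _)
      rwa [le_div_iff₀ (by positivity)] at this
    have h4 := hle η (by rw [abs_of_pos hη0]; exact min_le_left _ _)
    have h5 := intervalIntegral.integral_mono_on_of_le_Ioo (show x ≤ x + η by linarith)
      (hint _ _) (intervalIntegrable_const (c := q₁ + ε)) fun r hr =>
        (le_of_lt (hzs ⟨hr.1, by linarith [hr.2]⟩) : f r ≤ q₁ + ε)
    simp only [intervalIntegral.integral_const, add_sub_cancel_left, smul_eq_mul] at h5
    have h6 : p - C * η ≤ q₁ + ε := by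
      refine le_of_mul_le_mul_right ?_ hη0
      linarith
    have h7 : C * η ≤ |C| * η := mul_le_mul_of_nonneg_right (le_abs_self C) hη0.le
    nlinarith
  have hp2 : q₂ ≤ p := by
    by_contra hcon
    push Not at hcon
    set ε := (q₂ - p) / 2 with hε
    have hε0 : 0 < ε := by rw [hε]; linarith
    have h3 := h₂.eventually (lt_mem_nhds (show q₂ - ε < q₂ by linarith))
    obtain ⟨z, hz, hzs⟩ := mem_nhdsLT_iff_exists_Ioo_subset.1 h3
    have hz' : z < x := hz
    set η := min δ (min (x - z) (ε / (2 * (|C| + 1)))) with hη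
    have hη0 : 0 < η := lt_min hδ (lt_min (by linarith) (by positivity))
    have hηz : η ≤ x - z := (min_le_right _ _).trans (min_le_left _ _)
    have hηC : η * (2 * (|C| + 1)) ≤ ε := by
      have : η ≤ ε / (2 * (|C| + 1)) := (min_le_right _ _).trans (min_le_right _ _)
      rwa [le_div_iff₀ (by positivity)] at this
    have h4 := hle (-η) (by rw [abs_neg, abs_of_pos hη0]; exact min_le_left _ _)
    have h5 := intervalIntegral.integral_mono_on_of_le_Ioo (show x - η ≤ x by linarith)
      (intervalIntegrable_const (c := q₂ - ε)) (hint _ _) fun r hr =>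
        (le_of_lt (hzs ⟨by linarith [hr.1], hr.2⟩) : q₂ - ε ≤ f r)
    rw [← sub_eq_add_neg, intervalIntegral.integral_symm] at h4
    simp only [intervalIntegral.integral_const, sub_sub_cancel, smul_eq_mul] at h5
    have h6 : q₂ - ε ≤ p + C * η := by
      refine le_of_mul_le_mul_right ?_ hη0
      linarith
    have h7 : C * η ≤ |C| * η := mul_le_mul_of_nonneg_right (le_abs_self C) hη0.le
    nlinarith
  have e1 : q₁ = p := by linarith
  have e2 : q₂ = p := by linarith
  have e3 : f x = p := by linarith
  subst e1
  rw [e2] at h₂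
  refine ⟨continuousAt_iff_continuous_left'_right'.2 ⟨?_, ?_⟩, e3⟩
  · rw [ContinuousWithinAt, e3]; exact h₂
  · rw [ContinuousWithinAt, e3]; exact h₁

namespace SemiconcavePotential

variable {h : ℝ → ℝ → ℝ → ℝ} {c t₀ : ℝ} {K : ℝ → ℝ} {y u : ℝ → ℝ → ℝ}

/-- One-sided limits and their ordering are hypotheses rather than consequences of the Oleinik
bound, so that the statement also covers the initial time. -/
lemma continuousAt_of_calibrated_of_tendsto (P : SemiconcavePotential h c t₀ K y u)
    (hh : Smooth 2 h) (hpos : ∀ s x p, 0 < dP (dP h) s x p)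
    (hconv : ∀ s x, ConvexOn ℝ univ (h s x))
    {a b : ℝ} (ha : t₀ ≤ a) (hab : a < b) {ξ p : ℝ → ℝ} (T : IsLiftTraj h (Icc a b) ξ p)
    (hcal : u b (ξ b) - u a (ξ a) = action h c ξ p a b) {q₁ q₂ : ℝ}
    (h₁ : Tendsto (y a) (𝓝[>] ξ a) (𝓝 q₁)) (h₂ : Tendsto (y a) (𝓝[<] ξ a) (𝓝 q₂))
    (h₁' : q₁ ≤ y a (ξ a)) (h₂' : y a (ξ a) ≤ q₂)
    (hint : ∀ x x', IntervalIntegrable (y a) volume x x') :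
    ContinuousAt (y a) (ξ a) ∧ y a (ξ a) = p a := by
  obtain ⟨δ, hδ, C, hC0, hC⟩ := P.exists_lower_parabola_of_calibrated hh hpos hconv ha hab T hcal
  refine continuousAt_of_lower_parabola (C := C) hδ h₁ h₂ h₁' h₂' hint fun η hη => ?_
  have e1 := hC η hη
  have e2 := P.pot a ha (ξ a) (ξ a + η)
  rw [intervalIntegral.integral_sub (hint _ _) intervalIntegrable_const] at e2
  simp only [intervalIntegral.integral_const, add_sub_cancel_left, smul_eq_mul] at e2
  linarith

/-- Along a calibrated trajectory `y` is continuous before the final time. -/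
theorem continuousAt_of_calibrated (P : SemiconcavePotential h c t₀ K y u) (hh : Smooth 2 h)
    (hpos : ∀ s x p, 0 < dP (dP h) s x p) (hconv : ∀ s x, ConvexOn ℝ univ (h s x))
    {a b : ℝ} (ha : t₀ < a) (hab : a < b) {ξ p : ℝ → ℝ} (T : IsLiftTraj h (Icc a b) ξ p)
    (hcal : u b (ξ b) - u a (ξ a) = action h c ξ p a b) :
    ContinuousAt (y a) (ξ a) ∧ y a (ξ a) = p a := by
  obtain ⟨q₁, h₁, h₁'⟩ := (P.upperLip a ha).exists_tendsto_right (ξ a)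
  obtain ⟨q₂, h₂, h₂'⟩ := (P.upperLip a ha).exists_tendsto_left (ξ a)
  exact P.continuousAt_of_calibrated_of_tendsto hh hpos hconv ha.le hab T hcal h₁ h₂ h₁' h₂'
    (P.intervalIntegrable ha)

end SemiconcavePotential
end Burgers

namespace Burgers

/-! ### The Legendre transform of a strictly convex superlinear function -/

section Legendre

variable {f f' : ℝ → ℝ}

lemma tangent_le_of_strictMono (hf : ∀ p, HasDerivAt f (f' p) p) (hmono : StrictMono f') (p q : ℝ) :
    f p + f' p * (q - p) ≤ f q := by
  rcases lt_trichotomy p q with h | rfl | h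
  · obtain ⟨z, hz, he⟩ := exists_hasDerivAt_eq_slope f f' h
      (fun x _ => (hf x).continuousAt.continuousWithinAt) fun x _ => hf x
    rw [eq_div_iff (by linarith)] at he
    have := hmono hz.1
    nlinarith
  · simp
  · obtain ⟨z, hz, he⟩ := exists_hasDerivAt_eq_slope f f' h
      (fun x _ => (hf x).continuousAt.continuousWithinAt) fun x _ => hf x
    rw [eq_div_iff (by linarith)] at he
    have := hmono hz.2
    nlinarith

/-- Superlinearity makes `f p - v p` coercive, and the derivative equals `v` at a minimum. -/
lemma surjective_deriv_of_superlinear (hf : ∀ p, HasDerivAt f (f' p) p)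
    (hsup : Tendsto (fun p : ℝ => f p / |p|) (cocompact ℝ) atTop) : Function.Surjective f' := by
  intro v
  have hc : Continuous (fun p => f p - v * p) :=
    (continuous_iff_continuousAt.2 fun p => (hf p).continuousAt).sub (by fun_prop)
  have ht : Tendsto (fun p => f p - v * p) (cocompact ℝ) atTop := by
    have h1 : Tendsto (fun p : ℝ => |p|) (cocompact ℝ) atTop := tendsto_norm_cocompact_atTop
    refine tendsto_atTop_mono' _ ?_ h1
    filter_upwards [hsup.eventually_ge_atTop (|v| + 1), h1.eventually_gt_atTop 0] with p hp hp0
    rw [le_div_iff₀ hp0] at hp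
    have : v * p ≤ |v| * |p| := by rw [← abs_mul]; exact le_abs_self _
    linarith
  obtain ⟨p, hp⟩ := hc.exists_forall_le ht
  have hd : HasDerivAt (fun p => f p - v * p) (f' p - v * 1) p :=
    (hf p).sub ((hasDerivAt_id p).const_mul v)
  have hmin : IsLocalMin (fun p => f p - v * p) p := Eventually.of_forall hp
  have := hmin.hasDerivAt_eq_zero hd
  exact ⟨p, by linarith⟩

lemma isGreatest_legendre (hf : ∀ p, HasDerivAt f (f' p) p) (hmono : StrictMono f') (p : ℝ) :
    IsGreatest (range fun q => q * f' p - f q) (p * f' p - f p) := by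
  refine ⟨⟨p, rfl⟩, ?_⟩
  rintro _ ⟨q, rfl⟩
  have := tangent_le_of_strictMono hf hmono p q
  simp only
  linarith

lemma legendre_deriv_eq (hf : ∀ p, HasDerivAt f (f' p) p) (hmono : StrictMono f') (p : ℝ) :
    ⨆ q, (q * f' p - f q) = p * f' p - f p :=
  (isGreatest_legendre hf hmono p).csSup_eq

lemma le_legendre (hf : ∀ p, HasDerivAt f (f' p) p) (hmono : StrictMono f')
    (hsurj : Function.Surjective f') (q v : ℝ) : q * v - f q ≤ ⨆ q, (q * v - f q) := by
  obtain ⟨p, rfl⟩ := hsurj v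
  rw [legendre_deriv_eq hf hmono]
  exact (isGreatest_legendre hf hmono p).2 ⟨q, rfl⟩

lemma eq_deriv_of_legendre_eq (hf : ∀ p, HasDerivAt f (f' p) p) (hmono : StrictMono f')
    (hsurj : Function.Surjective f') {q v : ℝ} (he : q * v - f q = ⨆ q, (q * v - f q)) :
    v = f' q := by
  have hd : HasDerivAt (fun q => q * v - f q) (1 * v - f' q) q :=
    ((hasDerivAt_id q).mul_const v).sub (hf q)
  have hmax : IsLocalMax (fun q => q * v - f q) q :=
    Eventually.of_forall fun x => by
      simp only [he]
      exact le_legendre hf hmono hsurj x v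
  have := hmax.hasDerivAt_eq_zero hd
  linarith

/-- The tangent inequalities at the two momenta place the first order error between `0` and the
product of the momentum increment and the velocity increment. The former tends to zero because the
inverse of `f'` is continuous. -/
lemma hasDerivAt_legendre (hf : ∀ p, HasDerivAt f (f' p) p) (hmono : StrictMono f')
    (hsurj : Function.Surjective f') (p : ℝ) :
    HasDerivAt (fun v => ⨆ q, (q * v - f q)) p (f' p) := by
  set e := hmono.orderIsoOfSurjective f' hsurj with he
  have hef : ∀ w, f' (e.symm w) = w := fun w => e.apply_symm_apply w
  have hep : e.symm (f' p) = p := e.symm_apply_apply p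
  have hcont : Tendsto (fun w => e.symm w - p) (𝓝 (f' p)) (𝓝 0) := by
    have := (e.symm.continuous.tendsto (f' p)).sub_const p
    rwa [hep, sub_self] at this
  have key : ∀ w, |(⨆ q, (q * w - f q)) - (⨆ q, (q * f' p - f q)) - (w - f' p) * p| ≤
      |e.symm w - p| * |w - f' p| := by
    intro w
    have e1 := legendre_deriv_eq hf hmono p
    have e2 := legendre_deriv_eq hf hmono (e.symm w)
    rw [hef] at e2
    rw [e1, e2]
    have t1 := tangent_le_of_strictMono hf hmono p (e.symm w)
    have t2 := tangent_le_of_strictMono hf hmono (e.symm w) p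
    rw [hef] at t2
    rw [abs_of_nonneg (by linarith), ← abs_mul]
    refine le_trans ?_ (le_abs_self _)
    linarith
  rw [hasDerivAt_iff_isLittleO, Asymptotics.isLittleO_iff]
  intro ε hε
  filter_upwards [hcont.abs.eventually (ge_mem_nhds (show |(0 : ℝ)| < ε by simpa using hε))]
    with w hw
  simp only [smul_eq_mul, Real.norm_eq_abs]
  exact (key w).trans (mul_le_mul_of_nonneg_right hw (abs_nonneg _))

end Legendre

/-! ### Calibrated curves are trajectories -/

/-- Extending `v` by its end values gives a continuous integrand on the line, so that the end points
need no separate treatment. -/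
lemma hasDerivWithinAt_of_eq_integral {F v : ℝ → ℝ} {a b : ℝ} (hv : ContinuousOn v (Icc a b))
    (hF : ∀ s ∈ Icc a b, F s = F a + ∫ r in a..s, v r) :
    ∀ s ∈ Icc a b, HasDerivWithinAt F (v s) (Icc a b) s := by
  intro s hs
  have hab : a ≤ b := hs.1.trans hs.2
  set V := IccExtend hab ((Icc a b).domRestrict v) with hV
  have hVc : Continuous V := (continuousOn_iff_continuous_domRestrict.1 hv).Icc_extend'
  have hVv : ∀ r ∈ Icc a b, V r = v r := fun r hr => IccExtend_of_mem hab _ hr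
  have hd : HasDerivAt (fun s => F a + ∫ r in a..s, V r) (V s) s :=
    (intervalIntegral.integral_hasDerivAt_right (hVc.intervalIntegrable _ _)
      (hVc.stronglyMeasurableAtFilter _ _) hVc.continuousAt).const_add _
  rw [← hVv s hs]
  have hcongr : ∀ s ∈ Icc a b, F s = F a + ∫ r in a..s, V r := fun s hs => by
    rw [hF s hs]
    congr 1
    refine intervalIntegral.integral_congr fun r hr => ?_
    rw [uIcc_of_le hs.1] at hr
    exact (hVv r ⟨hr.1, hr.2.trans hs.2⟩).symm
  exact hd.hasDerivWithinAt.congr hcongr (hcongr s hs)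

namespace SemiconcavePotential

variable {h : ℝ → ℝ → ℝ → ℝ} {c t₀ : ℝ} {K : ℝ → ℝ} {y u : ℝ → ℝ → ℝ}

lemma hasDerivAt_u (P : SemiconcavePotential h c t₀ K y u) {t x : ℝ} (ht : t₀ < t)
    (hx : ContinuousAt (y t) x) : HasDerivAt (u t) (y t x - c) x := by
  have h1 : HasDerivAt (fun z => u t x + ∫ r in x..z, (y t r - c)) (y t x - c) x := by
    refine (intervalIntegral.integral_hasDerivAt_right (by simp) ?_
      (hx.sub continuousAt_const)).const_add _
    exact ((P.upperLip t ht).measurable.sub_const c).stronglyMeasurable.stronglyMeasurableAtFilter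
  refine h1.congr_of_eventuallyEq (Eventually.of_forall fun z => ?_)
  have := P.pot t ht.le x z
  linarith

/-- The side value is a pointwise limit of segment averages, which are continuous in time along the
curve. -/
lemma aestronglyMeasurable_side_value (P : SemiconcavePotential h c t₀ K y u) {l : Filter ℝ}
    [l.NeBot] [l.IsCountablyGenerated] (hl : IsSideFilter l) {a b : ℝ} (ha : t₀ < a)
    {ξ q : ℝ → ℝ} (hξ : ContinuousOn ξ (Icc a b))
    (hq : ∀ s ∈ Icc a b, Tendsto (fun r => y s (ξ s + r)) l (𝓝 (q s))) :
    AEStronglyMeasurable q (volume.restrict (Icc a b)) := by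
  obtain ⟨e, he⟩ := l.exists_seq_tendsto
  obtain ⟨N, hN⟩ := eventually_atTop.1 (he.eventually hl.ne_zero)
  refine aestronglyMeasurable_of_tendsto_ae atTop
    (f := fun n s => segAvg y (e (n + N)) s (ξ s)) (fun n => ?_) ?_
  · have c2 : ContinuousOn (fun s => segAvg y (e (n + N)) s (ξ s)) (Icc a b) := fun s hs =>
      ((P.continuousAt_segAvg_y (hN _ (by omega)) (ha.trans_le hs.1)
        (ξ s)).comp_continuousWithinAt (f := fun s => (s, ξ s))
        (continuousWithinAt_id.prodMk (hξ s hs)))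
    exact c2.aestronglyMeasurable measurableSet_Icc
  · rw [ae_restrict_iff' measurableSet_Icc]
    refine ae_of_all _ fun s hs => ?_
    exact (P.tendsto_average (Ψ := fun _ _ p => p) (by fun_prop) hl (ha.trans_le hs.1)
      (hq s hs)).comp (he.comp (tendsto_add_atTop_nat N))

/-- Along a calibrated curve the side values of `y` realize the Legendre transform. -/
lemma ae_eq_of_calibrated (P : SemiconcavePotential h c t₀ K y u) {l : Filter ℝ} [l.NeBot]
    [l.IsCountablyGenerated] (hl : IsSideFilter l) {a b : ℝ} (ha : t₀ < a) (hab : a ≤ b)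
    {ξ q g : ℝ → ℝ} (hξ : AbsolutelyContinuousOnInterval ξ a b)
    (hq : ∀ s ∈ Icc a b, Tendsto (fun r => y s (ξ s + r)) l (𝓝 (q s)))
    (hg : IntervalIntegrable g volume a b)
    (hle : ∀ᵐ s, s ∈ Ioc a b → ∀ q, (q - c) * deriv ξ s - h s (ξ s) q ≤ g s)
    (hcal : u b (ξ b) - u a (ξ a) = ∫ s in a..b, g s) :
    ∀ᵐ s, s ∈ Ioc a b → (q s - c) * deriv ξ s - h s (ξ s) (q s) = g s := by
  obtain ⟨i1, i2⟩ := P.chain_rule hl ha hab hξ hq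
  have h0 : ∫ s in a..b, (g s - ((q s - c) * deriv ξ s - h s (ξ s) (q s))) = 0 := by
    rw [intervalIntegral.integral_sub hg i1, ← i2, ← hcal, sub_self]
  have hnn : 0 ≤ᵐ[volume.restrict (Ioc a b)]
      fun s => g s - ((q s - c) * deriv ξ s - h s (ξ s) (q s)) := by
    rw [Filter.EventuallyLE, ae_restrict_iff' measurableSet_Ioc]
    filter_upwards [hle] with s hs hsab
    simpa using hs hsab (q s)
  rw [intervalIntegral.integral_of_le hab,
    integral_eq_zero_iff_of_nonneg_ae hnn ((intervalIntegrable_iff_integrableOn_Ioc_of_le hab).1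
      (hg.sub i1))] at h0
  rw [Filter.EventuallyEq, ae_restrict_iff' measurableSet_Ioc] at h0
  filter_upwards [h0] with s hs hsab
  have := hs hsab
  simp only [Pi.zero_apply] at this
  linarith

/-- Calibrated absolutely continuous curves are projections of trajectories. -/
theorem exists_trajectory_of_calibrated (P : SemiconcavePotential h c t₀ K y u) (hh : Smooth 2 h)
    (hpos : ∀ s x p, 0 < dP (dP h) s x p) (hconv : ∀ s x, ConvexOn ℝ univ (h s x))
    (hsurj : ∀ s x, Function.Surjective (dP h s x))
    {a b : ℝ} (ha : t₀ < a) (hab : a < b) {ξ : ℝ → ℝ} (hξ : AbsolutelyContinuousOnInterval ξ a b)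
    (hg : IntervalIntegrable
      (fun s => (⨆ q, (q * deriv ξ s - h s (ξ s) q)) - c * deriv ξ s) volume a b)
    (hcal : u b (ξ b) - u a (ξ a) =
      ∫ s in a..b, ((⨆ q, (q * deriv ξ s - h s (ξ s) q)) - c * deriv ξ s)) :
    ∃ p : ℝ → ℝ, IsLiftTraj h (Icc a b) ξ p ∧
      u b (ξ b) - u a (ξ a) = action h c ξ p a b := by
  have h1 : Smooth 1 h := ContDiff.of_le hh (by norm_num)
  have hmono : ∀ s x, StrictMono (dP h s x) := fun s x =>
    strictMono_of_deriv_pos fun p => hpos s x p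
  have hder : ∀ s x p, HasDerivAt (h s x) (dP h s x p) p := h1.hasDerivAt_dP
  have hξc := hξ.continuousOn
  rw [uIcc_of_le hab.le] at hξc
  set g : ℝ → ℝ := fun s => (⨆ q, (q * deriv ξ s - h s (ξ s) q)) - c * deriv ξ s with hgdef
  have hle : ∀ᵐ s : ℝ, s ∈ Ioc a b → ∀ q, (q - c) * deriv ξ s - h s (ξ s) q ≤ g s :=
    ae_of_all _ fun s _ q => by
      have := le_legendre (hder s (ξ s)) (hmono s (ξ s)) (hsurj s (ξ s)) q (deriv ξ s)
      simp only [hgdef]; linarith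
  obtain ⟨q, hq⟩ := P.exists_right_value ξ
  obtain ⟨q', hq'⟩ := P.exists_left_value ξ
  have hqt : ∀ s ∈ Icc a b, Tendsto (fun r => y s (ξ s + r)) (𝓝[>] 0) (𝓝 (q s)) := fun s hs =>
    (hq s (ha.trans_le hs.1)).comp (tendsto_add_left_nhdsGT _)
  have hqt' : ∀ s ∈ Icc a b, Tendsto (fun r => y s (ξ s + r)) (𝓝[<] 0) (𝓝 (q' s)) := fun s hs =>
    (hq' s (ha.trans_le hs.1)).comp (tendsto_add_left_nhdsLT _)
  set Good : ℝ → Prop := fun s => deriv ξ s = dP h s (ξ s) (q s) ∧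
    g s = (q s - c) * deriv ξ s - h s (ξ s) (q s) ∧
    ContinuousAt (y s) (ξ s) ∧ y s (ξ s) = q s with hGood
  -- Almost everywhere both side limits give equality in Fenchel for the same velocity. Strict
  -- convexity makes them equal, and then `y s` is continuous at `ξ s`.
  have hgood : ∀ᵐ s, s ∈ Ioc a b → Good s := by
    filter_upwards [P.ae_eq_of_calibrated isSideFilter_right ha hab.le hξ hqt hg hle hcal,
      P.ae_eq_of_calibrated isSideFilter_left ha hab.le hξ hqt' hg hle hcal] with s e1 e2 hs
    have hs0 := ha.trans hs.1
    have d1 : deriv ξ s = dP h s (ξ s) (q s) :=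
      eq_deriv_of_legendre_eq (hder s (ξ s)) (hmono s (ξ s)) (hsurj s (ξ s)) (by
        have := e1 hs
        simp only [hgdef] at this; linarith)
    have d2 : deriv ξ s = dP h s (ξ s) (q' s) :=
      eq_deriv_of_legendre_eq (hder s (ξ s)) (hmono s (ξ s)) (hsurj s (ξ s)) (by
        have := e2 hs
        simp only [hgdef] at this; linarith)
    have hqq : q s = q' s := (hmono s (ξ s)).injective (d1.symm.trans d2)
    obtain ⟨r1, hr1, hr1'⟩ := (P.upperLip s hs0).exists_tendsto_right (ξ s)
    obtain ⟨r2, hr2, hr2'⟩ := (P.upperLip s hs0).exists_tendsto_left (ξ s)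
    have e3 := tendsto_nhds_unique hr1 (hq s hs0)
    have e4 := tendsto_nhds_unique hr2 (hq' s hs0)
    have e5 : y s (ξ s) = q s := by linarith
    refine ⟨d1, (e1 hs).symm, continuousAt_iff_continuous_left'_right'.2 ⟨?_, ?_⟩, e5⟩
    · rw [ContinuousWithinAt, e5, hqq]; exact hq' s hs0
    · rw [ContinuousWithinAt, e5]; exact hq s hs0
  obtain ⟨X, hX⟩ := isCompact_Icc.exists_bound_of_continuousOn hξc
  set R := K a + |c| with hR
  have hqR : ∀ s ∈ Icc a b, |q s| ≤ R := fun s hs =>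
    P.abs_le_of_tendsto ha hs.1 (hq s (ha.trans_le hs.1))
  have hqm := P.aestronglyMeasurable_side_value isSideFilter_right ha hξc hqt
  have hcompint : ∀ {G : ℝ → ℝ → ℝ → ℝ},
      Continuous (fun z : ℝ × ℝ × ℝ => G z.1 z.2.1 z.2.2) →
      IntegrableOn (fun s => G s (ξ s) (q s)) (Icc a b) := by
    intro G hG
    obtain ⟨C, -, hC⟩ := exists_bound_on_box hG a b X R
    refine Integrable.of_bound ?_ C ?_
    · exact hG.comp_aestronglyMeasurable (aestronglyMeasurable_id.prodMk
        ((hξc.aestronglyMeasurable measurableSet_Icc).prodMk hqm))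
    · rw [ae_restrict_iff' measurableSet_Icc]
      exact ae_of_all _ fun s hs => hC s hs _ (hX s hs) _ (hqR s hs)
  have hsubint : ∀ {G : ℝ → ℝ}, IntegrableOn G (Icc a b) → ∀ s ∈ Icc a b, ∀ s' ∈ Icc a b,
      IntervalIntegrable G volume s s' := fun hG s hs s' hs' =>
    (hG.mono_set (uIcc_subset_Icc hs hs')).intervalIntegrable
  have hDX := hcompint h1.continuous_dX
  obtain ⟨δ₀, hδ₀, C, hC0, hC⟩ := hh.exists_fenchel_variation hpos hconv a b X R
  -- The integrated Euler-Lagrange equation. Translating the curve by `η` gives a competitor, so a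
  -- function of `η` has a local maximum at `0`. At good times `u` is differentiable at the end
  -- points, so its derivative exists and vanishes.
  have hEL : ∀ s₁ s₂, s₁ ∈ Ioc a b → s₂ ∈ Ioc a b → s₁ ≤ s₂ → Good s₁ → Good s₂ →
      q s₂ - q s₁ = -∫ r in s₁..s₂, dX h r (ξ r) (q r) := by
    intro s₁ s₂ m1 m2 hle12 g1 g2
    have hs1 := ha.trans m1.1
    have hs2 := ha.trans m2.1
    have m1' := Ioc_subset_Icc_self m1
    have m2' := Ioc_subset_Icc_self m2
    have hsub : Icc s₁ s₂ ⊆ Icc a b := Icc_subset_Icc m1.1.le m2.2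
    have hac : AbsolutelyContinuousOnInterval ξ s₁ s₂ := hξ.mono (by
      rw [uIcc_of_le hle12, uIcc_of_le hab.le]; exact hsub)
    have j1 : IntervalIntegrable g volume s₁ s₂ := hg.mono_set (by
      rw [uIcc_of_le hle12, uIcc_of_le hab.le]; exact hsub)
    have j2 := hsubint hDX s₁ m1' s₂ m2'
    obtain ⟨-, i2⟩ := P.chain_rule isSideFilter_right hs1 hle12 hac
      (q := q) fun s hs => hqt s (hsub hs)
    have i3 : u s₂ (ξ s₂) - u s₁ (ξ s₁) = ∫ s in s₁..s₂, g s := by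
      rw [i2]
      refine intervalIntegral.integral_congr_ae ?_
      filter_upwards [hgood] with s hs hs'
      rw [uIoc_of_le hle12] at hs'
      exact (hs ⟨m1.1.trans hs'.1, hs'.2.trans m2.2⟩).2.1.symm
    set I := ∫ r in s₁..s₂, dX h r (ξ r) (q r) with hI
    have hvar : ∀ η, |η| ≤ δ₀ → u s₂ (ξ s₂ + η) - u s₁ (ξ s₁ + η) + η * I
        - C * (s₂ - s₁) * η ^ 2 ≤ u s₂ (ξ s₂) - u s₁ (ξ s₁) := by
      intro η hη
      have hac' : AbsolutelyContinuousOnInterval (fun s => ξ s + η) s₁ s₂ := by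
        unfold AbsolutelyContinuousOnInterval at hac ⊢
        simpa using hac
      have := P.sub_le_integral hs1 hle12 hac' (v := deriv ξ)
        (ae_of_all _ fun s _ => by simp) (g := fun s => g s - η * dX h s (ξ s) (q s) + C * η ^ 2)
        ((j1.sub (j2.const_mul η)).add intervalIntegrable_const) (by
          filter_upwards [hgood] with s hs hs' z
          have hsab : s ∈ Ioc a b := ⟨m1.1.trans hs'.1, hs'.2.trans m2.2⟩
          obtain ⟨d1, d2, -, -⟩ := hs hsab
          have hsI := Ioc_subset_Icc_self hsab
          have := hC s hsI (ξ s) (hX s hsI) (q s) (hqR s hsI) η hη 0 (by simpa using hδ₀.le) z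
          rw [add_zero, ← d1] at this
          rw [d2]
          linarith)
      rw [intervalIntegral.integral_add (j1.sub (j2.const_mul η)) intervalIntegrable_const,
        intervalIntegral.integral_sub j1 (j2.const_mul η), intervalIntegral.integral_const_mul,
        intervalIntegral.integral_const, smul_eq_mul, ← i3] at this
      linarith
    have hd0 : HasDerivAt (fun η : ℝ => u s₂ (ξ s₂ + η) - u s₁ (ξ s₁ + η) + η * I
        - C * (s₂ - s₁) * η ^ 2) ((y s₂ (ξ s₂) - c) - (y s₁ (ξ s₁) - c) + 1 * I
          - C * (s₂ - s₁) * (2 * 0 ^ (2 - 1) * 1)) 0 := by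
      have k1 : HasDerivAt (fun η : ℝ => u s₂ (ξ s₂ + η)) (y s₂ (ξ s₂) - c) 0 :=
        HasDerivAt.comp_const_add (ξ s₂) 0 (by simpa using P.hasDerivAt_u hs2 g2.2.2.1)
      have k2 : HasDerivAt (fun η : ℝ => u s₁ (ξ s₁ + η)) (y s₁ (ξ s₁) - c) 0 :=
        HasDerivAt.comp_const_add (ξ s₁) 0 (by simpa using P.hasDerivAt_u hs1 g1.2.2.1)
      exact ((k1.sub k2).add ((hasDerivAt_id 0).mul_const I)).sub
        (((hasDerivAt_id (0 : ℝ)).pow 2).const_mul _)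
    have hmax : IsLocalMax (fun η : ℝ => u s₂ (ξ s₂ + η) - u s₁ (ξ s₁ + η) + η * I
        - C * (s₂ - s₁) * η ^ 2) 0 := by
      filter_upwards [Metric.ball_mem_nhds (0 : ℝ) hδ₀] with η hη
      have : |η| < δ₀ := by simpa using hη
      simpa using hvar η this.le
    have := hmax.hasDerivAt_eq_zero hd0
    rw [g1.2.2.2, g2.2.2.2] at this
    simp at this
    linarith
  -- Good times have full measure in an interval of positive length, so one of them can anchor the
  -- momentum.
  obtain ⟨s₀, hs₀, hs₀g⟩ : ∃ s ∈ Ioc a b, Good s := by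
    by_contra hcon
    push Not at hcon
    have : volume (Ioc a b) = 0 := measure_mono_null (t := {s | ¬ (s ∈ Ioc a b → Good s)})
      (fun s hs hn => hcon s hs (hn hs)) hgood
    simp at this
    linarith
  have hs₀' := Ioc_subset_Icc_self hs₀
  have haI : a ∈ Icc a b := ⟨le_rfl, hab.le⟩
  -- The continuous representative of `q`. It agrees with `q` almost everywhere, so replacing `q` by
  -- `p` in integrals makes both Hamilton equations hold at every time.
  set p : ℝ → ℝ := fun s => q s₀ + (∫ r in a..s₀, dX h r (ξ r) (q r)) -
    ∫ r in a..s, dX h r (ξ r) (q r) with hp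
  have hpq : ∀ᵐ s, s ∈ Ioc a b → p s = q s := by
    filter_upwards [hgood] with s hs hsab
    have hs' := Ioc_subset_Icc_self hsab
    have e := intervalIntegral.integral_interval_sub_left (hsubint hDX a haI s hs')
      (hsubint hDX a haI s₀ hs₀')
    rcases le_total s₀ s with hle | hle
    · have := hEL s₀ s hs₀ hsab hle hs₀g (hs hsab)
      simp only [hp]
      linarith
    · have := hEL s s₀ hsab hs₀ hle (hs hsab) hs₀g
      rw [intervalIntegral.integral_symm] at this
      simp only [hp]
      linarith
  have hpc : ContinuousOn p (Icc a b) := by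
    have := intervalIntegral.continuousOn_primitive_interval (μ := volume) (a := a) (b := b)
      (f := fun r => dX h r (ξ r) (q r)) (by rw [uIcc_of_le hab.le]; exact hDX)
    rw [uIcc_of_le hab.le] at this
    exact continuousOn_const.sub this
  have hcomp : ∀ {G : ℝ → ℝ → ℝ → ℝ}, Continuous (fun z : ℝ × ℝ × ℝ => G z.1 z.2.1 z.2.2) →
      ContinuousOn (fun s => G s (ξ s) (p s)) (Icc a b) := fun hG =>
    hG.comp_continuousOn (continuousOn_id.prodMk (hξc.prodMk hpc))
  refine ⟨p, fun s hs => ⟨?_, ?_⟩, ?_⟩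
  · refine hasDerivWithinAt_of_eq_integral (hcomp h1.continuous_dP) (fun s hs => ?_) s hs
    have hac : AbsolutelyContinuousOnInterval ξ a s := hξ.mono (by
      rw [uIcc_of_le hs.1, uIcc_of_le hab.le]; exact Icc_subset_Icc_right hs.2)
    have e := hac.integral_deriv_eq_sub
    have e2 : ∫ r in a..s, deriv ξ r = ∫ r in a..s, dP h r (ξ r) (p r) := by
      refine intervalIntegral.integral_congr_ae ?_
      filter_upwards [hgood, hpq] with r hr hr' hrs
      rw [uIoc_of_le hs.1] at hrs
      have hrab : r ∈ Ioc a b := ⟨hrs.1, hrs.2.trans hs.2⟩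
      rw [hr' hrab]
      exact (hr hrab).1
    linarith
  · refine hasDerivWithinAt_of_eq_integral (v := fun s => -dX h s (ξ s) (p s))
      (hcomp h1.continuous_dX).neg (fun s hs => ?_) s hs
    rw [intervalIntegral.integral_neg]
    have e2 : ∫ r in a..s, dX h r (ξ r) (p r) = ∫ r in a..s, dX h r (ξ r) (q r) := by
      refine intervalIntegral.integral_congr_ae ?_
      filter_upwards [hpq] with r hr' hrs
      rw [uIoc_of_le hs.1] at hrs
      rw [hr' ⟨hrs.1, hrs.2.trans hs.2⟩]
    rw [e2]
    simp only [hp, intervalIntegral.integral_same, sub_zero]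
    ring
  · rw [hcal]
    refine intervalIntegral.integral_congr_ae ?_
    filter_upwards [hgood, hpq] with r hr hr' hrs
    rw [uIoc_of_le hab.le] at hrs
    obtain ⟨d1, d2, -, -⟩ := hr hrs
    refine d2.trans ?_
    rw [hr' hrs, d1]

/-- Domination holds on `[a, s]` and on `[s, b]`, and the two inequalities add up to an equality. -/
lemma calibrated_sub (P : SemiconcavePotential h c t₀ K y u) (hh : Smooth 2 h)
    (hpos : ∀ s x p, 0 < dP (dP h) s x p) (hconv : ∀ s x, ConvexOn ℝ univ (h s x))
    {a b : ℝ} (ha : t₀ < a) {ξ p : ℝ → ℝ} (T : IsLiftTraj h (Icc a b) ξ p)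
    (hcal : u b (ξ b) - u a (ξ a) = action h c ξ p a b) :
    ∀ s ∈ Icc a b, u b (ξ b) - u s (ξ s) = action h c ξ p s b := by
  intro s hs
  have h1 : Smooth 1 h := ContDiff.of_le hh (by norm_num)
  have e1 := P.sub_le_action hh hpos hconv ha T s hs
  have e2 := P.sub_le_action hh hpos hconv ha (T.mono (Icc_subset_Icc_right hs.2)) a
    ⟨le_rfl, hs.1⟩
  have hc := T.continuousOn_action_integrand h1 c
  have e3 : action h c ξ p a s + action h c ξ p s b = action h c ξ p a b :=
    intervalIntegral.integral_add_adjacent_intervals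
      ((hc.mono (Icc_subset_Icc_right hs.2)).intervalIntegrable_of_Icc hs.1)
      ((hc.mono (Icc_subset_Icc_left hs.1)).intervalIntegrable_of_Icc hs.2)
  linarith

end SemiconcavePotential
end Burgers

namespace Burgers

/-! ### The potential of an entropy solution -/

section Circle

/-- The covering map preserves measure on each unit interval, and countably many of these cover the
line. This transports null sets and measurability to the cover. -/
lemma quasiMeasurePreserving_coe :
    Measure.QuasiMeasurePreserving ((↑) : ℝ → Circ) volume volume := by
  refine ⟨AddCircle.measurable_mk', ?_⟩
  refine Measure.AbsolutelyContinuous.mk fun s hs h0 => ?_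
  rw [Measure.map_apply AddCircle.measurable_mk' hs]
  have hU : ((↑) : ℝ → Circ) ⁻¹' s = ⋃ k : ℤ, (((↑) : ℝ → Circ) ⁻¹' s ∩ Ioc (k : ℝ) (k + 1)) := by
    rw [← inter_iUnion, iUnion_Ioc_intCast, inter_univ]
  rw [hU, measure_iUnion_null_iff]
  intro k
  have h := (UnitAddCircle.measurePreserving_mk (k : ℝ)).measure_preimage hs.nullMeasurableSet
  rwa [h0, Measure.restrict_apply (AddCircle.measurable_mk' hs)] at h

lemma quasiMeasurePreserving_prodMap_coe :
    Measure.QuasiMeasurePreserving (fun z : ℝ × ℝ => (z.1, (z.2 : Circ))) volume volume :=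
  QuasiMeasurePreserving.prodMap (Measure.QuasiMeasurePreserving.id _) quasiMeasurePreserving_coe

lemma intervalIntegrable_coe {f : Circ → ℝ} (hf : Integrable f) (a b : ℝ) :
    IntervalIntegrable (fun x : ℝ => f x) volume a b := by
  refine Function.Periodic.intervalIntegrable₀ (T := 1) (fun x => by simp)
    one_ne_zero ?_ a b
  rw [intervalIntegrable_iff_integrableOn_Ioc_of_le zero_le_one]
  have := (UnitAddCircle.measurePreserving_mk 0).integrable_comp_of_integrable hf
  rwa [zero_add] at this

lemma integral_circ_eq (f : Circ → ℝ) : ∫ x, f x = ∫ x in (0 : ℝ)..1, f x := by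
  rw [← UnitAddCircle.intervalIntegral_preimage 0 f, zero_add]

lemma circDeriv_coe (f : Circ → ℝ) (x : ℝ) : circDeriv f x = deriv (fun z : ℝ => f z) x := by
  have h : (fun r : ℝ => f ((x : Circ) + (r : Circ))) = fun r => (fun z : ℝ => f z) (x + r) := by
    funext r; simp
  have h2 := deriv_comp_const_add (fun z : ℝ => f z) x 0
  rw [add_zero] at h2
  rw [circDeriv, h, h2]

end Circle

/-- Integration by parts with `g` merely integrable: its primitive is absolutely continuous with
derivative `g` almost everywhere. -/
lemma integral_deriv_mul_primitive {χ g : ℝ → ℝ} {a b : ℝ}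
    (hχ : ContDiff ℝ 1 χ) (hg : IntervalIntegrable g volume a b) :
    ∫ t in a..b, deriv χ t * (∫ s in a..t, g s)
      = χ b * (∫ s in a..b, g s) - ∫ t in a..b, χ t * g t := by
  have hG := hg.absolutelyContinuousOnInterval_intervalIntegral (c := a) left_mem_uIcc
  have hX : AbsolutelyContinuousOnInterval χ a b :=
    hχ.contDiffOn.absolutelyContinuousOnInterval
  have h := hX.integral_mul_deriv_eq_deriv_mul hG
  have h2 : ∫ t in a..b, χ t * deriv (fun x => ∫ v in a..x, g v) t = ∫ t in a..b, χ t * g t := by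
    refine intervalIntegral.integral_congr_ae ?_
    filter_upwards [hg.ae_hasDerivAt_integral] with t ht hmem
    rw [(ht (uIoc_subset_uIcc hmem) a left_mem_uIcc).deriv]
  rw [h2] at h
  simp only [intervalIntegral.integral_same, mul_zero, sub_zero] at h
  linarith

lemma continuous_periodic_lift {f : ℝ → ℝ} (hf : Continuous f) (hp : Function.Periodic f 1) :
    Continuous (hp.lift : Circ → ℝ) :=
  continuous_coinduced_dom.2 (by simpa [Function.comp_def] using! hf)

lemma circDeriv_lift_coe {f : ℝ → ℝ} (hp : Function.Periodic f 1) (x : ℝ) :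
    circDeriv (hp.lift : Circ → ℝ) x = deriv f x := by
  rw [circDeriv_coe]
  rfl

lemma continuous_circDeriv_lift {f : ℝ → ℝ} (hf : ContDiff ℝ 1 f) (hp : Function.Periodic f 1) :
    Continuous (circDeriv (hp.lift : Circ → ℝ)) := by
  refine continuous_coinduced_dom.2 ?_
  have : (circDeriv (hp.lift : Circ → ℝ)) ∘ ((↑) : ℝ → Circ) = deriv f :=
    funext (circDeriv_lift_coe hp)
  exact this ▸ hf.continuous_deriv_one

/-! ### The weak equation tested against products of a time and a space function -/

namespace IsEntropySolution

variable {H : ℝ → Circ → ℝ → ℝ} {t₀ : ℝ} {y : ℝ → Circ → ℝ}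

lemma continuousOn_integral_mul (hy : IsEntropySolution H t₀ y) {Ψ : Circ → ℝ}
    (hΨ : Continuous Ψ) : ContinuousOn (fun s => ∫ x, y s x * Ψ x) (Ici t₀) := by
  obtain ⟨C, hC⟩ := isCompact_univ.exists_bound_of_continuousOn hΨ.continuousOn
  have hint : ∀ s ≥ t₀, Integrable (fun x => y s x * Ψ x) := fun s hs =>
    (hy.integrable s hs).mul_bdd hΨ.aestronglyMeasurable (ae_of_all _ fun x => hC x (mem_univ x))
  intro t ht
  refine tendsto_iff_dist_tendsto_zero.2 ?_
  have h := (hy.continuous_L1 t ht).mul_const C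
  rw [zero_mul] at h
  refine squeeze_zero' (Eventually.of_forall fun s => dist_nonneg) ?_ h
  filter_upwards [self_mem_nhdsWithin] with s hs
  rw [Real.dist_eq, ← integral_sub (hint s hs) (hint t ht), ← integral_mul_const]
  refine (abs_integral_le_integral_abs).trans ?_
  refine integral_mono ((hint s hs).sub (hint t ht)).abs
    (((hy.integrable s hs).sub (hy.integrable t ht)).abs.mul_const C) fun x => ?_
  simp only [← sub_mul, abs_mul]
  exact mul_le_mul_of_nonneg_left (hC x (mem_univ x)) (abs_nonneg _)

/-- Since `η` vanishes after `T`, the integral reduces to the compact set `[t₀, T] × 𝕋`, where the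
local integrability hypotheses and Fubini apply. `η` need not vanish at `t₀`, so the initial term
survives. -/
lemma weak_separated (hy : IsEntropySolution H t₀ y) {ψ η : ℝ → ℝ}
    (hψ : ContDiff ℝ ((⊤ : ℕ∞) : WithTop ℕ∞) ψ) (hp : Function.Periodic ψ 1)
    (hη : ContDiff ℝ ((⊤ : ℕ∞) : WithTop ℕ∞) η) {T : ℝ} (hT : t₀ ≤ T)
    (hηT : ∀ s ≥ T, η s = 0) :
    (∫ s in t₀..T, deriv η s * ∫ x, y s x * (hp.lift : Circ → ℝ) x)
      + (∫ s in t₀..T, η s * ∫ x, H s x (y s x) * circDeriv (hp.lift : Circ → ℝ) x)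
      + η t₀ * ∫ x, y t₀ x * (hp.lift : Circ → ℝ) x = 0 := by
  have h1 : (1 : WithTop ℕ∞) ≤ ((⊤ : ℕ∞) : WithTop ℕ∞) := by exact_mod_cast le_top
  have hψ1 : ContDiff ℝ 1 ψ := hψ.of_le h1
  have hη1 : ContDiff ℝ 1 η := hη.of_le h1
  set Ψ : Circ → ℝ := hp.lift with hΨ
  have hΨc : Continuous Ψ := continuous_periodic_lift hψ.continuous hp
  have hΨ'c : Continuous (circDeriv Ψ) := continuous_circDeriv_lift hψ1 hp
  have hw := hy.weak (fun s x => η s * Ψ x)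
    ⟨(hη.comp contDiff_fst).mul (hψ.comp contDiff_snd), T, fun s hs x => by simp [hηT s hs]⟩
  have hd1 : ∀ (s : ℝ) (x : Circ), deriv (fun s => η s * Ψ x) s = deriv η s * Ψ x := fun s x =>
    deriv_mul_const (hη1.differentiable one_ne_zero _) _
  have hd2 : ∀ (s : ℝ) (x : Circ), circDeriv (fun x => η s * Ψ x) x = η s * circDeriv Ψ x :=
    fun s x => deriv_const_mul_field _
  simp only [hd1, hd2] at hw
  have hd0 : ∀ s > T, deriv η s = 0 := fun s hs => by
    have : η =ᶠ[𝓝 s] fun _ => 0 := by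
      filter_upwards [Ioi_mem_nhds hs] with r hr using hηT r (le_of_lt hr)
    rw [this.deriv_eq, deriv_const]
  rw [setIntegral_eq_of_subset_of_forall_sdiff_eq_zero (s := Icc t₀ T ×ˢ univ)
    (measurableSet_Ici.prod MeasurableSet.univ)
    (prod_mono Icc_subset_Ici_self Subset.rfl)] at hw
  swap
  · rintro ⟨s, x⟩ ⟨⟨hs, -⟩, hns⟩
    have hsT : T < s := by
      by_contra hc
      exact hns ⟨⟨hs, not_lt.1 hc⟩, mem_univ _⟩
    simp [hd0 s hsT, hηT s hsT.le]
  have hK : IsCompact (Icc t₀ T ×ˢ (univ : Set Circ)) := isCompact_Icc.prod isCompact_univ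
  have hi1 : IntegrableOn (fun z : ℝ × Circ => y z.1 z.2 * (deriv η z.1 * Ψ z.2))
      (Icc t₀ T ×ˢ univ) := (hy.locInt T).mul_continuousOn
        (((hη1.continuous_deriv_one).comp continuous_fst).mul
          (hΨc.comp continuous_snd)).continuousOn hK
  have hi2 : IntegrableOn (fun z : ℝ × Circ => H z.1 z.2 (y z.1 z.2) * (η z.1 * circDeriv Ψ z.2))
      (Icc t₀ T ×ˢ univ) := (hy.locInt_H T).mul_continuousOn
        ((hη.continuous.comp continuous_fst).mul (hΨ'c.comp continuous_snd)).continuousOn hK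
  rw [integral_add hi1 hi2] at hw
  have e1 : ∫ z in Icc t₀ T ×ˢ (univ : Set Circ), y z.1 z.2 * (deriv η z.1 * Ψ z.2)
      = ∫ s in t₀..T, deriv η s * ∫ x, y s x * Ψ x := by
    rw [Measure.volume_eq_prod] at hi1 ⊢
    rw [setIntegral_prod _ hi1, intervalIntegral.integral_of_le hT, integral_Icc_eq_integral_Ioc]
    refine integral_congr_ae (ae_of_all _ fun s => ?_)
    simp only [Measure.restrict_univ, ← integral_const_mul]
    congr 1; funext x; ring
  have e2 : ∫ z in Icc t₀ T ×ˢ (univ : Set Circ), H z.1 z.2 (y z.1 z.2) * (η z.1 * circDeriv Ψ z.2)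
      = ∫ s in t₀..T, η s * ∫ x, H s x (y s x) * circDeriv Ψ x := by
    rw [Measure.volume_eq_prod] at hi2 ⊢
    rw [setIntegral_prod _ hi2, intervalIntegral.integral_of_le hT, integral_Icc_eq_integral_Ioc]
    refine integral_congr_ae (ae_of_all _ fun s => ?_)
    simp only [Measure.restrict_univ, ← integral_const_mul]
    congr 1; funext x; ring
  have e3 : ∫ x, y t₀ x * (η t₀ * Ψ x) = η t₀ * ∫ x, y t₀ x * Ψ x := by
    rw [← integral_const_mul]
    congr 1; funext x; ring
  rw [e1, e2, e3] at hw
  exact hw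

lemma intervalIntegrable_integral_mul (hy : IsEntropySolution H t₀ y) {Ψ : Circ → ℝ}
    (hΨ : Continuous Ψ) {T : ℝ} (hT : t₀ ≤ T) :
    IntervalIntegrable (fun s => ∫ x, H s x (y s x) * Ψ x) volume t₀ T := by
  have hi : IntegrableOn (fun z : ℝ × Circ => H z.1 z.2 (y z.1 z.2) * Ψ z.2)
      (Icc t₀ T ×ˢ univ) := (hy.locInt_H T).mul_continuousOn
        (hΨ.comp continuous_snd).continuousOn (isCompact_Icc.prod isCompact_univ)
  rw [IntegrableOn, Measure.volume_eq_prod, ← Measure.prod_restrict, Measure.restrict_univ] at hi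
  rw [intervalIntegrable_iff_integrableOn_Icc_of_le hT]
  exact hi.integral_prod_left

lemma integral_mul_eq_circ (hy : IsEntropySolution H t₀ y) {ψ : ℝ → ℝ}
    (hψ : ContDiff ℝ ((⊤ : ℕ∞) : WithTop ℕ∞) ψ) (hp : Function.Periodic ψ 1) {t : ℝ}
    (ht : t₀ ≤ t) :
    ∫ x, y t x * (hp.lift : Circ → ℝ) x = (∫ x, y t₀ x * (hp.lift : Circ → ℝ) x)
      + ∫ s in t₀..t, ∫ x, H s x (y s x) * circDeriv (hp.lift : Circ → ℝ) x := by
  have h1 : (1 : WithTop ℕ∞) ≤ ((⊤ : ℕ∞) : WithTop ℕ∞) := by exact_mod_cast le_top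
  have hψ1 : ContDiff ℝ 1 ψ := hψ.of_le h1
  have hΨc := continuous_periodic_lift hψ.continuous hp
  have hΨ'c := continuous_circDeriv_lift hψ1 hp
  set m : ℝ → ℝ := fun s => ∫ x, y s x * (hp.lift : Circ → ℝ) x with hm
  set g : ℝ → ℝ := fun s => ∫ x, H s x (y s x) * circDeriv (hp.lift : Circ → ℝ) x with hg
  -- The extra unit keeps the interval nondegenerate when `t = t₀`, so that almost everywhere
  -- equality of continuous functions gives equality at `t`.
  set T := t + 1 with hTdef
  have hT : t₀ < T := by linarith
  have hgi : IntervalIntegrable g volume t₀ T := hy.intervalIntegrable_integral_mul hΨ'c hT.le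
  have hmc : ContinuousOn m (Icc t₀ T) :=
    (hy.continuousOn_integral_mul hΨc).mono Icc_subset_Ici_self
  have hGc : ContinuousOn (fun r => ∫ s in t₀..r, g s) (Icc t₀ T) := by
    have := intervalIntegral.continuousOn_primitive_interval' hgi left_mem_uIcc
    rwa [uIcc_of_le hT.le] at this
  have hDc : ContinuousOn (fun r => m r - m t₀ - ∫ s in t₀..r, g s) (Icc t₀ T) :=
    (hmc.sub continuousOn_const).sub hGc
  have key : ∀ᵐ r, r ∈ Ioo t₀ T → m r - m t₀ - ∫ s in t₀..r, g s = 0 := by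
    refine isOpen_Ioo.ae_eq_zero_of_integral_contDiff_smul_eq_zero
      ((hDc.mono Ioo_subset_Icc_self).locallyIntegrableOn measurableSet_Ioo) ?_
    intro η hη hηc hsupp
    -- Testing with the primitive that vanishes at `T` brings in the initial value directly: `χ t₀`
    -- is minus the integral of `η`, and integration by parts turns `χ g` into `η` times the
    -- primitive of `g`.
    set χ : ℝ → ℝ := fun s => ∫ r in T..s, η r with hχ
    have hχd : ∀ s, HasDerivAt χ (η s) s := fun s =>
      intervalIntegral.integral_hasDerivAt_right (hη.continuous.intervalIntegrable _ _)
        (hη.continuous.stronglyMeasurableAtFilter _ _) hη.continuous.continuousAt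
    have hχ' : deriv χ = η := funext fun s => (hχd s).deriv
    have hχs : ContDiff ℝ ((⊤ : ℕ∞) : WithTop ℕ∞) χ :=
      contDiff_infty_iff_deriv.2 ⟨fun s => (hχd s).differentiableAt, by rw [hχ']; exact hη⟩
    have hη0 : ∀ s, s ∉ Ioo t₀ T → η s = 0 := fun s hs =>
      image_eq_zero_of_notMem_tsupport fun h => hs (hsupp h)
    have hχ0 : ∀ s ≥ T, χ s = 0 := fun s hs => by
      refine intervalIntegral.integral_zero_ae (ae_of_all _ fun r hr => hη0 r fun h => ?_)
      rw [uIoc_of_le hs] at hr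
      exact absurd h.2 (not_lt.2 hr.1.le)
    have hw := hy.weak_separated hψ hp hχs hT.le hχ0
    rw [hχ'] at hw
    have hparts := integral_deriv_mul_primitive (hχs.of_le h1) hgi
    rw [hχ', hχ0 T le_rfl, zero_mul, zero_sub] at hparts
    have hχt : χ t₀ = -∫ s in t₀..T, η s := intervalIntegral.integral_symm _ _
    have hi1 : IntervalIntegrable (fun s => η s * m s) volume t₀ T :=
      (hη.continuous.continuousOn.mul hmc).intervalIntegrable_of_Icc hT.le
    have hi2 : IntervalIntegrable (fun s => η s * ∫ r in t₀..s, g r) volume t₀ T :=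
      (hη.continuous.continuousOn.mul hGc).intervalIntegrable_of_Icc hT.le
    have hi3 : IntervalIntegrable (fun s => η s * m t₀) volume t₀ T :=
      (hη.continuous.mul continuous_const).intervalIntegrable _ _
    have hsum : ∫ s in t₀..T, η s * (m s - m t₀ - ∫ r in t₀..s, g r) = 0 := by
      have : ∀ s, η s * (m s - m t₀ - ∫ r in t₀..s, g r)
          = η s * m s - η s * m t₀ - η s * ∫ r in t₀..s, g r := fun s => by ring
      simp only [this]
      rw [intervalIntegral.integral_sub (hi1.sub hi3) hi2, intervalIntegral.integral_sub hi1 hi3,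
        intervalIntegral.integral_mul_const, hparts]
      rw [hχt] at hw
      linarith
    rw [intervalIntegral.integral_of_le hT.le, ← integral_Icc_eq_integral_Ioc,
      setIntegral_eq_integral_of_forall_compl_eq_zero] at hsum
    · exact hsum
    · intro s hs
      rw [hη0 s fun h => hs (Ioo_subset_Icc_self h), zero_mul]
  have hae : (fun r => m r - m t₀ - ∫ s in t₀..r, g s) =ᵐ[volume.restrict (Icc t₀ T)]
      fun _ => 0 := by
    rw [restrict_Ioo_eq_restrict_Icc.symm]
    exact (ae_restrict_iff' measurableSet_Ioo).2 key
  have := Measure.eqOn_Icc_of_ae_eq volume hT.ne hae hDc continuousOn_const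
    (show t ∈ Icc t₀ T from ⟨ht, by linarith⟩)
  simp only at this
  linarith

/-- The equation tested against a periodic function of the space variable. -/
lemma integral_mul_eq (hy : IsEntropySolution H t₀ y) {ψ : ℝ → ℝ}
    (hψ : ContDiff ℝ ((⊤ : ℕ∞) : WithTop ℕ∞) ψ) (hp : Function.Periodic ψ 1) {t : ℝ}
    (ht : t₀ ≤ t) :
    ∫ x in (0 : ℝ)..1, y t x * ψ x = (∫ x in (0 : ℝ)..1, y t₀ x * ψ x)
      + ∫ s in t₀..t, ∫ x in (0 : ℝ)..1, H s x (y s x) * deriv ψ x := by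
  have h := hy.integral_mul_eq_circ hψ hp ht
  simp only [integral_circ_eq, circDeriv_lift_coe] at h
  exact h

end IsEntropySolution

/-- Sines and cosines of nonzero frequency are derivatives of periodic functions, and the zero
frequency is the mean. All Fourier coefficients vanish, so `F` is zero almost everywhere by
Parseval. -/
lemma integral_eq_zero_of_forall_integral_mul_deriv {F : ℝ → ℝ} {B : ℝ}
    (hm : AEStronglyMeasurable F (volume.restrict (Ioc 0 1))) (hB : ∀ x, |F x| ≤ B)
    (h0 : ∫ x in (0 : ℝ)..1, F x = 0)
    (h : ∀ ψ : ℝ → ℝ, ContDiff ℝ ((⊤ : ℕ∞) : WithTop ℕ∞) ψ → Function.Periodic ψ 1 →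
      ∫ x in (0 : ℝ)..1, F x * deriv ψ x = 0) :
    ∀ x ∈ Icc (0 : ℝ) 1, ∫ r in (0 : ℝ)..x, F r = 0 := by
  have hcs : ∀ n : ℤ, (∫ x in (0 : ℝ)..1, F x * Real.cos (2 * Real.pi * n * x) = 0) ∧
      ∫ x in (0 : ℝ)..1, F x * Real.sin (2 * Real.pi * n * x) = 0 := by
    intro n
    rcases eq_or_ne n 0 with rfl | hn
    · simpa using h0
    have hn' : 2 * Real.pi * (n : ℝ) ≠ 0 := by
      have : (n : ℝ) ≠ 0 := by exact_mod_cast hn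
      positivity
    have hper : ∀ x : ℝ, 2 * Real.pi * n * (x + 1) = 2 * Real.pi * n * x + n * (2 * Real.pi) :=
      fun x => by ring
    have hl : ∀ x : ℝ, HasDerivAt (fun x : ℝ => 2 * Real.pi * n * x) (2 * Real.pi * n) x :=
      fun x => by simpa using (hasDerivAt_id x).const_mul (2 * Real.pi * n)
    constructor
    · have := h (fun x => Real.sin (2 * Real.pi * n * x) / (2 * Real.pi * n))
        ((Real.contDiff_sin.comp (contDiff_const.mul contDiff_id)).div_const _)
        (fun x => by simp only [hper, Real.sin_add_int_mul_two_pi])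
      refine Eq.trans ?_ this
      congr 1; funext x
      rw [((hl x).sin.div_const _).deriv, mul_div_cancel_right₀ _ hn']
    · have := h (fun x => Real.cos (2 * Real.pi * n * x) / (-(2 * Real.pi * n)))
        ((Real.contDiff_cos.comp (contDiff_const.mul contDiff_id)).div_const _)
        (fun x => by simp only [hper, Real.cos_add_int_mul_two_pi])
      refine Eq.trans ?_ this
      congr 1; funext x
      rw [((hl x).cos.div_const _).deriv, neg_mul, neg_div_neg_eq, mul_div_cancel_right₀ _ hn']
  have hbd : ∀ {g : ℝ → ℝ}, Continuous g →
      IntervalIntegrable (fun x => F x * g x) volume 0 1 := by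
    intro g hg
    have hF : IntervalIntegrable F volume 0 1 := by
      rw [intervalIntegrable_iff_integrableOn_Ioc_of_le zero_le_one]
      exact IntegrableOn.of_bound measure_Ioc_lt_top hm B (ae_of_all _ hB)
    exact hF.mul_continuousOn hg.continuousOn
  have hbd' : ∀ {g : ℝ → ℝ}, IntervalIntegrable g volume 0 1 →
      IntervalIntegrable (fun x => (g x : ℂ)) volume 0 1 := fun h => ⟨h.1.ofReal, h.2.ofReal⟩
  have hFm : MemLp (fun x => (F x : ℂ)) 2 (volume.restrict (Ioc 0 1)) :=
    MemLp.of_bound (Complex.continuous_ofReal.comp_aestronglyMeasurable hm) B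
      (ae_of_all _ fun x => by simpa using hB x)
  have hs := hasSum_sq_fourierCoeffOn (zero_lt_one' ℝ) hFm
  have hz : ∀ n : ℤ, fourierCoeffOn (zero_lt_one' ℝ) (fun x => (F x : ℂ)) n = 0 := by
    intro n
    rw [fourierCoeffOn_eq_integral]
    have hpt : ∀ x : ℝ, fourier (-n) (x : AddCircle ((1 : ℝ) - 0)) • (F x : ℂ)
        = ((F x * Real.cos (2 * Real.pi * n * x) : ℝ) : ℂ)
          - ((F x * Real.sin (2 * Real.pi * n * x) : ℝ) : ℂ) * Complex.I := by
      intro x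
      rw [fourier_coe_apply]
      have : (2 * Real.pi * Complex.I * ((-n : ℤ) : ℂ) * x / ((1 - 0 : ℝ) : ℂ) : ℂ)
          = ((-(2 * Real.pi * n * x) : ℝ) : ℂ) * Complex.I := by
        push_cast; ring
      rw [this, Complex.exp_mul_I, ← Complex.ofReal_cos, ← Complex.ofReal_sin, Real.cos_neg,
        Real.sin_neg, smul_eq_mul]
      push_cast; ring
    simp only [hpt]
    rw [intervalIntegral.integral_sub, intervalIntegral.integral_mul_const,
      intervalIntegral.integral_ofReal, intervalIntegral.integral_ofReal, (hcs n).1, (hcs n).2]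
    · simp
    · exact hbd' (hbd (g := fun x => Real.cos (2 * Real.pi * n * x)) (by fun_prop))
    · exact (hbd' (hbd (g := fun x => Real.sin (2 * Real.pi * n * x))
        (by fun_prop))).mul_const _
  simp only [hz, norm_zero, ne_eq, OfNat.ofNat_ne_zero, not_false_eq_true, zero_pow] at hs
  have hsq := hs.unique hasSum_zero
  rw [sub_zero, inv_one, one_smul, intervalIntegral.integral_of_le zero_le_one] at hsq
  have hae := (integral_eq_zero_iff_of_nonneg (fun x => sq_nonneg _) hFm.integrable_norm_pow').1 hsq
  have hae' : ∀ᵐ x, x ∈ Ioc (0 : ℝ) 1 → F x = 0 := by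
    filter_upwards [(ae_restrict_iff' measurableSet_Ioc).1 hae] with x hx hmem
    simpa using hx hmem
  intro x hx
  refine intervalIntegral.integral_zero_ae ?_
  filter_upwards [hae'] with r hr hmem
  rw [uIoc_of_le hx.1] at hmem
  exact hr ⟨hmem.1, hmem.2.trans hx.2⟩

/-- On `[x, x + 1]` growth from `x` bounds `f` above by `f x + K`, and growth up to `x + 1`, where
the value is again `f x`, bounds it below by `f x - K`. Averaging over the period gives the claim.
-/
lemma Periodic.abs_sub_le_of_oleinik {f : ℝ → ℝ} {K c : ℝ} (hp : Function.Periodic f 1)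
    (hf : UpperLip K f) (hK : 0 ≤ K) (hi : IntervalIntegrable f volume 0 1)
    (hc : ∫ x in (0 : ℝ)..1, f x = c) (x : ℝ) : |f x - c| ≤ K := by
  have hc' : ∫ r in x..x + 1, f r = c := by rw [hp.intervalIntegral_add_eq x 0, zero_add, hc]
  have hi' : IntervalIntegrable f volume x (x + 1) :=
    hp.intervalIntegrable₀ one_ne_zero hi _ _
  have h1 : ∀ r ∈ Icc x (x + 1), f r ≤ f x + K := by
    intro r hr
    rcases eq_or_lt_of_le hr.1 with rfl | h
    · linarith
    · have h2 := hf x (r - x) (sub_pos.2 h)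
      rw [add_sub_cancel] at h2
      nlinarith [hr.2]
  have h2 : ∀ r ∈ Icc x (x + 1), f x - K ≤ f r := by
    intro r hr
    rcases eq_or_lt_of_le hr.2 with rfl | h
    · rw [hp x]; linarith
    · have h2 := hf r (x + 1 - r) (sub_pos.2 h)
      rw [add_sub_cancel, hp x] at h2
      nlinarith [hr.1]
  have e1 := intervalIntegral.integral_mono_on (by linarith) hi'
    (intervalIntegrable_const (c := f x + K)) h1
  have e2 := intervalIntegral.integral_mono_on (by linarith)
    (intervalIntegrable_const (c := f x - K)) hi' h2
  rw [hc', intervalIntegral.integral_const] at e1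
  rw [hc', intervalIntegral.integral_const] at e2
  simp only [add_sub_cancel_left, one_smul] at e1 e2
  rw [abs_le]
  constructor <;> linarith

lemma exists_mem_Ico_coe_eq (x : ℝ) : ∃ x' ∈ Ico (0 : ℝ) 1, (x' : Circ) = (x : Circ) := by
  refine ⟨Int.fract x, ⟨Int.fract_nonneg x, Int.fract_lt_one x⟩, ?_⟩
  rw [QuotientAddGroup.eq]
  refine AddSubgroup.mem_zmultiples_iff.2 ⟨⌊x⌋, ?_⟩
  rw [zsmul_eq_mul, mul_one]
  linarith [Int.fract_add_floor x]

/-- A zero mean makes the primitive periodic, so `x` may be taken in `[0, 1)`. The bound is uniform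
over the whole line. -/
lemma Periodic.abs_integral_le {g : ℝ → ℝ} (hp : Function.Periodic g 1)
    (hi : IntervalIntegrable g volume 0 1) (h0 : ∫ x in (0 : ℝ)..1, g x = 0) (x : ℝ) :
    |∫ r in (0 : ℝ)..x, g r| ≤ ∫ r in (0 : ℝ)..1, |g r| := by
  have hii : ∀ a b, IntervalIntegrable g volume a b := hp.intervalIntegrable₀ one_ne_zero hi
  have hW : Function.Periodic (fun x => ∫ r in (0 : ℝ)..x, g r) 1 := by
    intro x
    simp only
    rw [← intervalIntegral.integral_add_adjacent_intervals (hii 0 x) (hii x (x + 1)),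
      hp.intervalIntegral_add_eq x 0, zero_add, h0, add_zero]
  obtain ⟨z, hz, hzx⟩ := hW.exists_mem_Ico₀ one_pos x
  rw [hzx]
  refine (intervalIntegral.abs_integral_le_integral_abs hz.1).trans ?_
  rw [intervalIntegral.integral_of_le hz.1, intervalIntegral.integral_of_le zero_le_one]
  refine setIntegral_mono_set ?_ (ae_of_all _ fun r => abs_nonneg _)
    (Ioc_subset_Ioc_right hz.2.le).eventuallyLE
  exact hi.abs.1

/-- A primitive of `y t - c`, normalised so as to solve the Hamilton-Jacobi equation. -/
noncomputable def potential (H : ℝ → Circ → ℝ → ℝ) (c t₀ : ℝ) (y : ℝ → Circ → ℝ) (t x : ℝ) : ℝ :=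
  (∫ r in (0 : ℝ)..x, (y t r - c)) - (∫ z in (0 : ℝ)..1, ∫ r in (0 : ℝ)..z, (y t r - c))
    - ∫ s in t₀..t, ∫ z in (0 : ℝ)..1, H s z (y s z)

namespace IsEntropySolution

variable {H : ℝ → Circ → ℝ → ℝ} {t₀ : ℝ} {y : ℝ → Circ → ℝ}

lemma intervalIntegrable (hy : IsEntropySolution H t₀ y) {t : ℝ} (ht : t₀ ≤ t) (a b : ℝ) :
    IntervalIntegrable (fun x : ℝ => y t x) volume a b :=
  intervalIntegrable_coe (hy.integrable t ht) a b

lemma integral_eq (hy : IsEntropySolution H t₀ y) {t : ℝ} (ht : t₀ ≤ t) :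
    ∫ x in (0 : ℝ)..1, y t x = ∫ x, y t₀ x := by
  have := hy.integral_mul_eq (ψ := fun _ => 1) contDiff_const (fun _ => rfl) ht
  simpa [integral_circ_eq] using this

lemma upperLip {K : ℝ → ℝ}
    (hK : ∀ t > t₀, ∀ x : Circ, ∀ δ : ℝ, 0 < δ → y t (x + (δ : Circ)) - y t x ≤ K t * δ)
    {t : ℝ} (ht : t₀ < t) : UpperLip (K t) (fun x : ℝ => y t x) := fun x δ hδ => by
  simpa using hK t ht x δ hδ

lemma integral_sub_const (hy : IsEntropySolution H t₀ y) {t : ℝ} (ht : t₀ ≤ t) :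
    ∫ x in (0 : ℝ)..1, (y t x - ∫ x, y t₀ x) = 0 := by
  rw [intervalIntegral.integral_sub (hy.intervalIntegrable ht _ _) (by simp),
    hy.integral_eq ht]
  simp

lemma intervalIntegrable_sub_const (hy : IsEntropySolution H t₀ y) {t : ℝ} (ht : t₀ ≤ t)
    (c a b : ℝ) : IntervalIntegrable (fun x : ℝ => y t x - c) volume a b :=
  (hy.intervalIntegrable ht a b).sub (by simp)

lemma potential_sub (hy : IsEntropySolution H t₀ y) {t : ℝ} (ht : t₀ ≤ t) (c x x' : ℝ) :
    potential H c t₀ y t x' - potential H c t₀ y t x = ∫ r in x..x', (y t r - c) := by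
  have := intervalIntegral.integral_interval_sub_left
    (hy.intervalIntegrable_sub_const ht c 0 x') (hy.intervalIntegrable_sub_const ht c 0 x)
  rw [← this, potential, potential]
  ring

lemma periodic_potential (hy : IsEntropySolution H t₀ y) {t : ℝ} (ht : t₀ ≤ t) :
    Function.Periodic (potential H (∫ x, y t₀ x) t₀ y t) 1 := by
  intro x
  have h := hy.potential_sub ht (∫ x, y t₀ x) x (x + 1)
  have hp : Function.Periodic (fun r : ℝ => y t r - ∫ x, y t₀ x) 1 := fun x => by simp
  rw [hp.intervalIntegral_add_eq x 0, zero_add, hy.integral_sub_const ht] at h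
  linarith

lemma continuous_primitive (hy : IsEntropySolution H t₀ y) {t : ℝ} (ht : t₀ ≤ t) (c : ℝ) :
    Continuous (fun x : ℝ => ∫ r in (0 : ℝ)..x, (y t r - c)) :=
  intervalIntegral.continuous_primitive (hy.intervalIntegrable_sub_const ht c) 0

/-- This turns `L¹` continuity in time into uniform convergence of the primitives. Conservation of
the mean supplies the zero mean of the difference. -/
lemma abs_primitive_sub_le (hy : IsEntropySolution H t₀ y) {t s : ℝ} (ht : t₀ ≤ t) (hs : t₀ ≤ s)
    (c x : ℝ) :
    |(∫ r in (0 : ℝ)..x, (y s r - c)) - ∫ r in (0 : ℝ)..x, (y t r - c)|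
      ≤ ∫ z, |y s z - y t z| := by
  rw [← intervalIntegral.integral_sub (hy.intervalIntegrable_sub_const hs c 0 x)
    (hy.intervalIntegrable_sub_const ht c 0 x), integral_circ_eq]
  simp only [sub_sub_sub_cancel_right]
  refine Periodic.abs_integral_le (fun x => by simp)
    ((hy.intervalIntegrable hs 0 1).sub (hy.intervalIntegrable ht 0 1)) ?_ x
  rw [intervalIntegral.integral_sub (hy.intervalIntegrable hs 0 1)
    (hy.intervalIntegrable ht 0 1), hy.integral_eq hs, hy.integral_eq ht, sub_self]

lemma tendsto_primitive (hy : IsEntropySolution H t₀ y) {t : ℝ} (ht : t₀ ≤ t) (c x : ℝ) :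
    Tendsto (fun z : ℝ × ℝ => ∫ r in (0 : ℝ)..z.2, (y z.1 r - c)) (𝓝[Ici t₀ ×ˢ univ] (t, x))
      (𝓝 (∫ r in (0 : ℝ)..x, (y t r - c))) := by
  have hfst : Tendsto (Prod.fst : ℝ × ℝ → ℝ) (𝓝[Ici t₀ ×ˢ univ] (t, x)) (𝓝[Ici t₀] t) := by
    refine tendsto_nhdsWithin_iff.2 ⟨(continuous_fst.tendsto _).mono_left nhdsWithin_le_nhds, ?_⟩
    filter_upwards [self_mem_nhdsWithin] with z hz using hz.1
  have h1 := (hy.continuous_L1 t ht).comp hfst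
  have h2 : Tendsto (fun z : ℝ × ℝ => ∫ r in (0 : ℝ)..z.2, (y t r - c))
      (𝓝[Ici t₀ ×ˢ univ] (t, x)) (𝓝 (∫ r in (0 : ℝ)..x, (y t r - c))) :=
    (((hy.continuous_primitive ht c).comp continuous_snd).tendsto (t, x)).mono_left
      nhdsWithin_le_nhds
  have h3 : Tendsto (fun z : ℝ × ℝ => (∫ r in (0 : ℝ)..z.2, (y z.1 r - c))
      - ∫ r in (0 : ℝ)..z.2, (y t r - c)) (𝓝[Ici t₀ ×ˢ univ] (t, x)) (𝓝 0) := by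
    refine squeeze_zero_norm' ?_ h1
    filter_upwards [self_mem_nhdsWithin] with z hz
    exact hy.abs_primitive_sub_le ht hz.1 c z.2
  simpa using h3.add h2

lemma continuousOn_integral_primitive (hy : IsEntropySolution H t₀ y) (c : ℝ) :
    ContinuousOn (fun t => ∫ z in (0 : ℝ)..1, ∫ r in (0 : ℝ)..z, (y t r - c)) (Ici t₀) := by
  intro t ht
  refine tendsto_iff_norm_sub_tendsto_zero.2 ?_
  refine squeeze_zero' (Eventually.of_forall fun _ => norm_nonneg _) ?_ (hy.continuous_L1 t ht)
  filter_upwards [self_mem_nhdsWithin] with s hs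
  rw [← intervalIntegral.integral_sub ((hy.continuous_primitive hs c).intervalIntegrable _ _)
    ((hy.continuous_primitive ht c).intervalIntegrable _ _)]
  refine (intervalIntegral.norm_integral_le_of_norm_le_const fun z _ =>
    hy.abs_primitive_sub_le ht hs c z).trans ?_
  simp

lemma intervalIntegrable_flux (hy : IsEntropySolution H t₀ y) {T : ℝ} (hT : t₀ ≤ T) :
    IntervalIntegrable (fun s => ∫ z in (0 : ℝ)..1, H s z (y s z)) volume t₀ T := by
  have := hy.intervalIntegrable_integral_mul (Ψ := fun _ => 1) continuous_const hT
  simpa [integral_circ_eq] using this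

lemma continuousOn_potential (hy : IsEntropySolution H t₀ y) (c : ℝ) :
    ContinuousOn (fun z : ℝ × ℝ => potential H c t₀ y z.1 z.2) (Ici t₀ ×ˢ univ) := by
  have h3 : ContinuousOn (fun t => ∫ s in t₀..t, ∫ z in (0 : ℝ)..1, H s z (y s z)) (Ici t₀) := by
    intro t ht
    have hT : t₀ ≤ t + 1 := le_trans ht (by linarith)
    have h := intervalIntegral.continuousOn_primitive_interval' (hy.intervalIntegrable_flux hT)
      left_mem_uIcc
    rw [uIcc_of_le hT] at h
    refine (h t ⟨ht, by linarith⟩).mono_of_mem_nhdsWithin ?_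
    filter_upwards [self_mem_nhdsWithin,
      mem_nhdsWithin_of_mem_nhds (Iic_mem_nhds (lt_add_one t))] with s h1 h2 using ⟨h1, h2⟩
  have hm : MapsTo (Prod.fst : ℝ × ℝ → ℝ) (Ici t₀ ×ˢ univ) (Ici t₀) := fun z hz => hz.1
  refine ContinuousOn.sub (ContinuousOn.sub ?_
    ((hy.continuousOn_integral_primitive c).comp continuousOn_fst hm))
    (h3.comp continuousOn_fst hm)
  rintro ⟨t, x⟩ hz
  exact hy.tendsto_primitive hz.1 c x

end IsEntropySolution

/-! ### Boundedness and integrability of the flux at positive times -/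

namespace IsEntropySolution

variable {H : ℝ → Circ → ℝ → ℝ} {t₀ : ℝ} {y : ℝ → Circ → ℝ}

lemma aestronglyMeasurable_flux (hy : IsEntropySolution H t₀ y) (T : ℝ) :
    AEStronglyMeasurable (fun z : ℝ × ℝ => H z.1 z.2 (y z.1 z.2))
      (volume.restrict (Icc t₀ T ×ˢ univ)) :=
  (hy.locInt_H T).aestronglyMeasurable.comp_quasiMeasurePreserving
    (quasiMeasurePreserving_prodMap_coe.restrict fun _ hz => ⟨hz.1, mem_univ _⟩)

/-- The Oleinik inequality and the fixed mean confine `y` to a compact range for times at least `t`,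
and positions reduce to one period. -/
lemma exists_flux_bound (hy : IsEntropySolution H t₀ y)
    (hH : Continuous (fun z : ℝ × ℝ × ℝ => H z.1 (z.2.1 : Circ) z.2.2)) {t t' : ℝ}
    (ht : t₀ < t) : ∃ B : ℝ, ∀ s ∈ Icc t t', ∀ x : ℝ, |H s x (y s x)| ≤ B := by
  obtain ⟨K, hK0, hKa, hK⟩ := hy.oleinik
  set c := ∫ x, y t₀ x with hc
  obtain ⟨B, hB⟩ := (isCompact_Icc.prod ((isCompact_Icc (a := (0 : ℝ)) (b := 1)).prod
    (isCompact_Icc (a := c - K t) (b := c + K t)))).exists_bound_of_continuousOn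
      (hH.continuousOn (s := Icc t t' ×ˢ Icc (0 : ℝ) 1 ×ˢ Icc (c - K t) (c + K t)))
  refine ⟨B, fun s hs x => ?_⟩
  obtain ⟨x', hx', hxx⟩ := exists_mem_Ico_coe_eq x
  have hs0 : t₀ < s := ht.trans_le hs.1
  have hb := Periodic.abs_sub_le_of_oleinik (fun x => by simp) (upperLip hK hs0) (hK0 s hs0).le
    (hy.intervalIntegrable hs0.le 0 1) (hy.integral_eq hs0.le) x
  have hKs : K s ≤ K t := hKa ht hs0 hs.1
  rw [abs_le] at hb
  have := hB (s, x', y s x) ⟨hs, Ico_subset_Icc_self hx', by constructor <;> linarith⟩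
  simpa only [hxx] using! this

lemma integrableOn_flux (hy : IsEntropySolution H t₀ y)
    (hH : Continuous (fun z : ℝ × ℝ × ℝ => H z.1 (z.2.1 : Circ) z.2.2)) {t t' : ℝ}
    (ht : t₀ < t) (a b : ℝ) :
    IntegrableOn (fun z : ℝ × ℝ => H z.1 z.2 (y z.1 z.2)) (Ioc t t' ×ˢ uIoc a b) := by
  obtain ⟨B, hB⟩ := hy.exists_flux_bound hH (t' := t') ht
  refine IntegrableOn.of_bound (C := B) ?_ ((hy.aestronglyMeasurable_flux t').mono_set ?_) ?_
  · rw [Measure.volume_eq_prod, Measure.prod_prod]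
    exact ENNReal.mul_lt_top measure_Ioc_lt_top (by simp [uIoc])
  · exact prod_mono (fun s hs => ⟨(ht.trans hs.1).le, hs.2⟩) (subset_univ _)
  · refine (ae_restrict_iff' (measurableSet_Ioc.prod measurableSet_uIoc)).2 (ae_of_all _ ?_)
    rintro ⟨s, x⟩ hz
    exact hB s ⟨hz.1.1.le, hz.1.2⟩ x

lemma integrable_flux_mul (hy : IsEntropySolution H t₀ y)
    (hH : Continuous (fun z : ℝ × ℝ × ℝ => H z.1 (z.2.1 : Circ) z.2.2)) {t t' : ℝ}
    (ht : t₀ < t) (htt : t ≤ t') {g : ℝ → ℝ} (hg : Continuous g) (a b : ℝ) :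
    Integrable (Function.uncurry fun s x : ℝ => H s x (y s x) * g x)
      ((volume.restrict (uIoc t t')).prod (volume.restrict (uIoc a b))) := by
  obtain ⟨C, hC⟩ := isCompact_uIcc.exists_bound_of_continuousOn (hg.continuousOn (s := uIcc a b))
  rw [Measure.prod_restrict, uIoc_of_le htt]
  refine (hy.integrableOn_flux hH ht a b).mul_bdd (c := C)
    (hg.comp continuous_snd).aestronglyMeasurable ?_
  refine (ae_restrict_iff' (measurableSet_Ioc.prod measurableSet_uIoc)).2 (ae_of_all _ ?_)
  rintro ⟨s, x⟩ hz
  exact hC x (uIoc_subset_uIcc hz.2)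

lemma integral_flux_swap (hy : IsEntropySolution H t₀ y)
    (hH : Continuous (fun z : ℝ × ℝ × ℝ => H z.1 (z.2.1 : Circ) z.2.2)) {t t' : ℝ}
    (ht : t₀ < t) (htt : t ≤ t') {g : ℝ → ℝ} (hg : Continuous g) (a b : ℝ) :
    ∫ s in t..t', ∫ x in a..b, H s x (y s x) * g x
      = ∫ x in a..b, (∫ s in t..t', H s x (y s x)) * g x := by
  have h := hy.integrable_flux_mul hH ht htt hg a b
  have := intervalIntegral_integral_swap h
  simp only [intervalIntegral.intervalIntegral_eq_integral_uIoc (b := b),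
    intervalIntegral.integral_smul, this, ← intervalIntegral.integral_mul_const]

lemma aestronglyMeasurable_timeIntegral (hy : IsEntropySolution H t₀ y)
    (hH : Continuous (fun z : ℝ × ℝ × ℝ => H z.1 (z.2.1 : Circ) z.2.2)) {t t' : ℝ}
    (ht : t₀ < t) (htt : t ≤ t') (a b : ℝ) :
    AEStronglyMeasurable (fun x : ℝ => ∫ s in t..t', H s x (y s x))
      (volume.restrict (uIoc a b)) := by
  have h := (hy.integrable_flux_mul hH ht htt (continuous_const (y := (1 : ℝ))) a b).integral_prod_right
  simpa [intervalIntegral.integral_of_le htt, uIoc_of_le htt] using h.aestronglyMeasurable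

end IsEntropySolution

/-! ### The potential solves the integrated Hamilton-Jacobi equation -/

namespace IsEntropySolution

variable {H : ℝ → Circ → ℝ → ℝ} {t₀ : ℝ} {y : ℝ → Circ → ℝ}

lemma continuous_potential (hy : IsEntropySolution H t₀ y) {t : ℝ} (ht : t₀ ≤ t) (c : ℝ) :
    Continuous (potential H c t₀ y t) :=
  ((hy.continuous_primitive ht c).sub continuous_const).sub continuous_const

lemma integral_potential (hy : IsEntropySolution H t₀ y) {t : ℝ} (ht : t₀ ≤ t) (c : ℝ) :
    ∫ x in (0 : ℝ)..1, potential H c t₀ y t x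
      = -∫ s in t₀..t, ∫ z in (0 : ℝ)..1, H s z (y s z) := by
  have hi := (hy.continuous_primitive ht c).intervalIntegrable (μ := volume) 0 1
  simp only [potential]
  rw [intervalIntegral.integral_sub (hi.sub (by simp)) (by simp),
    intervalIntegral.integral_sub hi (by simp)]
  simp

/-- Integration by parts has no boundary contribution, because `y - c` has zero mean and `ψ 1 = ψ
0`. -/
lemma integral_potential_mul_deriv (hy : IsEntropySolution H t₀ y) {t : ℝ} (ht : t₀ ≤ t)
    {ψ : ℝ → ℝ} (hψ : ContDiff ℝ 1 ψ) (hp : Function.Periodic ψ 1) :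
    ∫ x in (0 : ℝ)..1, potential H (∫ x, y t₀ x) t₀ y t x * deriv ψ x
      = (∫ x, y t₀ x) * (∫ x in (0 : ℝ)..1, ψ x) - ∫ x in (0 : ℝ)..1, y t x * ψ x := by
  set c := ∫ x, y t₀ x with hc
  have hψ' := hψ.continuous_deriv_one
  have hpot : ∀ x, potential H c t₀ y t x * deriv ψ x
      = potential H c t₀ y t 0 * deriv ψ x + deriv ψ x * ∫ r in (0 : ℝ)..x, (y t r - c) := by
    intro x
    rw [← hy.potential_sub ht c 0 x]
    ring
  simp only [hpot]
  have hi1 : IntervalIntegrable (fun x => potential H c t₀ y t 0 * deriv ψ x) volume 0 1 :=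
    (continuous_const.mul hψ').intervalIntegrable _ _
  have hi2 : IntervalIntegrable (fun x => deriv ψ x * ∫ r in (0 : ℝ)..x, (y t r - c)) volume 0 1 :=
    (hψ'.mul (hy.continuous_primitive ht c)).intervalIntegrable _ _
  rw [intervalIntegral.integral_add hi1 hi2,
    integral_deriv_mul_primitive hψ (hy.intervalIntegrable_sub_const ht c 0 1),
    hy.integral_sub_const ht, intervalIntegral.integral_const_mul,
    intervalIntegral.integral_deriv_eq_sub
      (fun x _ => (hψ.differentiable one_ne_zero) x) (hψ'.intervalIntegrable _ _)]
  have h01 : ψ 1 = ψ 0 := by simpa using hp 0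
  have hi : IntervalIntegrable (fun x : ℝ => y t x * ψ x) volume 0 1 :=
    (hy.intervalIntegrable ht 0 1).mul_continuousOn hψ.continuous.continuousOn
  have : ∀ x : ℝ, ψ x * (y t x - c) = y t x * ψ x - c * ψ x := fun x => by ring
  simp only [this]
  have hi3 : IntervalIntegrable (fun x => c * ψ x) volume 0 1 :=
    (continuous_const.mul hψ.continuous).intervalIntegrable _ _
  rw [intervalIntegral.integral_sub hi hi3, h01,
    intervalIntegral.integral_const_mul]
  ring

/-- The Hamilton-Jacobi equation, integrated over a rectangle. -/
lemma integral_potential_sub (hy : IsEntropySolution H t₀ y)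
    (hH : Continuous (fun z : ℝ × ℝ × ℝ => H z.1 (z.2.1 : Circ) z.2.2)) {t t' : ℝ}
    (ht : t₀ < t) (htt : t ≤ t') (a b : ℝ) :
    ∫ x in a..b, (potential H (∫ x, y t₀ x) t₀ y t' x - potential H (∫ x, y t₀ x) t₀ y t x)
      = -∫ s in t..t', ∫ x in a..b, H s x (y s x) := by
  set c := ∫ x, y t₀ x with hc
  have ht' : t₀ ≤ t' := ht.le.trans htt
  set D : ℝ → ℝ := fun x => potential H c t₀ y t' x - potential H c t₀ y t x with hD
  set N : ℝ → ℝ := fun x => ∫ s in t..t', H s x (y s x) with hN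
  have hDc : Continuous D :=
    (hy.continuous_potential ht' c).sub (hy.continuous_potential ht.le c)
  have hDp : Function.Periodic D 1 :=
    (hy.periodic_potential ht').sub (hy.periodic_potential ht.le)
  have hNp : Function.Periodic N 1 := fun x => by simp [hN]
  obtain ⟨B, hB⟩ := hy.exists_flux_bound hH (t' := t') ht
  have hNB : ∀ x, |N x| ≤ B * |t' - t| := fun x => by
    have hle : ∀ s ∈ uIoc t t', ‖H s x (y s x)‖ ≤ B := fun s hs => by
      rw [uIoc_of_le htt] at hs
      exact hB s (Ioc_subset_Icc_self hs) x
    exact intervalIntegral.norm_integral_le_of_norm_le_const hle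
  have hNm : ∀ a b, AEStronglyMeasurable N (volume.restrict (uIoc a b)) :=
    hy.aestronglyMeasurable_timeIntegral hH ht htt
  have hNi : ∀ a b, IntervalIntegrable N volume a b := fun a b => by
    rw [intervalIntegrable_iff]
    exact IntegrableOn.of_bound (by simp [uIoc]) (hNm a b) _ (ae_of_all _ hNB)
  have hswap : ∀ {g : ℝ → ℝ}, Continuous g → ∀ a b, ∫ s in t..t', ∫ x in a..b, H s x (y s x) * g x
      = ∫ x in a..b, N x * g x := fun hg a b => hy.integral_flux_swap hH ht htt hg a b
  have hswap1 : ∀ a b, ∫ s in t..t', ∫ x in a..b, H s x (y s x) = ∫ x in a..b, N x :=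
    fun a b => by simpa using hswap (continuous_const (y := (1 : ℝ))) a b
  obtain ⟨B', hB'⟩ := isCompact_Icc.exists_bound_of_continuousOn
    (hDc.continuousOn (s := Icc (0 : ℝ) 1))
  -- `D + N` is the residual of the equation integrated in time. Its mean vanishes by the
  -- normalization of `potential`, and orthogonality to `deriv ψ` is the weak equation tested with
  -- `ψ`.
  have hF : ∀ x ∈ Icc (0 : ℝ) 1, ∫ r in (0 : ℝ)..x, (D r + N r) = 0 := by
    refine integral_eq_zero_of_forall_integral_mul_deriv (B := B' + B * |t' - t|) ?_ ?_ ?_ ?_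
    · have := hNm 0 1
      rw [uIoc_of_le zero_le_one] at this
      exact hDc.aestronglyMeasurable.add this
    · intro x
      obtain ⟨z, hz, hzx⟩ := hDp.exists_mem_Ico₀ one_pos x
      refine (_root_.abs_add_le _ _).trans (add_le_add ?_ (hNB x))
      rw [hzx]
      exact hB' z (Ico_subset_Icc_self hz)
    · rw [intervalIntegral.integral_add (hDc.intervalIntegrable _ _) (hNi 0 1), ← hswap1,
        intervalIntegral.integral_sub ((hy.continuous_potential ht' c).intervalIntegrable _ _)
          ((hy.continuous_potential ht.le c).intervalIntegrable _ _),
        hy.integral_potential ht' c, hy.integral_potential ht.le c,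
        ← intervalIntegral.integral_interval_sub_left (hy.intervalIntegrable_flux ht')
          (hy.intervalIntegrable_flux ht.le)]
      ring
    · intro ψ hψ hp
      have h1 : (1 : WithTop ℕ∞) ≤ ((⊤ : ℕ∞) : WithTop ℕ∞) := by exact_mod_cast le_top
      have hψ1 : ContDiff ℝ 1 ψ := hψ.of_le h1
      have hψ' := hψ1.continuous_deriv_one
      have hg := fun T (hT : t₀ ≤ T) => hy.intervalIntegrable_integral_mul (continuous_circDeriv_lift hψ1 hp) hT
      simp only [integral_circ_eq, circDeriv_lift_coe] at hg
      simp only [add_mul, hD, sub_mul]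
      have hi1 : IntervalIntegrable (fun x => potential H c t₀ y t' x * deriv ψ x) volume 0 1 :=
        ((hy.continuous_potential ht' c).mul hψ').intervalIntegrable _ _
      have hi2 : IntervalIntegrable (fun x => potential H c t₀ y t x * deriv ψ x) volume 0 1 :=
        ((hy.continuous_potential ht.le c).mul hψ').intervalIntegrable _ _
      rw [intervalIntegral.integral_add (hi1.sub hi2)
        ((hNi 0 1).mul_continuousOn hψ'.continuousOn), ← hswap hψ',
        intervalIntegral.integral_sub hi1 hi2, hy.integral_potential_mul_deriv ht' hψ1 hp,
        hy.integral_potential_mul_deriv ht.le hψ1 hp, hy.integral_mul_eq hψ hp ht',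
        hy.integral_mul_eq hψ hp ht.le,
        ← intervalIntegral.integral_interval_sub_left (hg _ ht') (hg _ ht.le)]
      ring
  have hFi : ∀ a b, IntervalIntegrable (fun r => D r + N r) volume a b := fun a b =>
    (hDc.intervalIntegrable _ _).add (hNi a b)
  -- The mean of the periodic residual is zero, so its primitive is periodic and vanishes on the
  -- whole line.
  have hall : ∀ x, ∫ r in (0 : ℝ)..x, (D r + N r) = 0 := by
    have hW : Function.Periodic (fun x => ∫ r in (0 : ℝ)..x, (D r + N r)) 1 := by
      intro x
      have hDN : Function.Periodic (fun r => D r + N r) 1 := hDp.add hNp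
      simp only
      rw [← intervalIntegral.integral_add_adjacent_intervals (hFi 0 x) (hFi x (x + 1)),
        hDN.intervalIntegral_add_eq x 0,
        zero_add, hF 1 (right_mem_Icc.2 zero_le_one), add_zero]
    intro x
    obtain ⟨z, hz, hzx⟩ := hW.exists_mem_Ico₀ one_pos x
    exact hzx.trans (hF z (Ico_subset_Icc_self hz))
  have hab : ∫ r in a..b, (D r + N r) = 0 := by
    rw [← intervalIntegral.integral_interval_sub_left (hFi 0 b) (hFi 0 a), hall, hall, sub_zero]
  rw [intervalIntegral.integral_add (hDc.intervalIntegrable _ _) (hNi a b), ← hswap1] at hab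
  linarith

theorem semiconcavePotential (hy : IsEntropySolution H t₀ y)
    (hH : Continuous (fun z : ℝ × ℝ × ℝ => H z.1 (z.2.1 : Circ) z.2.2)) :
    ∃ K : ℝ → ℝ, SemiconcavePotential (fun s x p => H s (x : Circ) p) (∫ x, y t₀ x) t₀ K
      (fun t x => y t (x : Circ)) (potential H (∫ x, y t₀ x) t₀ y) := by
  obtain ⟨K, hK0, hKa, hK⟩ := hy.oleinik
  refine ⟨K, hH, fun t ht => upperLip hK ht, hKa, hK0, ?_, hy.continuousOn_potential _,
    fun t ht x x' => hy.potential_sub ht _ x x', ?_⟩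
  · intro t ht x
    exact Periodic.abs_sub_le_of_oleinik (fun x => by simp) (upperLip hK ht) (hK0 t ht).le
      (hy.intervalIntegrable (le_of_lt ht) 0 1) (hy.integral_eq (le_of_lt ht)) x
  · have main : ∀ t t', t₀ < t → t ≤ t' → ∀ x, ∀ ε ≠ (0 : ℝ),
        ∫ θ in (0 : ℝ)..1, (potential H (∫ x, y t₀ x) t₀ y t' (x + ε * θ)
          - potential H (∫ x, y t₀ x) t₀ y t (x + ε * θ)) =
        -∫ s in t..t', ∫ θ in (0 : ℝ)..1,
          H s ((x + ε * θ : ℝ) : Circ) (y s ((x + ε * θ : ℝ) : Circ)) := by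
      intro t t' ht htt x ε hε
      have h := hy.integral_potential_sub hH ht htt (x + ε * 0) (x + ε * 1)
      have e1 := intervalIntegral.integral_comp_add_mul (a := (0 : ℝ)) (b := 1)
        (fun z => potential H (∫ x, y t₀ x) t₀ y t' z - potential H (∫ x, y t₀ x) t₀ y t z) hε x
      have e2 : ∀ s, ∫ θ in (0 : ℝ)..1,
          H s ((x + ε * θ : ℝ) : Circ) (y s ((x + ε * θ : ℝ) : Circ))
          = ε⁻¹ • ∫ z in (x + ε * 0)..(x + ε * 1), H s z (y s z) := fun s =>
        intervalIntegral.integral_comp_add_mul (fun z : ℝ => H s (z : Circ) (y s (z : Circ))) hε x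
      rw [e1, h]
      simp only [e2, intervalIntegral.integral_smul, smul_neg]
    intro t t' ht ht' x ε hε
    rcases le_total t t' with htt | htt
    · exact main t t' ht htt x ε hε
    · have h := main t' t ht' htt x ε hε
      rw [intervalIntegral.integral_symm t' t, neg_neg, ← neg_inj, ← h,
        ← intervalIntegral.integral_neg]
      simp only [neg_sub]

end IsEntropySolution

end Burgers

namespace Burgers

/-! ### Viscosity solutions with prescribed space derivative -/

lemma abs_integral_unit_sub_le {G : ℝ → ℝ} {g η : ℝ} (hm : Measurable G)
    (h : ∀ θ ∈ Icc (0 : ℝ) 1, |G θ - g| ≤ η) : |(∫ θ in (0 : ℝ)..1, G θ) - g| ≤ η := by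
  have hi : IntervalIntegrable G volume 0 1 := by
    rw [intervalIntegrable_iff_integrableOn_Ioc_of_le zero_le_one]
    refine IntegrableOn.of_bound (C := |g| + η) measure_Ioc_lt_top hm.aestronglyMeasurable ?_
    refine (ae_restrict_iff' measurableSet_Ioc).2 (ae_of_all _ fun θ hθ => ?_)
    have h1 := h θ (Ioc_subset_Icc_self hθ)
    have h2 := abs_add_le g (G θ - g)
    rw [add_sub_cancel] at h2
    rw [Real.norm_eq_abs]
    linarith
  have e : (∫ θ in (0 : ℝ)..1, G θ) - g = ∫ θ in (0 : ℝ)..1, (G θ - g) := by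
    rw [intervalIntegral.integral_sub hi (by simp)]
    simp
  rw [e]
  have h2 : ∀ θ ∈ uIoc (0 : ℝ) 1, ‖G θ - g‖ ≤ η := fun θ hθ => by
    rw [uIoc_of_le zero_le_one] at hθ
    exact h θ (Ioc_subset_Icc_self hθ)
  simpa using intervalIntegral.norm_integral_le_of_norm_le_const h2

namespace SemiconcavePotential

variable {h : ℝ → ℝ → ℝ → ℝ} {c t₀ : ℝ} {K : ℝ → ℝ} {y u : ℝ → ℝ → ℝ}

/-- At a continuity point of the slice, joint continuity of `y` allows time, position and segment
length to vary together, without restriction on the sign of the length. -/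
lemma tendsto_average_nhds (P : SemiconcavePotential h c t₀ K y u) {Ψ : ℝ → ℝ → ℝ → ℝ}
    (hΨ : Continuous (fun z : ℝ × ℝ × ℝ => Ψ z.1 z.2.1 z.2.2)) {t x : ℝ} (ht : t₀ < t)
    (hx : ContinuousAt (y t) x) :
    Tendsto (fun w : ℝ × ℝ × ℝ => ∫ θ in (0 : ℝ)..1,
        Ψ w.1 (w.2.1 + w.2.2 * θ) (y w.1 (w.2.1 + w.2.2 * θ))) (𝓝 (t, x, 0))
      (𝓝 (Ψ t x (y t x))) := by
  have hg : ContinuousAt (fun z : ℝ × ℝ => Ψ z.1 z.2 (y z.1 z.2)) (t, x) :=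
    hΨ.continuousAt.comp (f := fun z : ℝ × ℝ => ((z.1, z.2, y z.1 z.2) : ℝ × ℝ × ℝ))
      (continuousAt_fst.prodMk (continuousAt_snd.prodMk (P.continuousAt_y ht hx)))
  rw [Metric.tendsto_nhds]
  intro η hη
  obtain ⟨d, hd, hdg⟩ := Metric.continuousAt_iff.1 hg (η / 2) (by positivity)
  have hn : ∀ᶠ w : ℝ × ℝ × ℝ in 𝓝 (t, x, 0), |w.1 - t| < d ∧ |w.2.1 - x| + |w.2.2| < d ∧
      t₀ < w.1 := by
    refine ((Continuous.tendsto (f := fun w : ℝ × ℝ × ℝ => |w.1 - t|) (by fun_prop) _).eventually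
      (gt_mem_nhds (by simpa using hd))).and (((Continuous.tendsto
        (f := fun w : ℝ × ℝ × ℝ => |w.2.1 - x| + |w.2.2|) (by fun_prop) _).eventually
      (gt_mem_nhds (by simpa using hd))).and ((continuous_fst.tendsto _).eventually
        (lt_mem_nhds ht)))
  filter_upwards [hn] with w hw
  rw [Real.dist_eq]
  refine (abs_integral_unit_sub_le (η := η / 2) ?_ fun θ hθ => ?_).trans_lt (by linarith)
  · have hm := (P.upperLip w.1 hw.2.2).measurable
    exact hΨ.measurable.comp (measurable_const.prodMk
      ((by fun_prop : Measurable fun θ : ℝ => w.2.1 + w.2.2 * θ).prodMk (hm.comp (by fun_prop))))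
  · refine (hdg (x := (w.1, w.2.1 + w.2.2 * θ)) ?_).le
    rw [Prod.dist_eq, max_lt_iff, Real.dist_eq, Real.dist_eq]
    refine ⟨hw.1, lt_of_le_of_lt ?_ hw.2.1⟩
    have h1 : |w.2.2 * θ| ≤ |w.2.2| := by
      rw [abs_mul, abs_of_nonneg hθ.1]
      exact mul_le_of_le_one_right (abs_nonneg _) hθ.2
    have h2 := abs_add_le (w.2.1 - x) (w.2.2 * θ)
    rw [show w.2.1 + w.2.2 * θ - x = (w.2.1 - x) + w.2.2 * θ by ring]
    linarith

lemma contDiffAt_segAvg (P : SemiconcavePotential h c t₀ K y u) {ε : ℝ} (hε : ε ≠ 0)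
    {t : ℝ} (ht : t₀ < t) (x : ℝ) :
    ContDiffAt ℝ 1 (fun z : ℝ × ℝ => segAvg u ε z.1 z.2) (t, x) := by
  have hl : Continuous (fun a : ℝ => ContinuousLinearMap.toSpanSingleton ℝ a) :=
    (ContinuousLinearMap.toSpanSingletonCLE (𝕜 := ℝ) (E := ℝ)).continuous
  refine contDiffAt_one_iff.2 ⟨fun z => (ContinuousLinearMap.toSpanSingleton ℝ
    (-segFlux h y ε z.1 z.2)).coprod (ContinuousLinearMap.toSpanSingleton ℝ
      (segAvg y ε z.1 z.2 - c)), Ioi t₀ ×ˢ univ, prod_mem_nhds (Ioi_mem_nhds ht) univ_mem, ?_, ?_⟩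
  · rintro ⟨s, z⟩ hz
    refine ContinuousAt.continuousWithinAt ?_
    have h1 := hl.continuousAt.comp (P.continuousAt_segFlux hε hz.1 z).neg
    have h2 := hl.continuousAt.comp
      ((P.continuousAt_segAvg_y hε hz.1 z).sub (continuousAt_const (y := c)))
    exact ContinuousAt.continuousLinearMapCoprod h1 h2
  · rintro ⟨s, z⟩ hz
    exact (P.hasStrictFDerivAt_segAvg hε hz.1 z).hasFDerivAt

end SemiconcavePotential

/-- A smooth function which is the identity on `[a, ∞)` and is bounded below by `a - d`. -/
lemma exists_smooth_cutoff (a : ℝ) {d : ℝ} (hd : 0 < d) :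
    ∃ θ : ℝ → ℝ, ContDiff ℝ 1 θ ∧ (∀ t ≥ a, θ t = t) ∧ ∀ t, a - d ≤ θ t := by
  refine ⟨fun t => a + (t - a) * Real.smoothTransition ((t - a + d) / d), ?_, ?_, ?_⟩
  · exact contDiff_const.add ((contDiff_id.sub contDiff_const).mul
      (Real.smoothTransition.contDiff.comp
        (((contDiff_id.sub contDiff_const).add contDiff_const).div_const _)))
  · intro t ht
    simp only
    rw [Real.smoothTransition.one_of_one_le, mul_one, add_sub_cancel]
    rw [le_div_iff₀ hd]
    linarith
  · intro t
    simp only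
    set q := Real.smoothTransition ((t - a + d) / d) with hq
    have h0 : 0 ≤ q := Real.smoothTransition.nonneg _
    have h1 : q ≤ 1 := Real.smoothTransition.le_one _
    rcases le_total a t with h | h
    · nlinarith [mul_nonneg (sub_nonneg.2 h) h0]
    rcases le_total t (a - d) with h' | h'
    · have : q = 0 := Real.smoothTransition.zero_of_nonpos
        (div_nonpos_of_nonpos_of_nonneg (by linarith) hd.le)
      rw [this]; linarith
    · nlinarith

/-- A viscosity-type criterion for monotonicity. An increase would let `b` minus a strictly
increasing test function attain an interior maximum. -/
lemma antitoneOn_of_isLocalMax {b : ℝ → ℝ} {a : ℝ} (hb : ContinuousOn b (Ioi a))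
    (h : ∀ β : ℝ → ℝ, ContDiff ℝ 1 β → ∀ s > a, IsLocalMax (fun r => b r - β r) s →
      deriv β s ≤ 0) : AntitoneOn b (Ioi a) := by
  intro t ht t' ht' htt
  by_contra hlt
  push Not at hlt
  have htt' : t < t' := lt_of_le_of_ne htt fun e => by simp [e] at hlt
  set δ := b t' - b t with hδ
  have hδ0 : 0 < δ := sub_pos.2 hlt
  have hct := (hb.continuousAt (Ioi_mem_nhds ht')).eventually (lt_mem_nhds
    (show b t' - δ / 4 < b t' by linarith))
  obtain ⟨s, hs, hs1, hs2⟩ := ((hct.filter_mono (nhdsWithin_le_nhds (s := Iio t'))).and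
    ((eventually_mem_nhdsWithin).and
      (mem_nhdsWithin_of_mem_nhds (lt_mem_nhds htt')))).exists
  have hη : 0 < t' - s := sub_pos.2 hs1
  -- The exponential rate makes `β` fall from `δ / 2` at `t'` to at most `δ / 4` at `s`, while `b`
  -- loses less than `δ / 4` there. Hence `s` beats both end points and the maximum is interior.
  set A := 1 / (t' - s) with hA
  have hA0 : 0 < A := by positivity
  set β : ℝ → ℝ := fun r => δ / 2 * Real.exp (A * (r - t')) with hβ
  have hβs : β s ≤ δ / 4 := by
    have e1 : A * (s - t') = -1 := by rw [hA]; field_simp; ring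
    have e2 : Real.exp (-1) ≤ 1 / 2 := by
      rw [Real.exp_neg, one_div]
      exact inv_anti₀ two_pos (by linarith [Real.add_one_le_exp (1 : ℝ)])
    simp only [hβ]
    rw [e1]
    nlinarith
  have hβt' : β t' = δ / 2 := by simp [hβ]
  have hβ0 : 0 < β t := by positivity
  have hβc : ContDiff ℝ 1 β := by
    refine contDiff_const.mul (Real.contDiff_exp.comp
      (contDiff_const.mul (contDiff_id.sub contDiff_const)))
  have hsub : Icc t t' ⊆ Ioi a := fun r hr => lt_of_lt_of_le ht hr.1
  obtain ⟨r, hr, hmax⟩ := isCompact_Icc.exists_isMaxOn (nonempty_Icc.2 htt)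
    ((hb.mono hsub).sub hβc.continuous.continuousOn)
  have hm : b s - β s ≤ b r - β r := hmax ⟨hs2.le, le_of_lt hs1⟩
  have hrt : r ≠ t := by rintro rfl; linarith
  have hrt' : r ≠ t' := by rintro rfl; linarith
  have hloc := hmax.isLocalMax (Icc_mem_nhds (lt_of_le_of_ne hr.1 hrt.symm)
    (lt_of_le_of_ne hr.2 hrt'))
  have hd : HasDerivAt β (δ / 2 * (Real.exp (A * (r - t')) * A)) r := by
    simpa using ((((hasDerivAt_id r).sub_const t').const_mul A).exp).const_mul (δ / 2)
  have := h β hβc r (hsub hr) hloc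
  rw [hd.deriv] at this
  have : 0 < δ / 2 * (Real.exp (A * (r - t')) * A) := by positivity
  linarith

/-! ### The perturbed test function argument -/

namespace SemiconcavePotential

variable {h : ℝ → ℝ → ℝ → ℝ} {c t₀ : ℝ} {K : ℝ → ℝ} {y u : ℝ → ℝ → ℝ}

lemma exists_abs_segAvg_sub_lt (P : SemiconcavePotential h c t₀ K y u) {a b X η : ℝ} (ha : t₀ ≤ a)
    (hη : 0 < η) : ∃ d > 0, ∀ ε, |ε| < d → ∀ t ∈ Icc a b, ∀ x ∈ Icc (-X) X,
      |segAvg u ε t x - u t x| ≤ η := by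
  have hc : ContinuousOn (fun z : ℝ × ℝ => u z.1 z.2) (Icc a b ×ˢ Icc (-(X + 1)) (X + 1)) :=
    P.cont.mono (prod_mono (fun s hs => ha.trans hs.1) (subset_univ _))
  have huc := (isCompact_Icc.prod isCompact_Icc).uniformContinuousOn_of_continuous hc
  obtain ⟨d, hd, hdu⟩ := Metric.uniformContinuousOn_iff.1 huc η hη
  refine ⟨min d 1, by positivity, fun ε hε t ht x hx => ?_⟩
  refine abs_integral_unit_sub_le
    ((P.cont_slice (ha.trans ht.1)).comp (by fun_prop)).measurable fun θ hθ => ?_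
  have h1 : |ε * θ| ≤ |ε| := by
    rw [abs_mul, abs_of_nonneg hθ.1]
    exact mul_le_of_le_one_right (abs_nonneg _) hθ.2
  have h2 : |ε * θ| < min d 1 := h1.trans_lt hε
  have h3 := _root_.abs_lt.1 (h2.trans_le (min_le_right _ _))
  have := hdu (t, x + ε * θ) ⟨ht, by constructor <;> linarith [hx.1, hx.2, h3.1, h3.2]⟩ (t, x)
    ⟨ht, by constructor <;> linarith [hx.1, hx.2]⟩ (by
      rw [Prod.dist_eq, dist_self, max_eq_right dist_nonneg, Real.dist_eq, add_sub_cancel_left]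
      exact h2.trans_le (min_le_left _ _))
  exact this.le

/-- If `u + b` is a viscosity subsolution (`σ = 1`) or supersolution (`σ = -1`), where `b` depends
only on time, then `σ * b` is a viscosity subsolution of `b' = 0`. -/
lemma mul_deriv_nonpos_of_isLocalMax (P : SemiconcavePotential h c t₀ K y u) {b : ℝ → ℝ}
    {σ : ℝ} (hσ : σ * σ = 1) (hper : ∀ t > t₀, Function.Periodic (u t) 1)
    (hb : ContinuousOn b (Ioi t₀))
    (hV : ∀ φ : ℝ → ℝ → ℝ, ContDiff ℝ 1 (fun z : ℝ × ℝ => φ z.1 z.2) →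
      (∀ t, Function.Periodic (φ t) 1) → ∀ t > t₀, ∀ x : ℝ,
      IsLocalMax (fun z : ℝ × ℝ => σ * (u z.1 z.2 + b z.1 - φ z.1 z.2)) (t, x) →
        σ * (deriv (fun s => φ s x) t + h t x (c + deriv (φ t) x)) ≤ 0)
    {β : ℝ → ℝ} (hβ : ContDiff ℝ 1 β) {t₁ : ℝ} (ht₁ : t₀ < t₁)
    (hmax : IsLocalMax (fun s => σ * (b s - β s)) t₁) : σ * deriv β t₁ ≤ 0 := by
  by_contra hpos
  push Not at hpos
  -- At a continuity point of the slice the averaged flux and the flux at the averaged momentum have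
  -- the same limit.
  obtain ⟨x₀, hx₀⟩ : ∃ x₀, ContinuousAt (y t₁) x₀ := by
    have hd := (P.upperLip t₁ ht₁).countable_not_continuousAt.dense_compl ℝ
    obtain ⟨x₀, hx₀⟩ := hd.nonempty
    exact ⟨x₀, by simpa using! hx₀⟩
  -- The left side of the viscosity inequality for the test function constructed below. It tends to
  -- `σ * deriv β t₁`, assumed positive, whereas the inequality makes it nonpositive.
  set D : ℝ → ℝ → ℝ → ℝ := fun t x ε => σ * (deriv β t + σ * (2 * (t - t₁)) - segFlux h y ε t x
    + h t x (c + (σ * (2 * Real.pi * Real.sin (2 * Real.pi * (x - x₀)))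
      + (segAvg y ε t x - c)))) with hD
  have hDlim : Tendsto (fun w : ℝ × ℝ × ℝ => D w.1 w.2.1 w.2.2) (𝓝 (t₁, x₀, 0))
      (𝓝 (σ * deriv β t₁)) := by
    have l1 := P.tendsto_average_nhds P.contH ht₁ hx₀
    have l2 := P.tendsto_average_nhds (Ψ := fun _ _ p => p) (by fun_prop) ht₁ hx₀
    have l3 : Tendsto (fun w : ℝ × ℝ × ℝ => deriv β w.1 + σ * (2 * (w.1 - t₁)))
        (𝓝 (t₁, x₀, 0)) (𝓝 (deriv β t₁ + σ * (2 * (t₁ - t₁)))) := by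
      have := hβ.continuous_deriv_one
      exact Continuous.tendsto (by fun_prop) _
    have l4 : Tendsto (fun w : ℝ × ℝ × ℝ =>
        σ * (2 * Real.pi * Real.sin (2 * Real.pi * (w.2.1 - x₀))))
        (𝓝 (t₁, x₀, 0)) (𝓝 (σ * (2 * Real.pi * Real.sin (2 * Real.pi * (x₀ - x₀))))) :=
      Continuous.tendsto (by fun_prop) _
    have l5 := (P.contH.tendsto (t₁, x₀, c + (σ * (2 * Real.pi * Real.sin
      (2 * Real.pi * (x₀ - x₀))) + (y t₁ x₀ - c)))).comp
        ((continuous_fst.tendsto (t₁, x₀, (0 : ℝ))).prodMk_nhds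
          (((continuous_fst.comp continuous_snd).tendsto (t₁, x₀, (0 : ℝ))).prodMk_nhds
            ((l4.add (l2.sub_const c)).const_add c)))
    have := ((l3.sub l1).add l5).const_mul σ
    simp only [sub_self, mul_zero, Real.sin_zero, zero_add, add_zero, add_sub_cancel,
      sub_add_cancel] at this
    refine this.congr fun w => ?_
    simp only [hD, segFlux, segAvg, Function.comp_def]
  obtain ⟨ρ₀, hρ₀, hDpos⟩ := Metric.eventually_nhds_iff.1 (hDlim.eventually (lt_mem_nhds hpos))
  obtain ⟨r₀, hr₀, hr₀m⟩ := Metric.eventually_nhds_iff.1 hmax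
  -- The box of half width `r` lies where `t₁` is a maximum, and `t₁ - 2 * r > t₀` leaves room for
  -- the time cutoff.
  set r := min (r₀ / 2) ((t₁ - t₀) / 3) with hr
  have hr0 : 0 < r := lt_min (by positivity) (by linarith)
  have hrr : r < r₀ := (min_le_left _ _).trans_lt (by linarith)
  have hrt : t₀ < t₁ - 2 * r := by linarith [min_le_right (r₀ / 2) ((t₁ - t₀) / 3)]
  set ρ := min ρ₀ (min r (1 / 2)) with hρ
  have hρ0 : 0 < ρ := by positivity
  have hρρ : ρ ≤ ρ₀ := min_le_left _ _
  have hρr : ρ ≤ r := (min_le_right _ _).trans (min_le_left _ _)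
  have hρ2 : ρ ≤ 1 / 2 := (min_le_right _ _).trans (min_le_right _ _)
  obtain ⟨d, hd, hdu⟩ := P.exists_abs_segAvg_sub_lt (a := t₁ - r) (b := t₁ + r) (X := |x₀| + 1)
    (η := ρ ^ 2 / 4) (by linarith) (by positivity)
  set ε := min (d / 2) (ρ / 2) with hε
  have hε0 : 0 < ε := by positivity
  have hεd : |ε| < d := by
    rw [abs_of_pos hε0]; exact (min_le_left _ _).trans_lt (by linarith)
  have hερ : |ε| < ρ := by
    rw [abs_of_pos hε0]; exact (min_le_right _ _).trans_lt (by linarith)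
  -- Test functions must be `C¹` at all times, but segment averages are known to be so only after
  -- `t₀`. The cutoff changes nothing for times at least `t₁ - r`.
  obtain ⟨θ, hθc, hθ1, hθ2⟩ := exists_smooth_cutoff (t₁ - r) hr0
  have hθ0 : ∀ t, t₀ < θ t := fun t => by linarith [hθ2 t]
  -- The potential is replaced by its `C¹` average, and a periodic penalty forces the contact point
  -- to stay near `(t₁, x₀)`.
  set φ : ℝ → ℝ → ℝ := fun t x => β t + σ * ((t - t₁) ^ 2
    + (1 - Real.cos (2 * Real.pi * (x - x₀)))) + segAvg u ε (θ t) x with hφ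
  have hφc : ContDiff ℝ 1 (fun z : ℝ × ℝ => φ z.1 z.2) := by
    refine ContDiff.add ?_ ?_
    · refine (hβ.comp contDiff_fst).add (contDiff_const.mul (((contDiff_fst.sub
        contDiff_const).pow 2).add (contDiff_const.sub (Real.contDiff_cos.comp
          (contDiff_const.mul (contDiff_snd.sub contDiff_const))))))
    · refine contDiff_iff_contDiffAt.2 fun z => ?_
      exact (P.contDiffAt_segAvg hε0.ne' (hθ0 z.1) z.2).comp z
        (f := fun z : ℝ × ℝ => (θ z.1, z.2))
        ((hθc.comp contDiff_fst).prodMk contDiff_snd).contDiffAt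
  have hφp : ∀ t, Function.Periodic (φ t) 1 := by
    intro t x
    have e1 : 2 * Real.pi * (x + 1 - x₀) = 2 * Real.pi * (x - x₀) + 2 * Real.pi := by ring
    have e2 : segAvg u ε (θ t) (x + 1) = segAvg u ε (θ t) x := by
      simp only [segAvg]
      congr 1; funext r
      rw [show x + 1 + ε * r = x + ε * r + 1 by ring, hper (θ t) (hθ0 t)]
    simp only [hφ, e1, e2, Real.cos_add_two_pi]
  set f : ℝ × ℝ → ℝ := fun z => σ * (u z.1 z.2 + b z.1 - φ z.1 z.2) with hf
  set N : Set (ℝ × ℝ) := Icc (t₁ - r) (t₁ + r) ×ˢ Icc (x₀ - 1 / 2) (x₀ + 1 / 2) with hN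
  have hfc : ContinuousOn f N := by
    refine continuousOn_const.mul (((P.cont.mono ?_).add (hb.comp continuousOn_fst ?_)).sub
      hφc.continuous.continuousOn)
    · exact prod_mono (fun s hs => by have := hs.1; simp only [mem_Ici]; linarith) (subset_univ _)
    · intro z hz
      have := hz.1.1
      simp only [mem_Ioi]; linarith
  have hmem : (t₁, x₀) ∈ N :=
    ⟨⟨by linarith, by linarith⟩, ⟨by linarith, by linarith⟩⟩
  obtain ⟨⟨t, x⟩, hz, hzmax⟩ := (isCompact_Icc.prod isCompact_Icc).exists_isMaxOn ⟨_, hmem⟩ hfc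
  have hval : ∀ s ∈ Icc (t₁ - r) (t₁ + r), ∀ z, f (s, z) = σ * (b s - β s) - ((s - t₁) ^ 2
      + (1 - Real.cos (2 * Real.pi * (z - x₀)))) - σ * (segAvg u ε s z - u s z) := by
    intro s hs z
    simp only [hf, hφ, hθ1 s hs.1]
    linear_combination (-((s - t₁) ^ 2 + (1 - Real.cos (2 * Real.pi * (z - x₀))))) * hσ
  have hσ1 : |σ| = 1 := by
    rcases mul_self_eq_one_iff.1 hσ with rfl | rfl <;> simp
  have herr : ∀ s ∈ Icc (t₁ - r) (t₁ + r), ∀ z ∈ Icc (x₀ - 1 / 2) (x₀ + 1 / 2),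
      |σ * (segAvg u ε s z - u s z)| ≤ ρ ^ 2 / 4 := by
    intro s hs z hz
    rw [abs_mul, hσ1, one_mul]
    refine hdu ε hεd s hs z ⟨?_, ?_⟩
    · linarith [neg_abs_le x₀, hz.1]
    · linarith [le_abs_self x₀, hz.2]
  have hineq := hzmax hmem
  have hineq' : f (t₁, x₀) ≤ f (t, x) := hineq
  rw [hval t₁ hmem.1, hval t hz.1] at hineq'
  simp only [sub_self, mul_zero, Real.cos_zero, ne_eq, OfNat.ofNat_ne_zero, not_false_eq_true,
    zero_pow, add_zero, sub_zero] at hineq'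
  have hbt : σ * (b t - β t) ≤ σ * (b t₁ - β t₁) := by
    refine hr₀m ?_
    rw [Real.dist_eq]
    refine lt_of_le_of_lt (_root_.abs_le.2 ⟨?_, ?_⟩) hrr <;> linarith [hz.1.1, hz.1.2]
  have he1 := _root_.abs_le.1 (herr t₁ hmem.1 x₀ hmem.2)
  have he2 := _root_.abs_le.1 (herr t hz.1 x hz.2)
  -- Maximality compared with `(t₁, x₀)` bounds the penalty by the two averaging errors, each at
  -- most `ρ² / 4`.
  have hsmall : (t - t₁) ^ 2 + (1 - Real.cos (2 * Real.pi * (x - x₀))) ≤ ρ ^ 2 / 2 := by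
    linarith [he1.1, he1.2, he2.1, he2.2]
  have hcos0 : Real.cos (2 * Real.pi * (x - x₀)) ≤ 1 := Real.cos_le_one _
  have ht : |t - t₁| < ρ := by
    refine abs_lt_of_sq_lt_sq ?_ hρ0.le
    nlinarith
  have hx : |x - x₀| < ρ := by
    have hx2 : |x - x₀| ≤ 1 / 2 := _root_.abs_le.2 ⟨by linarith [hz.2.1], by linarith [hz.2.2]⟩
    -- On half a period this gives `1 - cos (2π z) ≥ 8 z²`, so the cosine penalty controls the
    -- distance to `x₀`.
    have hq := Real.cos_le_one_sub_mul_cos_sq (x := 2 * Real.pi * (x - x₀)) ?_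
    · refine abs_lt_of_sq_lt_sq ?_ hρ0.le
      have e : 2 / Real.pi ^ 2 * (2 * Real.pi * (x - x₀)) ^ 2 = 8 * (x - x₀) ^ 2 := by
        field_simp
        ring
      rw [e] at hq
      nlinarith [sq_nonneg (t - t₁), sq_nonneg (x - x₀)]
    · rw [abs_mul, abs_of_pos Real.two_pi_pos]
      nlinarith [Real.pi_pos]
  have hNn : N ∈ 𝓝 (t, x) := by
    have h1 := _root_.abs_lt.1 ht
    have h2 := _root_.abs_lt.1 hx
    exact prod_mem_nhds (Icc_mem_nhds (by linarith [h1.1]) (by linarith [h1.2]))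
      (Icc_mem_nhds (by linarith [h2.1]) (by linarith [h2.2]))
  have htt : t₁ - r < t := by linarith [(_root_.abs_lt.1 ht).1]
  have htt0 : t₀ < t := by linarith
  have hle := hV φ hφc hφp t htt0 x (hzmax.isLocalMax hNn)
  have hd1 : HasDerivAt (fun s => φ s x) (deriv β t + σ * (2 * (t - t₁))
      + -segFlux h y ε t x) t := by
    have e1 := (((hasDerivAt_id t).sub_const t₁).pow 2).add_const
      (1 - Real.cos (2 * Real.pi * (x - x₀)))
    have e2 : HasDerivAt (fun s => segAvg u ε (θ s) x) (-segFlux h y ε t x) t := by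
      refine (P.hasDerivAt_segAvg_left hε0.ne' htt0 x).congr_of_eventuallyEq ?_
      filter_upwards [lt_mem_nhds htt] with s hs
      rw [hθ1 s (le_of_lt hs)]
    have := (((hβ.differentiable one_ne_zero t).hasDerivAt).add (e1.const_mul σ)).add e2
    simpa using! this
  have hd2 : HasDerivAt (φ t) (σ * (2 * Real.pi * Real.sin (2 * Real.pi * (x - x₀)))
      + (segAvg y ε t x - c)) x := by
    have e1 : HasDerivAt (fun z => (t - t₁) ^ 2 + (1 - Real.cos (2 * Real.pi * (z - x₀))))
        (2 * Real.pi * Real.sin (2 * Real.pi * (x - x₀))) x := by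
      have := ((((hasDerivAt_id x).sub_const x₀).const_mul (2 * Real.pi)).cos.const_sub
        1).const_add ((t - t₁) ^ 2)
      refine this.congr_deriv ?_
      simp only [id_eq]
      ring
    have e2 : HasDerivAt (segAvg u ε (θ t)) (segAvg y ε t x - c) x := by
      rw [hθ1 t htt.le]
      exact P.hasDerivAt_segAvg_right hε0.ne' htt0 x
    exact ((e1.const_mul σ).const_add (β t)).add e2
  rw [hd1.deriv, hd2.deriv] at hle
  have hDp := hDpos (y := (t, x, ε)) (by
    rw [Prod.dist_eq, Prod.dist_eq, max_lt_iff, max_lt_iff, Real.dist_eq, Real.dist_eq,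
      Real.dist_eq, sub_zero]
    exact ⟨ht.trans_le hρρ, hx.trans_le hρρ, hερ.trans_le hρρ⟩)
  simp only [hD] at hDp
  rw [← sub_eq_add_neg] at hle
  linarith

end SemiconcavePotential

lemma isOpenMap_prodMap_coe : IsOpenMap (fun z : ℝ × ℝ => (z.1, (z.2 : Circ))) :=
  IsOpenMap.id.prodMap QuotientAddGroup.isOpenMap_coe

lemma continuous_prodMap_coe : Continuous (fun z : ℝ × ℝ => (z.1, (z.2 : Circ))) :=
  continuous_fst.prodMk ((AddCircle.continuous_mk' 1).comp continuous_snd)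

lemma eventually_of_eventually_lift {p : ℝ × Circ → Prop} {t x : ℝ}
    (h : ∀ᶠ z : ℝ × ℝ in 𝓝 (t, x), p (z.1, (z.2 : Circ))) : ∀ᶠ z in 𝓝 (t, (x : Circ)), p z :=
  isOpenMap_prodMap_coe.nhds_le (t, x) h

/-! ### Comparison of a viscosity solution with the potential -/

namespace IsViscositySolution

variable {H : ℝ → Circ → ℝ → ℝ} {t₀ c : ℝ} {v : ℝ → Circ → ℝ}

lemma lift_sub (hv : IsViscositySolution H c t₀ v) {φ : ℝ → ℝ → ℝ}
    (hφ : ContDiff ℝ 1 (fun z : ℝ × ℝ => φ z.1 z.2)) (hp : ∀ t, Function.Periodic (φ t) 1)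
    {t : ℝ} (ht : t₀ < t) {x : ℝ}
    (hmax : IsLocalMax (fun z : ℝ × ℝ => v z.1 (z.2 : Circ) - φ z.1 z.2) (t, x)) :
    deriv (fun s => φ s x) t + H t x (c + deriv (φ t) x) ≤ 0 := by
  have := hv.sub (fun t => ((hp t).lift : Circ → ℝ)) hφ t ht x (eventually_of_eventually_lift hmax)
  rw [circDeriv_lift_coe] at this
  exact this

lemma lift_super (hv : IsViscositySolution H c t₀ v) {φ : ℝ → ℝ → ℝ}
    (hφ : ContDiff ℝ 1 (fun z : ℝ × ℝ => φ z.1 z.2)) (hp : ∀ t, Function.Periodic (φ t) 1)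
    {t : ℝ} (ht : t₀ < t) {x : ℝ}
    (hmin : IsLocalMin (fun z : ℝ × ℝ => v z.1 (z.2 : Circ) - φ z.1 z.2) (t, x)) :
    0 ≤ deriv (fun s => φ s x) t + H t x (c + deriv (φ t) x) := by
  have := hv.super (fun t => ((hp t).lift : Circ → ℝ)) hφ t ht x
    (eventually_of_eventually_lift hmin)
  rw [circDeriv_lift_coe] at this
  exact this

lemma continuousOn_lift (hv : IsViscositySolution H c t₀ v) :
    ContinuousOn (fun z : ℝ × ℝ => v z.1 (z.2 : Circ)) (Ici t₀ ×ˢ univ) :=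
  hv.continuousOn.comp continuous_prodMap_coe.continuousOn fun _ hz => ⟨hz.1, mem_univ _⟩

/-- A viscosity solution with space derivative `y - c` differs from the potential of `y` by a
constant. -/
lemma exists_eq_add_const {y : ℝ → Circ → ℝ} {U : ℝ → ℝ → ℝ} {K : ℝ → ℝ}
    (hv : IsViscositySolution H c t₀ v) (hpot : IsPotential c t₀ y v)
    (P : SemiconcavePotential (fun s x p => H s (x : Circ) p) c t₀ K (fun t x => y t (x : Circ)) U)
    (hper : ∀ t > t₀, Function.Periodic (U t) 1) :
    ∃ b : ℝ, ∀ t ≥ t₀, ∀ x : ℝ, v t (x : Circ) = U t x + b := by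
  -- Both functions have the same space derivative at each time, so their difference depends on time
  -- only.
  set b : ℝ → ℝ := fun t => v t ((0 : ℝ) : Circ) - U t 0 with hb
  have hvb : ∀ t ≥ t₀, ∀ x : ℝ, v t (x : Circ) = U t x + b t := by
    intro t ht x
    have h1 := hpot t ht ((0 : ℝ) : Circ) x
    have h2 := P.pot t ht 0 x
    simp only [← AddCircle.coe_add, zero_add] at h1
    rw [← h2] at h1
    simp only [hb]
    linarith
  have hline : ContinuousOn (fun t : ℝ => (t, (0 : ℝ))) (Ici t₀) :=
    (continuous_id.prodMk continuous_const).continuousOn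
  have hbc : ContinuousOn b (Ici t₀) :=
    (hv.continuousOn_lift.comp hline fun t ht => ⟨ht, mem_univ _⟩).sub
      (P.cont.comp hline fun t ht => ⟨ht, mem_univ _⟩)
  have hbc' := hbc.mono Ioi_subset_Ici_self
  have hcong : ∀ {φ : ℝ → ℝ → ℝ} {t : ℝ}, t₀ < t → ∀ x : ℝ,
      (fun z : ℝ × ℝ => U z.1 z.2 + b z.1 - φ z.1 z.2) =ᶠ[𝓝 (t, x)]
        fun z => v z.1 (z.2 : Circ) - φ z.1 z.2 := by
    intro φ t ht x
    filter_upwards [(continuous_fst.tendsto (t, x)).eventually (lt_mem_nhds ht)] with z hz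
    rw [hvb z.1 (le_of_lt hz)]
  have hanti : AntitoneOn b (Ioi t₀) := by
    refine antitoneOn_of_isLocalMax hbc' fun β hβ s hs hmax => ?_
    have := P.mul_deriv_nonpos_of_isLocalMax (σ := 1) (one_mul 1) hper hbc' ?_ hβ hs
      (by simpa using hmax)
    · simpa using this
    · intro φ hφ hp t ht x hm
      simp only [one_mul] at hm ⊢
      exact hv.lift_sub hφ hp ht (hm.congr (hcong ht x))
  have hanti' : AntitoneOn (fun t => -b t) (Ioi t₀) := by
    refine antitoneOn_of_isLocalMax hbc'.neg fun β hβ s hs hmax => ?_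
    have := P.mul_deriv_nonpos_of_isLocalMax (σ := -1) (by norm_num) hper hbc' ?_ (β := -β) hβ.neg
      hs (by
        refine hmax.congr (Eventually.of_forall fun r => ?_)
        simp only [Pi.neg_apply]; ring)
    · simpa [deriv.neg'] using this
    · intro φ hφ hp t ht x hm
      have hm' : IsLocalMin (fun z : ℝ × ℝ => U z.1 z.2 + b z.1 - φ z.1 z.2) (t, x) := by
        have := hm.neg
        refine this.congr (Eventually.of_forall fun r => ?_)
        simp
      have := hv.lift_super hφ hp ht (hm'.congr (hcong ht x))
      linarith
  have hconst : ∀ t > t₀, b t = b (t₀ + 1) := by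
    intro t ht
    have h1 : t₀ + 1 ∈ Ioi t₀ := by simp
    rcases le_total t (t₀ + 1) with h | h
    · exact le_antisymm (neg_le_neg_iff.1 (hanti' ht h1 h)) (hanti ht h1 h)
    · exact le_antisymm (hanti h1 ht h) (neg_le_neg_iff.1 (hanti' h1 ht h))
  refine ⟨b (t₀ + 1), fun t ht x => ?_⟩
  rw [hvb t ht]
  -- Test functions see only times after `t₀`. Continuity of `b` gives the initial time.
  rcases eq_or_lt_of_le ht with rfl | h
  · congr 1
    have h1 : Tendsto b (𝓝[>] t₀) (𝓝 (b t₀)) :=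
      (hbc t₀ self_mem_Ici).mono_left (nhdsWithin_mono _ Ioi_subset_Ici_self)
    refine tendsto_nhds_unique h1 (tendsto_const_nhds.congr' ?_)
    filter_upwards [self_mem_nhdsWithin] with s hs using (hconst s hs).symm
  · rw [hconst t h]

theorem semiconcavePotential {y : ℝ → Circ → ℝ} (hy : IsEntropySolution H t₀ y)
    (hH : Continuous (fun z : ℝ × ℝ × ℝ => H z.1 (z.2.1 : Circ) z.2.2))
    (hv : IsViscositySolution H (∫ x, y t₀ x) t₀ v) (hpot : IsPotential (∫ x, y t₀ x) t₀ y v) :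
    ∃ K : ℝ → ℝ, SemiconcavePotential (fun s x p => H s (x : Circ) p) (∫ x, y t₀ x) t₀ K
      (fun t x => y t (x : Circ)) (fun t x => v t (x : Circ)) := by
  obtain ⟨K, P⟩ := hy.semiconcavePotential hH
  obtain ⟨b, hb⟩ := hv.exists_eq_add_const hpot P fun t ht => hy.periodic_potential (le_of_lt ht)
  refine ⟨K, P.contH, P.upperLip, P.anti, P.pos, P.bdd, hv.continuousOn_lift, ?_, ?_⟩
  · intro t ht x x'
    rw [hb t ht, hb t ht, ← P.pot t ht x x']
    ring
  · intro t t' ht ht' x ε hε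
    rw [← P.eqn t t' ht ht' x ε hε]
    congr 1; funext θ
    rw [hb t (le_of_lt ht), hb t' (le_of_lt ht')]
    ring

end IsViscositySolution

end Burgers

namespace Burgers

/-! ### Lifting trajectories and graphs from the circle to the line -/

/-- The lift of a Hamiltonian to the universal cover of the circle. -/
def liftHam (H : ℝ → Circ → ℝ → ℝ) (s x p : ℝ) : ℝ := H s (x : Circ) p

section Traj

variable {H : ℝ → Circ → ℝ → ℝ}

lemma isTrajectory_iff {I : Set ℝ} {γ : ℝ → Circ × ℝ} :
    IsTrajectory H I γ ↔ ∃ ξ : ℝ → ℝ, (∀ s ∈ I, (γ s).1 = (ξ s : Circ)) ∧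
      IsLiftTraj (liftHam H) I ξ (fun s => (γ s).2) := by
  refine exists_congr fun ξ => and_congr_right fun h => forall₂_congr fun s hs => ?_
  rw [h s hs, circDeriv_coe]
  rfl

lemma IsLiftTraj.isTrajectory {I : Set ℝ} {ξ p : ℝ → ℝ} (T : IsLiftTraj (liftHam H) I ξ p) :
    IsTrajectory H I (fun s => ((ξ s : Circ), p s)) :=
  isTrajectory_iff.2 ⟨ξ, fun _ _ => rfl, T⟩

lemma IsLiftTraj.congr_snd {h : ℝ → ℝ → ℝ → ℝ} {I : Set ℝ} {ξ p q : ℝ → ℝ}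
    (T : IsLiftTraj h I ξ p) (hq : ∀ s ∈ I, q s = p s) : IsLiftTraj h I ξ q := fun s hs => by
  rw [hq s hs]
  exact ⟨(T s hs).1, (T s hs).2.congr hq (hq s hs)⟩

lemma liftHam_add_intCast (s x p : ℝ) (k : ℤ) : liftHam H s (x + k) p = liftHam H s x p := by
  have : ((x + k : ℝ) : Circ) = (x : Circ) := by
    rw [QuotientAddGroup.eq]
    exact AddSubgroup.mem_zmultiples_iff.2 ⟨-k, by simp⟩
  rw [liftHam, this, liftHam]

lemma IsLiftTraj.add_intCast {I : Set ℝ} {ξ p : ℝ → ℝ} (T : IsLiftTraj (liftHam H) I ξ p) (k : ℤ) :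
    IsLiftTraj (liftHam H) I (fun s => ξ s + k) p := by
  intro s hs
  have e1 : dP (liftHam H) s (ξ s + k) (p s) = dP (liftHam H) s (ξ s) (p s) := by
    have : liftHam H s (ξ s + k) = liftHam H s (ξ s) := funext fun q => liftHam_add_intCast _ _ _ _
    simp only [dP, this]
  have e2 : dX (liftHam H) s (ξ s + k) (p s) = dX (liftHam H) s (ξ s) (p s) := by
    have := deriv_comp_add_const (fun z => liftHam H s z (p s)) (k : ℝ) (ξ s)
    simp only [dX]
    rw [← this]
    simp only [liftHam_add_intCast]
  rw [e1, e2]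
  exact ⟨(T s hs).1.add_const _, (T s hs).2⟩

lemma exists_intCast_of_coe_eq {x z : ℝ} (h : (x : Circ) = (z : Circ)) : ∃ k : ℤ, z = x + k := by
  obtain ⟨k, hk⟩ := AddSubgroup.mem_zmultiples_iff.1 (QuotientAddGroup.eq.1 h)
  refine ⟨k, ?_⟩
  simp only [zsmul_eq_mul, mul_one] at hk
  linarith

namespace IsTonelliHamiltonian

lemma smooth (hH : IsTonelliHamiltonian H) : Smooth 2 (liftHam H) := hH.contDiff

lemma smooth_one (hH : IsTonelliHamiltonian H) : Smooth 1 (liftHam H) :=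
  ContDiff.of_le hH.smooth (by norm_num)

lemma dP_dP_pos (hH : IsTonelliHamiltonian H) (s x p : ℝ) : 0 < dP (dP (liftHam H)) s x p := by
  have := hH.deriv2_pos s x p
  rwa [iteratedDeriv_succ, iteratedDeriv_one] at this

lemma convexOn_lift (hH : IsTonelliHamiltonian H) (s x : ℝ) :
    ConvexOn ℝ univ (liftHam H s x) := hH.convex s x

lemma strictMono_dP (hH : IsTonelliHamiltonian H) (s x : ℝ) : StrictMono (dP (liftHam H) s x) :=
  strictMono_of_deriv_pos fun p => hH.dP_dP_pos s x p

lemma surjective_dP (hH : IsTonelliHamiltonian H) (s x : ℝ) :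
    Function.Surjective (dP (liftHam H) s x) :=
  surjective_deriv_of_superlinear (fun p => hH.smooth_one.hasDerivAt_dP s x p) (hH.superlinear s x)

lemma exists_isLiftTraj (hH : IsTonelliHamiltonian H) (t : ℝ) (z : ℝ × ℝ) :
    ∃ ξ p : ℝ → ℝ, IsLiftTraj (liftHam H) univ ξ p ∧ ξ t = z.1 ∧ p t = z.2 := by
  obtain ⟨γ, hγ, hγt⟩ := hH.complete t ((z.1 : Circ), z.2)
  obtain ⟨ξ, hξ, T⟩ := isTrajectory_iff.1 hγ
  have h1 := hξ t (mem_univ t)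
  rw [hγt] at h1
  obtain ⟨k, hk⟩ := exists_intCast_of_coe_eq h1.symm
  exact ⟨_, _, T.add_intCast k, hk.symm, by simp [hγt]⟩

/-- `flow` follows a trajectory picked by choice. Uniqueness for the differential equation, after a
shift of the lift by an integer, identifies it with the given one. -/
lemma flow_eq (hH : IsTonelliHamiltonian H) {s t : ℝ} (hst : s ≤ t) {ξ p : ℝ → ℝ}
    (T : IsLiftTraj (liftHam H) (Icc s t) ξ p) :
    flow hH s t ((ξ s : Circ), p s) = ((ξ t : Circ), p t) := by
  obtain ⟨h1, h2⟩ := (hH.complete s ((ξ s : Circ), p s)).choose_spec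
  rw [flow]
  set γ := (hH.complete s ((ξ s : Circ), p s)).choose
  obtain ⟨ξ', hξ', T'⟩ := isTrajectory_iff.1 h1
  have h3 := hξ' s (mem_univ s)
  rw [h2] at h3
  obtain ⟨k, hk⟩ := exists_intCast_of_coe_eq h3
  have := hH.smooth.eq_of_eq_left (T.add_intCast k) (T'.mono (subset_univ _)) hk.symm
    (by simp [h2]) t ⟨hst, le_rfl⟩
  have h4 := hξ' t (mem_univ t)
  rw [← this.1] at h4
  refine Prod.ext ?_ this.2.symm
  rw [h4, QuotientAddGroup.eq]
  exact AddSubgroup.mem_zmultiples_iff.2 ⟨-k, by simp⟩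

end IsTonelliHamiltonian

/-- Two trajectories with the same end point coincide. -/
lemma IsTrajectory.eqOn_of_eq_right (hH : IsTonelliHamiltonian H) {a b : ℝ} {γ γ' : ℝ → Circ × ℝ}
    (hγ : IsTrajectory H (Icc a b) γ) (hγ' : IsTrajectory H (Icc a b) γ') (h : γ b = γ' b) :
    EqOn γ γ' (Icc a b) := by
  intro s hs
  have hb : b ∈ Icc a b := ⟨hs.1.trans hs.2, le_rfl⟩
  obtain ⟨ξ, hξ, T⟩ := isTrajectory_iff.1 hγ
  obtain ⟨ξ', hξ', T'⟩ := isTrajectory_iff.1 hγ'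
  have h1 := hξ b hb
  rw [h, hξ' b hb] at h1
  obtain ⟨k, hk⟩ := exists_intCast_of_coe_eq h1
  have := hH.smooth.eq_of_eq_right T (T'.add_intCast k) hk (by simp only [h]) s hs
  refine Prod.ext ?_ this.2
  rw [hξ s hs, hξ' s hs, this.1, QuotientAddGroup.eq]
  exact AddSubgroup.mem_zmultiples_iff.2 ⟨-k, by simp⟩

lemma IsTrajectory.mono {I J : Set ℝ} {γ : ℝ → Circ × ℝ} (hγ : IsTrajectory H J γ) (h : I ⊆ J) :
    IsTrajectory H I γ := by
  obtain ⟨ξ, hξ, T⟩ := isTrajectory_iff.1 hγ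
  exact isTrajectory_iff.2 ⟨ξ, fun s hs => hξ s (h hs), T.mono h⟩

end Traj

/-! ### Graphs of one-sided limits, on the circle and on the line -/

section Graph

variable {f : Circ → ℝ}

lemma continuousAt_coe_iff {x : ℝ} :
    ContinuousAt f (x : Circ) ↔ ContinuousAt (fun z : ℝ => f z) x := by
  rw [ContinuousAt, QuotientAddGroup.nhds_eq, tendsto_map'_iff]
  rfl

lemma tendsto_add_coe_nhdsGT_iff {x q : ℝ} :
    Tendsto (fun h : ℝ => f ((x : Circ) + (h : Circ))) (𝓝[>] 0) (𝓝 q)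
      ↔ Tendsto (fun z : ℝ => f z) (𝓝[>] x) (𝓝 q) := by
  have e : 𝓝[>] x = map (fun h => x + h) (𝓝[>] 0) := by simp
  rw [e, tendsto_map'_iff]
  rfl

lemma tendsto_add_coe_nhdsLT_iff {x q : ℝ} :
    Tendsto (fun h : ℝ => f ((x : Circ) + (h : Circ))) (𝓝[<] 0) (𝓝 q)
      ↔ Tendsto (fun z : ℝ => f z) (𝓝[<] x) (𝓝 q) := by
  have e : 𝓝[<] x = map (fun h => x + h) (𝓝[<] 0) := by simp
  rw [e, tendsto_map'_iff]
  rfl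

lemma mem_graph_of_continuousAt {x q : ℝ} (h : ContinuousAt f (x : Circ)) (hq : f x = q) :
    ((x : Circ), q) ∈ graph f := by
  rw [continuousAt_coe_iff] at h
  subst hq
  exact ⟨tendsto_add_coe_nhdsGT_iff.2 (h.tendsto.mono_left nhdsWithin_le_nhds),
    tendsto_add_coe_nhdsLT_iff.2 (h.tendsto.mono_left nhdsWithin_le_nhds)⟩

/-- `graph` looks only at the two side limits and ignores the value at the point. Since the value
lies between them, it is forced when they agree. -/
lemma UpperLip.preimage_graph {K : ℝ} (hf : UpperLip K (fun x : ℝ => f x)) :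
    (fun z : ℝ × ℝ => ((z.1 : Circ), z.2)) ⁻¹' graph f
      = SemiconcavePotential.contGraph (fun x : ℝ => f x) := by
  ext ⟨x, q⟩
  constructor
  · rintro ⟨h1, h2⟩
    have h1' := tendsto_add_coe_nhdsGT_iff.1 h1
    have h2' := tendsto_add_coe_nhdsLT_iff.1 h2
    obtain ⟨q₁, hq₁, hle₁⟩ := hf.exists_tendsto_right x
    obtain ⟨q₂, hq₂, hle₂⟩ := hf.exists_tendsto_left x
    have e1 := tendsto_nhds_unique h1' hq₁
    have e2 := tendsto_nhds_unique h2' hq₂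
    have e : f x = q := le_antisymm (by simp only at e2 hle₂; rw [e2]; exact hle₂)
      (by simp only at e1 hle₁; rw [e1]; exact hle₁)
    refine ⟨?_, e⟩
    refine continuousAt_iff_continuous_left'_right'.2 ⟨?_, ?_⟩
    · rw [ContinuousWithinAt]; simp only; rw [e]; exact h2'
    · rw [ContinuousWithinAt]; simp only; rw [e]; exact h1'
  · rintro ⟨h1, h2⟩
    exact mem_graph_of_continuousAt (continuousAt_coe_iff.2 h1) h2

/-- The covering map is open and continuous, so closure commutes with preimage. -/
lemma UpperLip.mem_closure_graph_iff {K : ℝ} (hf : UpperLip K (fun x : ℝ => f x)) {x q : ℝ} :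
    ((x : Circ), q) ∈ closure (graph f)
      ↔ (x, q) ∈ closure (SemiconcavePotential.contGraph (fun x : ℝ => f x)) := by
  have ho : IsOpenMap (fun z : ℝ × ℝ => ((z.1 : Circ), z.2)) :=
    QuotientAddGroup.isOpenMap_coe.prodMap IsOpenMap.id
  have hc : Continuous (fun z : ℝ × ℝ => ((z.1 : Circ), z.2)) :=
    ((AddCircle.continuous_mk' 1).comp continuous_fst).prodMk continuous_snd
  rw [← hf.preimage_graph, ← ho.preimage_closure_eq_closure_preimage hc]
  rfl

/-- At the initial time there is no Oleinik bound. A continuous plus a decreasing function has side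
limits ordered in the same way, which is all that the continuity argument uses. -/
lemma classE.exists_tendsto (hf : f ∈ classE) (x : ℝ) :
    ∃ q₁ q₂, Tendsto (fun z : ℝ => f z) (𝓝[>] x) (𝓝 q₁) ∧
      Tendsto (fun z : ℝ => f z) (𝓝[<] x) (𝓝 q₂) ∧ q₁ ≤ f x ∧ f x ≤ q₂ := by
  obtain ⟨ε, hε, g, d, hg, hd, hfe⟩ := hf x
  have h0 : (0 : ℝ) ∈ Ioo (-ε) ε := ⟨by linarith, hε⟩
  have hgc : ContinuousAt g 0 := hg.continuousAt (Ioo_mem_nhds h0.1 h0.2)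
  have hfx : f x = g 0 + d 0 := by simpa using hfe 0 h0
  have hmono : MonotoneOn (fun z => -d z) (Ioo (-ε) ε) := hd.neg
  have hR : ∀ z ∈ Ioo 0 ε, -d 0 ≤ -d z := fun z hz =>
    hmono h0 ⟨by linarith [hz.1], hz.2⟩ hz.1.le
  have hL : ∀ z ∈ Ioo (-ε) 0, -d z ≤ -d 0 := fun z hz =>
    hmono ⟨hz.1, by linarith [hz.2]⟩ h0 hz.2.le
  have hneR : ((fun z => -d z) '' Ioo 0 ε).Nonempty := (nonempty_Ioo.2 hε).image _
  have hneL : ((fun z => -d z) '' Ioo (-ε) 0).Nonempty :=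
    (nonempty_Ioo.2 (by linarith)).image _
  have tR := MonotoneOn.tendsto_nhdsWithin_Ioo_right (f := fun z => -d z) (nonempty_Ioo.2 hε)
    (hmono.mono (Ioo_subset_Ioo_left (by linarith)))
    ⟨-d 0, by rintro _ ⟨z, hz, rfl⟩; exact hR z hz⟩
  have tL := MonotoneOn.tendsto_nhdsWithin_Ioo_left (f := fun z => -d z)
    (nonempty_Ioo.2 (by linarith : -ε < 0))
    (hmono.mono (Ioo_subset_Ioo_right (by linarith)))
    ⟨-d 0, by rintro _ ⟨z, hz, rfl⟩; exact hL z hz⟩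
  have bR : -d 0 ≤ sInf ((fun z => -d z) '' Ioo 0 ε) :=
    le_csInf hneR (by rintro _ ⟨z, hz, rfl⟩; exact hR z hz)
  have bL : sSup ((fun z => -d z) '' Ioo (-ε) 0) ≤ -d 0 :=
    csSup_le hneL (by rintro _ ⟨z, hz, rfl⟩; exact hL z hz)
  refine ⟨g 0 - sInf ((fun z => -d z) '' Ioo 0 ε), g 0 - sSup ((fun z => -d z) '' Ioo (-ε) 0),
    tendsto_add_coe_nhdsGT_iff.1 ?_, tendsto_add_coe_nhdsLT_iff.1 ?_, ?_, ?_⟩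
  · refine ((hgc.tendsto.mono_left nhdsWithin_le_nhds).sub tR).congr' ?_
    filter_upwards [mem_nhdsWithin_of_mem_nhds (Ioo_mem_nhds h0.1 h0.2)] with z hz
    rw [hfe z hz, sub_neg_eq_add]
  · refine ((hgc.tendsto.mono_left nhdsWithin_le_nhds).sub tL).congr' ?_
    filter_upwards [mem_nhdsWithin_of_mem_nhds (Ioo_mem_nhds h0.1 h0.2)] with z hz
    rw [hfe z hz, sub_neg_eq_add]
  · linarith
  · linarith

end Graph

end Burgers

namespace Burgers

/-! ### Characteristics of entropy solutions -/

variable {H : ℝ → Circ → ℝ → ℝ} {t₀ c : ℝ} {K : ℝ → ℝ} {y : ℝ → Circ → ℝ} {U : ℝ → ℝ → ℝ}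

section Potential

/-- A trajectory which ends in the closure of the graph of `y t` is calibrated. -/
lemma SemiconcavePotential.calibrated_of_mem_closure_graph
    (P : SemiconcavePotential (liftHam H) c t₀ K (fun t x => y t (x : Circ)) U)
    (hH : IsTonelliHamiltonian H) {a b : ℝ} (ha : t₀ < a) (hab : a ≤ b) {ξ p : ℝ → ℝ}
    (T : IsLiftTraj (liftHam H) (Icc a b) ξ p)
    (hz : ((ξ b : Circ), p b) ∈ closure (graph (y b))) :
    ∀ s ∈ Icc a b, U b (ξ b) - U s (ξ s) = action (liftHam H) c ξ p s b := by
  refine P.calibrated_of_mem_closure hH.smooth hH.dP_dP_pos hH.convexOn_lift ha hab ?_ T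
    ((P.upperLip b (ha.trans_le hab)).mem_closure_graph_iff.1 hz)
  intro z
  obtain ⟨ξ, p, T, h⟩ := hH.exists_isLiftTraj b z
  exact ⟨ξ, p, T.mono (subset_univ _), h⟩

lemma SemiconcavePotential.continuousAt_of_mem_closure_graph
    (P : SemiconcavePotential (liftHam H) c t₀ K (fun t x => y t (x : Circ)) U)
    (hH : IsTonelliHamiltonian H) {a b : ℝ} (ha : t₀ < a) (hab : a < b) {ξ p : ℝ → ℝ}
    (T : IsLiftTraj (liftHam H) (Icc a b) ξ p)
    (hz : ((ξ b : Circ), p b) ∈ closure (graph (y b))) :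
    ContinuousAt (y a) (ξ a : Circ) ∧ y a (ξ a : Circ) = p a := by
  have := P.continuousAt_of_calibrated hH.smooth hH.dP_dP_pos hH.convexOn_lift ha hab T
    (P.calibrated_of_mem_closure_graph hH ha hab.le T hz a ⟨le_rfl, hab.le⟩)
  exact ⟨continuousAt_coe_iff.2 this.1, this.2⟩

/-- Calibration on `[s, b]` is known for `s > t₀` and passes to `s = t₀` by continuity of the
potential and of the action. The lower parabola then applies at the initial time. -/
lemma SemiconcavePotential.continuousAt_initial_of_mem_closure_graph
    (P : SemiconcavePotential (liftHam H) c t₀ K (fun t x => y t (x : Circ)) U)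
    (hH : IsTonelliHamiltonian H) (hy : IsEntropySolution H t₀ y) (hE : y t₀ ∈ classE)
    {b : ℝ} (hb : t₀ < b) {ξ p : ℝ → ℝ} (T : IsLiftTraj (liftHam H) (Icc t₀ b) ξ p)
    (hz : ((ξ b : Circ), p b) ∈ closure (graph (y b))) :
    ContinuousAt (y t₀) (ξ t₀ : Circ) ∧ y t₀ (ξ t₀ : Circ) = p t₀ := by
  have h1 : ∀ s ∈ Ioc t₀ b, U b (ξ b) - U s (ξ s) = action (liftHam H) c ξ p s b := fun s hs =>
    P.calibrated_of_mem_closure_graph hH hs.1 hs.2 (T.mono (Icc_subset_Icc_left hs.1.le)) hz s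
      ⟨le_rfl, hs.2⟩
  have hmem : t₀ ∈ Icc t₀ b := ⟨le_rfl, hb.le⟩
  have hle : 𝓝[Ioc t₀ b] t₀ ≤ 𝓝[Icc t₀ b] t₀ := nhdsWithin_mono _ Ioc_subset_Icc_self
  have c1 : Tendsto (fun s => U b (ξ b) - U s (ξ s)) (𝓝[Ioc t₀ b] t₀)
      (𝓝 (U b (ξ b) - U t₀ (ξ t₀))) :=
    tendsto_const_nhds.sub ((P.continuousOn_along le_rfl T.continuousOn_fst t₀ hmem).mono_left hle)
  have c2 : Tendsto (fun s => action (liftHam H) c ξ p s b) (𝓝[Ioc t₀ b] t₀)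
      (𝓝 (action (liftHam H) c ξ p t₀ b)) :=
    (continuousOn_action_left T hH.smooth_one c hb.le t₀ hmem).mono_left hle
  have hne : (𝓝[Ioc t₀ b] t₀).NeBot := by
    rw [nhdsWithin_Ioc_eq_nhdsGT hb]; infer_instance
  have hcal : U b (ξ b) - U t₀ (ξ t₀) = action (liftHam H) c ξ p t₀ b :=
    tendsto_nhds_unique_of_eventuallyEq c1 c2
      (by filter_upwards [self_mem_nhdsWithin] with s hs using h1 s hs)
  obtain ⟨q₁, q₂, l1, l2, b1, b2⟩ := classE.exists_tendsto hE (ξ t₀)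
  have := P.continuousAt_of_calibrated_of_tendsto hH.smooth hH.dP_dP_pos hH.convexOn_lift le_rfl hb
    T hcal l1 l2 b1 b2 (fun x x' => hy.intervalIntegrable le_rfl x x')
  exact ⟨continuousAt_coe_iff.2 this.1, this.2⟩

end Potential

namespace IsEntropySolution

lemma exists_potential (hy : IsEntropySolution H t₀ y) (hH : IsTonelliHamiltonian H) :
    ∃ (K : ℝ → ℝ) (U : ℝ → ℝ → ℝ), SemiconcavePotential (liftHam H) (∫ x, y t₀ x) t₀ K
      (fun t x => y t (x : Circ)) U := by
  obtain ⟨K, P⟩ := hy.semiconcavePotential hH.contDiff.continuous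
  exact ⟨K, _, P⟩

/-- The closed graph is preserved by the backward flow: calibration even puts the trajectory on the
graph at earlier times. -/
lemma mem_closure_graph_of_mem (hy : IsEntropySolution H t₀ y) (hH : IsTonelliHamiltonian H)
    {a b : ℝ} (ha : t₀ < a) (hab : a ≤ b) {ξ p : ℝ → ℝ}
    (T : IsLiftTraj (liftHam H) (Icc a b) ξ p)
    (hz : ((ξ b : Circ), p b) ∈ closure (graph (y b))) :
    ((ξ a : Circ), p a) ∈ closure (graph (y a)) := by
  obtain ⟨K, U, P⟩ := hy.exists_potential hH
  rcases eq_or_lt_of_le hab with rfl | h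
  · exact hz
  · have := P.continuousAt_of_mem_closure_graph hH ha h T hz
    exact subset_closure (mem_graph_of_continuousAt this.1 this.2)

/-- Completeness of the flow supplies the trajectory through `z`, and backward invariance makes it a
characteristic. Uniqueness is that of the differential equation on each `[s, t]`. -/
theorem exists_unique_characteristic (hy : IsEntropySolution H t₀ y)
    (hH : IsTonelliHamiltonian H) {t : ℝ} {z : Circ × ℝ}
    (hz : z ∈ closure (graph (y t))) :
    ∃ γ : ℝ → Circ × ℝ, (IsCharacteristic H y (Ioc t₀ t) γ ∧ γ t = z) ∧
      ∀ γ' : ℝ → Circ × ℝ, IsCharacteristic H y (Ioc t₀ t) γ' → γ' t = z →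
        EqOn γ' γ (Ioc t₀ t) := by
  obtain ⟨x, hx⟩ := QuotientAddGroup.mk_surjective z.1
  obtain ⟨ξ, p, T, h1, h2⟩ := hH.exists_isLiftTraj t (x, z.2)
  simp only at h1 h2
  have hzt : ((ξ t : Circ), p t) = z := Prod.ext (by rw [h1]; exact hx) h2
  have hT : IsTrajectory H univ (fun s => ((ξ s : Circ), p s)) := T.isTrajectory
  refine ⟨fun s => ((ξ s : Circ), p s), ⟨⟨hT.mono (subset_univ _), fun s hs => ?_⟩, hzt⟩, ?_⟩
  · exact hy.mem_closure_graph_of_mem hH hs.1 hs.2 (T.mono (subset_univ _)) (hzt ▸ hz)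
  · intro γ' hγ' hγt s hs
    exact IsTrajectory.eqOn_of_eq_right hH
      (hγ'.1.mono fun r hr => ⟨hs.1.trans_le hr.1, hr.2⟩) (hT.mono (subset_univ _))
      (hγt.trans hzt.symm) ⟨le_rfl, hs.2⟩

theorem continuousAt_of_characteristic (hy : IsEntropySolution H t₀ y)
    (hH : IsTonelliHamiltonian H) {t : ℝ} {γ : ℝ → Circ × ℝ}
    (hγ : IsCharacteristic H y (Ioc t₀ t) γ) {s : ℝ} (hs : s ∈ Ioo t₀ t) :
    ContinuousAt (y s) (γ s).1 ∧ y s (γ s).1 = (γ s).2 := by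
  obtain ⟨K, U, P⟩ := hy.exists_potential hH
  obtain ⟨ξ, hξ, T⟩ := isTrajectory_iff.1 hγ.1
  have htm : t ∈ Ioc t₀ t := ⟨hs.1.trans hs.2, le_rfl⟩
  have hz : ((ξ t : Circ), (γ t).2) ∈ closure (graph (y t)) := by
    rw [← hξ t htm]
    exact hγ.2 t htm
  rw [hξ s ⟨hs.1, hs.2.le⟩]
  exact P.continuousAt_of_mem_closure_graph hH hs.1 hs.2
    (T.mono fun r hr => ⟨hs.1.trans_le hr.1, hr.2⟩) hz

theorem exists_unique_characteristic_initial (hy : IsEntropySolution H t₀ y)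
    (hH : IsTonelliHamiltonian H) (hE : y t₀ ∈ classE) {t : ℝ} (ht : t₀ < t) {z : Circ × ℝ}
    (hz : z ∈ closure (graph (y t))) :
    ∃ γ : ℝ → Circ × ℝ, (IsCharacteristic H y (Icc t₀ t) γ ∧ γ t = z) ∧
      (∀ γ' : ℝ → Circ × ℝ, IsCharacteristic H y (Icc t₀ t) γ' → γ' t = z →
        EqOn γ' γ (Icc t₀ t)) ∧
      ContinuousAt (y t₀) (γ t₀).1 ∧ y t₀ (γ t₀).1 = (γ t₀).2 := by
  obtain ⟨K, U, P⟩ := hy.exists_potential hH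
  obtain ⟨x, hx⟩ := QuotientAddGroup.mk_surjective z.1
  obtain ⟨ξ, p, T, h1, h2⟩ := hH.exists_isLiftTraj t (x, z.2)
  simp only at h1 h2
  have hzt : ((ξ t : Circ), p t) = z := Prod.ext (by rw [h1]; exact hx) h2
  have hT : IsTrajectory H univ (fun s => ((ξ s : Circ), p s)) := T.isTrajectory
  have h0 := P.continuousAt_initial_of_mem_closure_graph hH hy hE ht (T.mono (subset_univ _))
    (hzt ▸ hz)
  refine ⟨fun s => ((ξ s : Circ), p s), ⟨⟨hT.mono (subset_univ _), fun s hs => ?_⟩, hzt⟩, ?_, h0⟩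
  · rcases eq_or_lt_of_le hs.1 with rfl | hs1
    · exact subset_closure (mem_graph_of_continuousAt h0.1 h0.2)
    · exact hy.mem_closure_graph_of_mem hH hs1 hs.2 (T.mono (subset_univ _)) (hzt ▸ hz)
  · intro γ' hγ' hγt
    exact IsTrajectory.eqOn_of_eq_right hH hγ'.1 (hT.mono (subset_univ _)) (hγt.trans hzt.symm)

theorem closure_graph_subset_image_flow (hy : IsEntropySolution H t₀ y)
    (hH : IsTonelliHamiltonian H) {t t' : ℝ} (ht : t₀ < t) (htt : t < t') :
    closure (graph (y t')) ⊆ flow hH t t' '' graph (y t) := by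
  intro z hz
  obtain ⟨K, U, P⟩ := hy.exists_potential hH
  obtain ⟨x, hx⟩ := QuotientAddGroup.mk_surjective z.1
  obtain ⟨ξ, p, T, h1, h2⟩ := hH.exists_isLiftTraj t' (x, z.2)
  simp only at h1 h2
  have hzt : ((ξ t' : Circ), p t') = z := Prod.ext (by rw [h1]; exact hx) h2
  have h0 := P.continuousAt_of_mem_closure_graph hH ht htt (T.mono (subset_univ _)) (hzt ▸ hz)
  exact ⟨_, mem_graph_of_continuousAt h0.1 h0.2,
    (hH.flow_eq htt.le (T.mono (subset_univ _))).trans hzt⟩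

theorem closure_graph_subset_image_flow_initial (hy : IsEntropySolution H t₀ y)
    (hH : IsTonelliHamiltonian H) (hE : y t₀ ∈ classE) {t : ℝ} (ht : t₀ < t) :
    closure (graph (y t)) ⊆ flow hH t₀ t '' graph (y t₀) := by
  intro z hz
  obtain ⟨K, U, P⟩ := hy.exists_potential hH
  obtain ⟨x, hx⟩ := QuotientAddGroup.mk_surjective z.1
  obtain ⟨ξ, p, T, h1, h2⟩ := hH.exists_isLiftTraj t (x, z.2)
  simp only at h1 h2
  have hzt : ((ξ t : Circ), p t) = z := Prod.ext (by rw [h1]; exact hx) h2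
  have h0 := P.continuousAt_initial_of_mem_closure_graph hH hy hE ht (T.mono (subset_univ _))
    (hzt ▸ hz)
  exact ⟨_, mem_graph_of_continuousAt h0.1 h0.2,
    (hH.flow_eq ht.le (T.mono (subset_univ _))).trans hzt⟩

/-- Changing the values of an entropy solution on null sets at the initial time. -/
lemma update_initial (hy : IsEntropySolution H t₀ y) {f : Circ → ℝ} (hf : y t₀ =ᵐ[volume] f) :
    IsEntropySolution H t₀ (Function.update y t₀ f) := by
  have hs : ∀ s, Function.update y t₀ f s =ᵐ[volume] y s := fun s => by
    rcases eq_or_ne s t₀ with rfl | h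
    · rw [Function.update_self]; exact hf.symm
    · rw [Function.update_of_ne h]
  have hz : ∀ᵐ z : ℝ × Circ, z.1 ≠ t₀ := by
    have : (volume : Measure (ℝ × Circ)) ({t₀} ×ˢ univ) = 0 := by
      rw [Measure.volume_eq_prod, Measure.prod_prod, measure_singleton, zero_mul]
    rw [ae_iff]
    refine measure_mono_null ?_ this
    intro z hz
    exact ⟨by simpa using hz, mem_univ _⟩
  have hz' : ∀ᵐ z : ℝ × Circ, Function.update y t₀ f z.1 z.2 = y z.1 z.2 := by
    filter_upwards [hz] with z hz
    rw [Function.update_of_ne hz]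
  have hpos : ∀ t > t₀, Function.update y t₀ f t = y t := fun t ht => Function.update_of_ne ht.ne' _ _
  refine ⟨fun t ht => (hy.integrable t ht).congr (hs t).symm, fun t ht => ?_, fun T => ?_,
    fun T => ?_, fun φ hφ => ?_, ?_⟩
  · refine (hy.continuous_L1 t ht).congr fun s => integral_congr_ae ?_
    filter_upwards [hs s, hs t] with x h1 h2
    rw [h1, h2]
  · refine (hy.locInt T).congr_fun_ae (ae_restrict_of_ae ?_)
    filter_upwards [hz'] with z h using h.symm
  · refine (hy.locInt_H T).congr_fun_ae (ae_restrict_of_ae ?_)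
    filter_upwards [hz'] with z h
    rw [h]
  · rw [← hy.weak φ hφ]
    congr 1
    · refine integral_congr_ae (ae_restrict_of_ae ?_)
      filter_upwards [hz'] with z h
      rw [h]
    · refine integral_congr_ae ?_
      filter_upwards [hs t₀] with x h
      rw [h]
  · obtain ⟨K, h1, h2, h3⟩ := hy.oleinik
    refine ⟨K, h1, h2, fun t ht => ?_⟩
    rw [hpos t ht]
    exact h3 t ht

end IsEntropySolution

/-- Every one-sided neighbourhood has positive measure, so it contains points where `f` and `g`
agree. The side limits of `f` exist by monotonicity and must coincide with those of `g`. -/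
lemma UpperLip.graph_subset_of_ae_eq {f g : Circ → ℝ} {K : ℝ} (hf : UpperLip K (fun x : ℝ => f x))
    (hfg : f =ᵐ[volume] g) : graph g ⊆ graph f := by
  have hae : ∀ᵐ x : ℝ, f x = g x := quasiMeasurePreserving_coe.ae hfg
  have hfreq : ∀ (x : ℝ) (s : Set ℝ), (∀ r ∈ 𝓝[s] x, 0 < volume r) →
      ∃ᶠ z : ℝ in 𝓝[s] x, f z = g z := by
    intro x s hs hn
    have h1 := hs _ hn
    have h2 : volume {z : ℝ | ¬ f z = g z} = 0 := hae
    exact h1.ne' h2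
  have hR : ∀ x : ℝ, ∀ r ∈ 𝓝[>] x, 0 < volume r := fun x r hr => by
    obtain ⟨b, hb, hbr⟩ := mem_nhdsGT_iff_exists_Ioo_subset.1 hr
    exact (by simpa using hb : 0 < volume (Ioo x b)).trans_le (measure_mono hbr)
  have hL : ∀ x : ℝ, ∀ r ∈ 𝓝[<] x, 0 < volume r := fun x r hr => by
    obtain ⟨b, hb, hbr⟩ := mem_nhdsLT_iff_exists_Ioo_subset.1 hr
    exact (by simpa using hb : 0 < volume (Ioo b x)).trans_le (measure_mono hbr)
  rintro ⟨x, q⟩ ⟨h1, h2⟩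
  obtain ⟨x, rfl⟩ := QuotientAddGroup.mk_surjective x
  have h1' := tendsto_add_coe_nhdsGT_iff.1 h1
  have h2' := tendsto_add_coe_nhdsLT_iff.1 h2
  obtain ⟨q₁, hq₁, -⟩ := hf.exists_tendsto_right x
  obtain ⟨q₂, hq₂, -⟩ := hf.exists_tendsto_left x
  have e1 := tendsto_nhds_unique_of_frequently_eq hq₁ h1' (hfreq x _ (hR x))
  have e2 := tendsto_nhds_unique_of_frequently_eq hq₂ h2' (hfreq x _ (hL x))
  subst e1
  simp only at e2
  subst e2
  exact ⟨tendsto_add_coe_nhdsGT_iff.2 hq₁, tendsto_add_coe_nhdsLT_iff.2 hq₂⟩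

theorem IsEntropyImage.closure_graph_subset (hH : IsTonelliHamiltonian H) {f g : Circ → ℝ}
    (hf : f ∈ classE) (h : IsEntropyImage H f g) :
    closure (graph g) ⊆ flow hH 0 1 '' graph f := by
  obtain ⟨y, hy, hyf, hyg⟩ := h
  -- The initial value is `f` only almost everywhere, while membership in `classE` and the graph
  -- concern `f` itself.
  have hy' := hy.update_initial hyf
  have h1 : Function.update y 0 f 1 = y 1 := Function.update_of_ne one_ne_zero _ _
  have h0 : Function.update y 0 f 0 = f := Function.update_self _ _ _
  have := hy'.closure_graph_subset_image_flow_initial hH (h0.symm ▸ hf) one_pos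
  rw [h1, h0] at this
  obtain ⟨K, -, -, hK⟩ := hy.oleinik
  exact (closure_mono ((IsEntropySolution.upperLip hK one_pos).graph_subset_of_ae_eq hyg)).trans this

end Burgers

namespace Burgers

/-! ### Calibrated curves and characteristics -/

variable {H : ℝ → Circ → ℝ → ℝ} {t₀ c : ℝ} {K : ℝ → ℝ} {y v : ℝ → Circ → ℝ}

lemma lagrangian_dP (hH : IsTonelliHamiltonian H) (s x p : ℝ) :
    lagrangian H s (x : Circ) (dP (liftHam H) s x p)
      = p * dP (liftHam H) s x p - liftHam H s x p :=
  legendre_deriv_eq (fun p => hH.smooth_one.hasDerivAt_dP s x p) (hH.strictMono_dP s x) p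

lemma deriv_lagrangian_dP (hH : IsTonelliHamiltonian H) (s x p : ℝ) :
    deriv (lagrangian H s (x : Circ)) (dP (liftHam H) s x p) = p :=
  (hasDerivAt_legendre (fun p => hH.smooth_one.hasDerivAt_dP s x p) (hH.strictMono_dP s x)
    (hH.surjective_dP s x) p).deriv

lemma ae_derivWithin_Icc_eq (ξ : ℝ → ℝ) {a b : ℝ} (hab : a ≤ b) :
    ∀ᵐ s, s ∈ uIoc a b → derivWithin ξ (Icc a b) s = deriv ξ s := by
  filter_upwards [compl_mem_ae_iff.2 (measure_singleton (μ := volume) b)] with s hsb hs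
  rw [uIoc_of_le hab] at hs
  exact derivWithin_of_mem_nhds (Icc_mem_nhds hs.1 (lt_of_le_of_ne hs.2 hsb))

/-- On a trajectory, the Lagrangian action is the action of the Hamiltonian. -/
lemma IsLiftTraj.lagrangian_eq (hH : IsTonelliHamiltonian H) {a b : ℝ} (hab : a < b) {ξ p : ℝ → ℝ}
    (T : IsLiftTraj (liftHam H) (Icc a b) ξ p) (c : ℝ) {s : ℝ} (hs : s ∈ Icc a b) :
    lagrangian H s (ξ s : Circ) (derivWithin ξ (Icc a b) s) - c * derivWithin ξ (Icc a b) s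
      = (p s - c) * dP (liftHam H) s (ξ s) (p s) - liftHam H s (ξ s) (p s) := by
  rw [(T s hs).1.derivWithin (uniqueDiffOn_Icc hab s hs), lagrangian_dP hH]
  ring

namespace SemiconcavePotential

lemma isCalibrated_of_trajectory
    (P : SemiconcavePotential (liftHam H) c t₀ K (fun t x => y t (x : Circ))
      (fun t x => v t (x : Circ)))
    (hH : IsTonelliHamiltonian H) {a b : ℝ} (ha : t₀ < a) (hab : a < b) {γ : ℝ → Circ × ℝ}
    (hγ : IsTrajectory H (Icc a b) γ) (hz : ∀ s ∈ Ico a b, γ s ∈ closure (graph (y s))) :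
    IsCalibrated H c v a b γ := by
  obtain ⟨ξ, hξ, T⟩ := isTrajectory_iff.1 hγ
  set p : ℝ → ℝ := fun s => (γ s).2 with hp
  have hcont := T.continuousOn_action_integrand hH.smooth_one c
  have hd : ∀ s ∈ Icc a b, derivWithin ξ (Icc a b) s = dP (liftHam H) s (ξ s) (p s) :=
    fun s hs => (T s hs).1.derivWithin (uniqueDiffOn_Icc hab s hs)
  have hint : ∀ s ∈ Icc a b, lagrangian H s (γ s).1 (derivWithin ξ (Icc a b) s)
      - c * derivWithin ξ (Icc a b) s
      = (p s - c) * dP (liftHam H) s (ξ s) (p s) - liftHam H s (ξ s) (p s) := fun s hs => by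
    rw [hξ s hs]
    exact T.lagrangian_eq hH hab c hs
  have hb : b ∈ Icc a b := ⟨hab.le, le_rfl⟩
  have ham : a ∈ Icc a b := ⟨le_rfl, hab.le⟩
  have hcal : v b (ξ b : Circ) - v a (ξ a : Circ) = action (liftHam H) c ξ p a b := by
    -- Nothing is assumed on the graph at time `b`. The curve is calibrated on `[a, s]` for each `s
    -- < b`, and `s ↑ b` by continuity.
    have h1 : ∀ s ∈ Ioo a b, v s (ξ s : Circ) - v a (ξ a : Circ) = action (liftHam H) c ξ p a s := by
      intro s hs
      refine P.calibrated_of_mem_closure_graph hH ha hs.1.le (T.mono (Icc_subset_Icc_right hs.2.le))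
        ?_ a ⟨le_rfl, hs.1.le⟩
      rw [← hξ s (Ioo_subset_Icc_self hs)]
      exact hz s (Ioo_subset_Ico_self hs)
    have hle : 𝓝[Ioo a b] b ≤ 𝓝[Icc a b] b := nhdsWithin_mono _ Ioo_subset_Icc_self
    have c1 : Tendsto (fun s => v s (ξ s : Circ) - v a (ξ a : Circ)) (𝓝[Ioo a b] b)
        (𝓝 (v b (ξ b : Circ) - v a (ξ a : Circ))) :=
      ((P.continuousOn_along ha.le T.continuousOn_fst b hb).mono_left hle).sub tendsto_const_nhds
    have c2 : Tendsto (fun s => action (liftHam H) c ξ p a s) (𝓝[Ioo a b] b)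
        (𝓝 (action (liftHam H) c ξ p a b)) :=
      (continuousOn_action_right T hH.smooth_one c hab.le b hb).mono_left hle
    have hne : (𝓝[Ioo a b] b).NeBot := by
      rw [nhdsWithin_Ioo_eq_nhdsLT hab]; infer_instance
    exact tendsto_nhds_unique_of_eventuallyEq c1 c2
      (by filter_upwards [self_mem_nhdsWithin] with s hs using h1 s hs)
  refine ⟨ξ, ?_, hξ, ?_, ?_, fun s hs => ?_⟩
  · exact absolutelyContinuousOnInterval_of_hasDerivWithinAt hab.le (fun s hs => (T s hs).1)
      (T.continuousOn_comp (hH.smooth.dP.continuous))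
  · exact (hcont.congr hint).intervalIntegrable_of_Icc hab.le
  · rw [hξ b hb, hξ a ham, ← sub_eq_iff_eq_add', hcal, action]
    refine intervalIntegral.integral_congr fun s hs => ?_
    rw [uIcc_of_le hab.le] at hs
    exact (hint s hs).symm
  · rw [hd s hs, hξ s hs, deriv_lagrangian_dP hH]

lemma exists_isLiftTraj_of_isCalibrated
    (P : SemiconcavePotential (liftHam H) c t₀ K (fun t x => y t (x : Circ))
      (fun t x => v t (x : Circ)))
    (hH : IsTonelliHamiltonian H) {a b : ℝ} (ha : t₀ < a) (hab : a < b) {γ : ℝ → Circ × ℝ}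
    (hγ : IsCalibrated H c v a b γ) :
    ∃ ξ : ℝ → ℝ, (∀ s ∈ Icc a b, (γ s).1 = (ξ s : Circ)) ∧
      IsLiftTraj (liftHam H) (Icc a b) ξ (fun s => (γ s).2) ∧
      v b (ξ b : Circ) - v a (ξ a : Circ) = action (liftHam H) c ξ (fun s => (γ s).2) a b := by
  obtain ⟨ξ, hac, hξ, hi, hcal, hp⟩ := hγ
  have hae := ae_derivWithin_Icc_eq ξ hab.le
  have hae' : ∀ᵐ s, s ∈ uIoc a b →
      lagrangian H s (γ s).1 (derivWithin ξ (Icc a b) s) - c * derivWithin ξ (Icc a b) s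
        = (⨆ q, (q * deriv ξ s - liftHam H s (ξ s) q)) - c * deriv ξ s := by
    filter_upwards [hae] with s hs hmem
    rw [hs hmem, hξ s (uIcc_of_le hab.le ▸ uIoc_subset_uIcc hmem)]
    rfl
  have hb : b ∈ Icc a b := ⟨hab.le, le_rfl⟩
  have ham : a ∈ Icc a b := ⟨le_rfl, hab.le⟩
  have hcal' : v b (ξ b : Circ) - v a (ξ a : Circ)
      = ∫ s in a..b, ((⨆ q, (q * deriv ξ s - liftHam H s (ξ s) q)) - c * deriv ξ s) := by
    rw [← intervalIntegral.integral_congr_ae hae', sub_eq_iff_eq_add', ← hξ b hb, ← hξ a ham]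
    exact hcal
  obtain ⟨p, T, hpa⟩ := P.exists_trajectory_of_calibrated hH.smooth hH.dP_dP_pos hH.convexOn_lift
    hH.surjective_dP ha hab hac
    (hi.congr_ae ((ae_restrict_iff' measurableSet_uIoc).2 hae')) hcal'
  -- The momentum of a calibrated curve is prescribed at every time, end points included, by the
  -- Legendre transform of the one-sided velocity. Having found that `ξ` solves the Hamilton
  -- equations with `p`, this momentum must be `p`.
  have hpe : ∀ s ∈ Icc a b, (γ s).2 = p s := fun s hs => by
    rw [hp s hs, (T s hs).1.derivWithin (uniqueDiffOn_Icc hab s hs), hξ s hs,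
      deriv_lagrangian_dP hH]
  refine ⟨ξ, hξ, T.congr_snd hpe, ?_⟩
  rw [hpa, action, action]
  refine intervalIntegral.integral_congr fun s hs => ?_
  rw [uIcc_of_le hab.le] at hs
  simp only [hpe s hs]

theorem isCalibrated_iff
    (P : SemiconcavePotential (liftHam H) c t₀ K (fun t x => y t (x : Circ))
      (fun t x => v t (x : Circ)))
    (hH : IsTonelliHamiltonian H) {a b : ℝ} (ha : t₀ < a) (hab : a < b) {γ : ℝ → Circ × ℝ} :
    IsCalibrated H c v a b γ ↔
      IsTrajectory H (Icc a b) γ ∧ ∀ s ∈ Ico a b, γ s ∈ closure (graph (y s)) := by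
  refine ⟨fun hγ => ?_, fun h => P.isCalibrated_of_trajectory hH ha hab h.1 h.2⟩
  obtain ⟨ξ, hξ, T, hcal⟩ := P.exists_isLiftTraj_of_isCalibrated hH ha hab hγ
  refine ⟨isTrajectory_iff.2 ⟨ξ, hξ, T⟩, fun s hs => ?_⟩
  -- Calibration restricts to `[s, b]`. For `s < b` the restricted interval is nondegenerate, which
  -- puts the curve on the graph at time `s` but says nothing at `b`.
  have h1 := P.calibrated_sub hH.smooth hH.dP_dP_pos hH.convexOn_lift ha T hcal s
    (Ico_subset_Icc_self hs)
  have h2 := P.continuousAt_of_calibrated hH.smooth hH.dP_dP_pos hH.convexOn_lift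
    (ha.trans_le hs.1) hs.2 (T.mono (Icc_subset_Icc_left hs.1)) h1
  have h3 := mem_graph_of_continuousAt (continuousAt_coe_iff.2 h2.1) h2.2
  have e : γ s = ((ξ s : Circ), (γ s).2) := Prod.ext (hξ s (Ico_subset_Icc_self hs)) rfl
  rw [e]
  exact subset_closure h3

theorem isCharacteristic_iff
    (P : SemiconcavePotential (liftHam H) c t₀ K (fun t x => y t (x : Circ))
      (fun t x => v t (x : Circ)))
    (hH : IsTonelliHamiltonian H) {a b : ℝ} (ha : t₀ < a) (hab : a < b) {γ : ℝ → Circ × ℝ} :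
    IsCharacteristic H y (Icc a b) γ ↔
      IsCalibrated H c v a b γ ∧ γ b ∈ closure (graph (y b)) := by
  rw [P.isCalibrated_iff hH ha hab]
  constructor
  · exact fun h => ⟨⟨h.1, fun s hs => h.2 s (Ico_subset_Icc_self hs)⟩, h.2 b ⟨hab.le, le_rfl⟩⟩
  · rintro ⟨⟨h1, h2⟩, h3⟩
    refine ⟨h1, fun s hs => ?_⟩
    rcases eq_or_lt_of_le hs.2 with rfl | h
    · exact h3
    · exact h2 s ⟨hs.1, h⟩

end SemiconcavePotential

end Burgers

theorem mainTheorem4 (H : ℝ → Circ → ℝ → ℝ) (hH : IsTonelliHamiltonian H) :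
    (∀ (t₀ : ℝ) (y : ℝ → Circ → ℝ), IsEntropySolution H t₀ y →
      -- (i)
      (∀ u : ℝ → Circ → ℝ, IsViscositySolution H (∫ x, y t₀ x) t₀ u →
        IsPotential (∫ x, y t₀ x) t₀ y u →
        ∀ t t' : ℝ, t₀ < t → t < t' → ∀ γ : ℝ → Circ × ℝ,
          (IsCharacteristic H y (Icc t t') γ ↔
            IsCalibrated H (∫ x, y t₀ x) u t t' γ ∧ γ t' ∈ closure (graph (y t'))) ∧
          (IsCalibrated H (∫ x, y t₀ x) u t t' γ ↔
            IsTrajectory H (Icc t t') γ ∧ ∀ s ∈ Ico t t', γ s ∈ closure (graph (y s)))) ∧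
      -- (ii)
      (∀ t > t₀, ∀ z ∈ closure (graph (y t)),
        ∃ γ : ℝ → Circ × ℝ, (IsCharacteristic H y (Ioc t₀ t) γ ∧ γ t = z) ∧
          ∀ γ' : ℝ → Circ × ℝ, IsCharacteristic H y (Ioc t₀ t) γ' → γ' t = z →
            EqOn γ' γ (Ioc t₀ t)) ∧
      -- (iii)
      (∀ t > t₀, ∀ γ : ℝ → Circ × ℝ, IsCharacteristic H y (Ioc t₀ t) γ →
        ∀ s ∈ Ioo t₀ t, ContinuousAt (y s) (γ s).1 ∧ y s (γ s).1 = (γ s).2) ∧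
      -- (iv)
      (y t₀ ∈ classE → ∀ t > t₀, ∀ z ∈ closure (graph (y t)),
        ∃ γ : ℝ → Circ × ℝ, (IsCharacteristic H y (Icc t₀ t) γ ∧ γ t = z) ∧
          (∀ γ' : ℝ → Circ × ℝ, IsCharacteristic H y (Icc t₀ t) γ' → γ' t = z →
            EqOn γ' γ (Icc t₀ t)) ∧
          ContinuousAt (y t₀) (γ t₀).1 ∧ y t₀ (γ t₀).1 = (γ t₀).2) ∧
      -- consequence at positive times
      (∀ t t' : ℝ, t₀ < t → t < t' →
        closure (graph (y t')) ⊆ flow hH t t' '' graph (y t))) ∧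
    -- consequence for the time-one operator
    (∀ f ∈ classE, ∀ g ∈ classE, IsEntropyImage H f g →
      closure (graph g) ⊆ flow hH 0 1 '' graph f) := by
  refine ⟨fun t₀ y hy => ⟨fun v hv hpot t t' ht htt γ => ?_,
    fun t _ z hz => hy.exists_unique_characteristic hH hz,
    fun t _ γ hγ s hs => hy.continuousAt_of_characteristic hH hγ hs,
    fun hE t ht z hz => hy.exists_unique_characteristic_initial hH hE ht hz,
    fun t t' ht htt => hy.closure_graph_subset_image_flow hH ht htt⟩,
    fun f hf g _ h => h.closure_graph_subset hH hf⟩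
  obtain ⟨K, P⟩ := hv.semiconcavePotential hy hH.contDiff.continuous hpot
  exact ⟨SemiconcavePotential.isCharacteristic_iff P hH ht htt,
    SemiconcavePotential.isCalibrated_iff P hH ht htt⟩
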